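/- \textbf{Setting.} Let $m\ge 1$. The ExtendedHyperLogLog sketch has $m$ rows $(C_1[j],C_2[j])$, initially $(0,1)$. Each arriving distinct element carries an independent hash value $(j,\rho)$, with $j$ uniform on the $m$ rows and $\rho$ independent of $j$, $P(\rho=k)=2^{-k}$ for $k\ge1$. If $\rho=C_1[j]+1$, the row becomes $(\rho,1)$; if $\rho>C_1[j]+1$, it becomes $(\rho,0)$; if $\rho=C_1[j]-1$ and $C_2[j]=0$, then $C_2[j]$ is set to $1$; otherwise nothing changes. Let $$Y=\Big(\sum_{j=1}^m 2^{-C_1[j]}+(1-C_2[j])2^{-C_1[j]+1}\Big)^{-1}.$$ $\mathrm{Var}_n$ denotes the variance after $n$ distinct elements, and $\mathrm{Var}_{\mathcal P(\lambda)}$ the variance when the number of distinct elements is Poisson with mean $\lambda$, independent of the hash values. Put $$f(u)=\log_2\tfrac{2+u}{1+u}+\log_2\tfrac{4+3u}{3+3u}-\log_2\tfrac{4+u}{3+u},\quad I_0(m)=\int_0^\infty f(u)^m\,du,\quad I_1(m)=\int_0^\infty u f(u)^m\,du,$$ $$\gamma_m=\frac1{mI_0(m)},\qquad \beta_m=m\Big(\frac{I_1(m)}{I_0(m)^2}-1\Big).$$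 \textbf{Theorem.} $I_0(m)$ converges for $m\ge2$ and $I_1(m)$ for $m\ge3$; for $m\ge 3$ the variable $Y$ has a finite second moment, both for every fixed $n$ and in the Poisson model with any mean. Moreover: (a) For every fixed $m\ge3$, as $x\to\infty$, $$\mathrm{Var}_{\mathcal P(mx)}(Y)=x^2\Big(\int_0^\infty u f(u)^m\,du-\Big(\int_0^\infty f(u)^m\,du\Big)^2+\frac{\epsilon}{m}+o(1)\Big),$$ where $\epsilon=\epsilon(m,x)$ satisfies $|\epsilon|\le 8.4\cdot10^{-5}$. (b) As $m\to\infty$, $$I_0(m)=\frac{\log 8}{2m}\Big(1+\frac1m\Big(\frac{41\log2}{16}-1\Big)+O(m^{-2})\Big),\qquad I_1(m)=\Big(\frac{\log 8}{2m}\Big)^2\Big(1+\frac3m\Big(\frac{41\log2}{16}-1\Big)+O(m^{-2})\Big).$$ (c) For every fixed $m\ge3$, the estimator $\theta=\gamma_m m^2Y$ satisfies, as $n\to\infty$, $$\frac{\mathrm{Var}_n(\theta)}{n^2}=\frac{\beta_m+\epsilon'}{m}+o(1),$$ where $\epsilon'=\epsilon'(m,n)$ satisfies $|\epsilon'|\le10^{-3}$.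 (d) As $m\to\infty$, $\gamma_m\to\frac{2}{3\log2}\approx0.962$ and $\beta_m\to\frac{41\log2}{16}-1\approx0.776$ (both decimals with error less than $5\cdot10^{-4}$). -/

import Mathlib

open MeasureTheory ProbabilityTheory Filter Topology Asymptotics
open scoped NNReal

namespace EHLL

/-- A row of the sketch: the counter `c1` and the bit `c2` (`true` is the bit `1`). -/
structure Cell where
  c1 : ℕ
  c2 : Bool

/-- Update of a row by an incoming geometric value `r`. -/
def Cell.update (c : Cell) (r : ℕ) : Cell :=
  if r = c.c1 + 1 then ⟨r, true⟩
  else if c.c1 + 1 < r then ⟨r, false⟩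
  else if r + 1 = c.c1 ∧ c.c2 = false then ⟨c.c1, true⟩
  else c

/-- The sketch with `m` rows. -/
abbrev Sketch (m : ℕ) := Fin m → Cell

/-- Initially every counter is `0` and every bit is `1`. -/
def Sketch.init (m : ℕ) : Sketch m := fun _ => ⟨0, true⟩

/-- Processing of one element whose hash value gives the row `h.1` and the value `h.2`. -/
def Sketch.insert {m : ℕ} (s : Sketch m) (h : Fin m × ℕ) : Sketch m :=
  Function.update s h.1 ((s h.1).update h.2)

/-- The sketch after a sequence of elements, given by their hash values in order of arrival. -/
def sketchOf {m : ℕ} (l : List (Fin m × ℕ)) : Sketch m :=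
  l.foldl Sketch.insert (Sketch.init m)

/-- The indicator `Y = (∑ⱼ 2^(-C₁[j]) + (1 - C₂[j]) 2^(-C₁[j]+1))⁻¹`. -/
noncomputable def Sketch.Y {m : ℕ} (s : Sketch m) : ℝ :=
  (∑ j, ((2 : ℝ) ^ (-((s j).c1 : ℤ))
    + (1 - if (s j).c2 then 1 else 0) * (2 : ℝ) ^ (-((s j).c1 : ℤ) + 1)))⁻¹

/-- The law `Geo(1/2)` on `{1, 2, 3, …}`: the value `k` has probability `2^(-k)`.
(`geometricMeasure` lives on `{0, 1, 2, …}`.) -/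
noncomputable def geoLaw : Measure ℕ :=
  (geometricMeasure ⟨1 / 2, by norm_num, by norm_num⟩).map (· + 1)

/-- The law of the hash value of an element: a uniform row and an independent `Geo(1/2)` value. -/
noncomputable def hashLaw (m : ℕ) : Measure (Fin m × ℕ) :=
  (uniformOn (Set.univ : Set (Fin m))).prod geoLaw

/-- The law of `Y` after exactly `n` distinct elements (independent hash values). -/
noncomputable def lawY (m n : ℕ) : Measure ℝ :=
  (Measure.pi fun _ : Fin n => hashLaw m).map fun h => (sketchOf (List.ofFn h)).Y

/-- The law of `Y` in the Poisson model: the number of distinct elements is `Pois(lam)`. -/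
noncomputable def poissonLawY (m : ℕ) (lam : ℝ≥0) : Measure ℝ :=
  (poissonMeasure lam).bind (lawY m)

/-- The function `f`. -/
noncomputable def f (u : ℝ) : ℝ :=
  Real.logb 2 ((2 + u) / (1 + u)) + Real.logb 2 ((4 + 3 * u) / (3 + 3 * u))
    - Real.logb 2 ((4 + u) / (3 + u))

noncomputable def I₀ (m : ℕ) : ℝ := ∫ u in Set.Ioi (0 : ℝ), f u ^ m

noncomputable def I₁ (m : ℕ) : ℝ := ∫ u in Set.Ioi (0 : ℝ), u * f u ^ m

/-- The bias correction constant `γ_m`. -/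
noncomputable def biasConst (m : ℕ) : ℝ := 1 / (m * I₀ m)

/-- The variance constant `β_m`. -/
noncomputable def varConst (m : ℕ) : ℝ := m * (I₁ m / I₀ m ^ 2 - 1)

end EHLL

namespace EHLL

/-! Write S = 1/Y and let L be its Laplace transform. Then E[Y] = ∫ L(t) dt and E[Y²] = ∫ t L(t) dt
(`integral_inv_pow_of_laplace`), so everything reduces to L. In the Poisson model with mean x per
row, the probability that every row avoids a prescribed set of values factorises over the rows, and
the state of a row is determined by which values it has avoided (`cell_spec`). Hence L is the m-th
power of a row transform, an explicit sum over the counter k (`rep_rowTerm`,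
`integral_exp_invY_poisson`). With t = xu, extending that sum to all integers k costs an
exponentially small amount and gives the log-periodic function `profile x u`.

Averaged over the scale, the profile is f: one has `profile x u = f u + dev x u`, where `dev` is
built from integrals of `fluct`, a Fourier series with coefficients Γ(1 + 2πil/log 2)/log 2. The
reflection formula gives |Γ(1 + it)|² = πt/sinh(πt), so these coefficients are of order
exp(-π²|l|/log 2) and `dev` is of order 1e-5. This is the source of the nonvanishing but tiny ε and
ε'.

The effect of `dev` on the variance functional must be bounded by about 1e-3/m³, the size of 1e-3/m
times I₀². Since `dev` vanishes at u = 0 a direct perturbation bound gives order 1e-5/m², enough for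
moderate m. For m ≥ 20 the linear part of `dev` at 0 is absorbed into a dilation of f. A dilation
only rescales `varFun f`, which is itself O(m⁻³), and what remains of the deviation is quadratic in
u, which gains a further factor 1/m. The case m = 3 needs sharper pointwise estimates. All of these
rest on the sandwich (1 + au/2)⁻² ≤ f(u) ≤ (1 + au)⁻¹ with a = -f'(0), whose powers integrate in
closed form.

The expansions of I₀ and I₁ come from linearising f^m around (1 + au)^(-m) with the correction
`curv` u²/(1 + au)³. The passage to a fixed number n of elements uses that an insertion never
increases S: the transform after n elements is monotone in n and is squeezed between Poisson
transforms with means n(1 ± o(1)), the Poisson tails being controlled by Chernoff bounds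
(`tendsto_varLap_fixed`). -/

/-! ### Fourier coefficients of the dyadic exponential sum -/

open Complex in
theorem norm_Gamma_one_add_mul_I_sq (t : ℝ) (ht : t ≠ 0) :
    ‖Gamma (1 + t * I)‖ ^ 2 = Real.pi * t / Real.sinh (Real.pi * t) := by
  have h0 : (t * I : ℂ) ≠ 0 := by simp [ht]
  have h1 : Gamma (1 + t * I) = t * I * Gamma (t * I) := by
    rw [add_comm, Gamma_add_one _ h0]
  have h2 : (starRingEnd ℂ) (Gamma (1 + t * I)) = Gamma (1 - t * I) := by
    rw [← Gamma_conj]; congr 1; simp [sub_eq_add_neg]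
  have h3 := Gamma_mul_Gamma_one_sub (t * I)
  have h4 : ((‖Gamma (1 + t * I)‖ ^ 2 : ℝ) : ℂ) = (Real.pi * t / Real.sinh (Real.pi * t) : ℝ) := by
    have := Complex.mul_conj' (Gamma (1 + t * I))
    rw [h2] at this
    push_cast
    rw [← this, h1, mul_assoc, h3]
    have hs : sin (Real.pi * (t * I)) = sinh (Real.pi * t) * I := by
      rw [← mul_assoc, sin_mul_I]
    rw [hs]
    have hne : sinh ((Real.pi : ℂ) * t) ≠ 0 := by
      rw [← ofReal_mul, ← ofReal_sinh]
      exact_mod_cast (Real.sinh_eq_zero.not.2 (mul_ne_zero Real.pi_ne_zero ht))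
    field_simp
  exact_mod_cast h4

/-- The Fourier coefficients of `∑ₖ y 2ᵏ exp (-y 2ᵏ)` as a function of `log₂ y`. -/
noncomputable def harmCoef (l : ℤ) : ℂ :=
  Complex.Gamma (1 + (2 * Real.pi * l / Real.log 2 : ℝ) * Complex.I) / Real.log 2

/-- The profile that is summed over a lattice. -/
noncomputable def gumbelProfile (v : ℝ) : ℂ :=
  (Real.exp (-(Real.log 2 * v)) * Real.exp (-Real.exp (-(Real.log 2 * v))) : ℝ)

theorem continuous_gumbelProfile : Continuous gumbelProfile := by
  unfold gumbelProfile; fun_prop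

-- Γ(1 + iτ) is the Mellin transform of e^(-x) at 1 + iτ. The substitution x = exp(-v log 2) turns
-- it into a Fourier transform, and its Jacobian supplies the factor 1/log 2.
open FourierTransform in
theorem fourier_gumbelProfile (l : ℤ) : 𝓕 gumbelProfile (l : ℝ) = harmCoef l := by
  have hL : (0 : ℝ) < Real.log 2 := Real.log_pos (by norm_num)
  set L := Real.log 2 with hLdef
  have h1 : Complex.Gamma (1 + (2 * Real.pi * l / L : ℝ) * Complex.I)
      = mellin (fun x => ((Real.exp (-x) : ℝ) : ℂ)) (1 + (2 * Real.pi * l / L : ℝ) * Complex.I) := by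
    rw [Complex.Gamma_eq_integral (by simp), Complex.GammaIntegral_eq_mellin]
  rw [harmCoef, h1, mellin_eq_fourier, Real.fourier_real_eq_integral_exp_smul,
    Real.fourier_real_eq_integral_exp_smul]
  have := Measure.integral_comp_mul_left (fun y : ℝ =>
    Complex.exp ((-2 * Real.pi * y * ((1 + (2 * Real.pi * l / L : ℝ) * Complex.I).im
      / (2 * Real.pi)) : ℝ) * Complex.I) • Real.exp (-(1 + (2 * Real.pi * l / L : ℝ)
        * Complex.I).re * y) • ((Real.exp (-Real.exp (-y)) : ℝ) : ℂ)) L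
  rw [abs_of_pos (by positivity)] at this
  rw [eq_div_iff (by exact_mod_cast hL.ne'), mul_comm]
  have h2 : ∀ z w : ℂ, z = L⁻¹ • w → (L : ℂ) * z = w := by
    rintro z w rfl
    have : (L : ℂ) ≠ 0 := by exact_mod_cast hL.ne'
    rw [Complex.real_smul]; push_cast
    field_simp
  apply h2
  rw [← this]
  congr 1 with v
  simp only [gumbelProfile, ← hLdef]
  congr 2
  · congr 2
    simp
    field_simp
  · simp

/-- The profile decays exponentially at +∞ and doubly exponentially at -∞. The exponent -2 is just a
convenient one below -1 for Poisson summation. -/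
theorem gumbelProfile_isBigO :
    gumbelProfile =O[cocompact ℝ] fun v : ℝ => |v| ^ (-2 : ℝ) := by
  have hL : (0 : ℝ) < Real.log 2 := Real.log_pos (by norm_num)
  have key : ∀ v : ℝ, ‖gumbelProfile v‖ * v ^ 2 ≤ 6 / Real.log 2 ^ 2 := by
    intro v
    set w := Real.log 2 * v with hw
    have h1 : Real.exp (-w) * Real.exp (-Real.exp (-w)) * w ^ 2 ≤ 6 := by
      rcases le_total 0 w with h | h
      · have e1 : Real.exp (-Real.exp (-w)) ≤ 1 := Real.exp_le_one_iff.2 (by simp [Real.exp_nonneg])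
        have e2 : w ^ 2 / 2 ≤ Real.exp w := by
          have := Real.quadratic_le_exp_of_nonneg h; linarith
        have e3 : Real.exp (-w) * Real.exp w = 1 := by rw [← Real.exp_add]; simp
        have e4 : Real.exp (-w) * w ^ 2 ≤ 2 := by
          have := mul_le_mul_of_nonneg_left e2 (Real.exp_nonneg (-w)); nlinarith
        have e5 := Real.exp_nonneg (-w)
        have e6 : 0 ≤ Real.exp (-w) * w ^ 2 := by positivity
        nlinarith [mul_le_mul_of_nonneg_left e1 e6]
      · set y := Real.exp (-w) with hy
        have hy1 : 1 ≤ y := Real.one_le_exp (by linarith)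
        have hwy : -w ≤ y := by have := Real.add_one_le_exp (-w); linarith
        have e1 : y ^ 3 / 6 ≤ Real.exp y := by
          have := Real.pow_div_factorial_le_exp (x := y) (by linarith) 3
          simpa [Nat.factorial] using this
        have e3 : Real.exp (-y) * Real.exp y = 1 := by rw [← Real.exp_add]; simp
        have e4 : w ^ 2 ≤ y ^ 2 := by nlinarith
        have e5 := mul_le_mul_of_nonneg_left e1 (Real.exp_nonneg (-y))
        calc y * Real.exp (-y) * w ^ 2 ≤ y * Real.exp (-y) * y ^ 2 := by gcongr
          _ = 6 * (Real.exp (-y) * (y ^ 3 / 6)) := by ring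
          _ ≤ 6 := by linarith
    have h2 : ‖gumbelProfile v‖ = Real.exp (-w) * Real.exp (-Real.exp (-w)) := by
      rw [gumbelProfile, Complex.norm_real, Real.norm_of_nonneg (by positivity)]
    rw [h2, le_div_iff₀ (by positivity)]
    calc _ = Real.exp (-w) * Real.exp (-Real.exp (-w)) * w ^ 2 := by rw [hw]; ring
      _ ≤ 6 := h1
  refine IsBigO.of_bound (6 / Real.log 2 ^ 2) ?_
  have : ∀ᶠ v : ℝ in cocompact ℝ, v ≠ 0 := by
    have := (isCompact_singleton (x := (0 : ℝ))).compl_mem_cocompact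
    filter_upwards [this] with v hv using by simpa using hv
  filter_upwards [this] with v hv
  have h3 : ‖|v| ^ (-2 : ℝ)‖ = (v ^ 2)⁻¹ := by
    rw [Real.norm_of_nonneg (by positivity), Real.rpow_neg (abs_nonneg v)]
    norm_cast
    simp
  rw [h3, ← div_eq_mul_inv, le_div_iff₀ (by positivity)]
  exact key v

theorem log_two_bounds : 0.693147 < Real.log 2 ∧ Real.log 2 < 0.693148 :=
  ⟨by linarith [Real.log_two_gt_d9], by linarith [Real.log_two_lt_d9]⟩

/-- For t = 2πl/log 2 one has πt = 2Pl with P = π²/log 2, so the l-th coefficient decays like √l ·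
e^(-Pl). Hence the numerical control of P and of e^(-P). -/
theorem pi_sq_div_log_two_gt : 14.2387 < Real.pi ^ 2 / Real.log 2 := by
  have h := log_two_bounds
  rw [lt_div_iff₀ (by linarith)]
  nlinarith [Real.pi_gt_d6]

theorem exp_neg_lt : Real.exp (-14.2387) < 6.552e-7 := by
  have h1 : (2.7182818283 : ℝ) ^ 14 ≤ Real.exp 14 := by
    have := Real.exp_one_gt_d9
    calc (2.7182818283 : ℝ) ^ 14 ≤ Real.exp 1 ^ 14 := by gcongr
      _ = Real.exp 14 := by rw [← Real.exp_nat_mul]; norm_num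
  have h2 : 1 + 0.2387 + 0.2387 ^ 2 / 2 + 0.2387 ^ 3 / 6 ≤ Real.exp 0.2387 := by
    have := Real.sum_le_exp_of_nonneg (x := 0.2387) (by norm_num) 4
    norm_num [Finset.sum_range_succ, Nat.factorial] at this ⊢
    linarith
  have h3 : Real.exp 14.2387 = Real.exp 14 * Real.exp 0.2387 := by
    rw [← Real.exp_add]; norm_num
  rw [Real.exp_neg, inv_lt_comm₀ (by positivity) (by norm_num), h3]
  calc (6.552e-7 : ℝ)⁻¹ < (2.7182818283 : ℝ) ^ 14 * (1 + 0.2387 + 0.2387 ^ 2 / 2 + 0.2387 ^ 3 / 6) := by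
        norm_num
    _ ≤ _ := by gcongr

/-- The squared norm is (z/sinh z)/log² 2 with z = 2P|l|. For |l| = 1 this gives about 2√P ·
e^(-P)/log 2, just below 7.14e-6. The true factor √|l| is relaxed to |l|. -/
theorem norm_harmCoef_le (l : ℤ) (hl : l ≠ 0) :
    ‖harmCoef l‖ ≤ 7.14e-6 * (l.natAbs * (6.552e-7) ^ (l.natAbs - 1)) := by
  obtain ⟨n, hn⟩ : ∃ n : ℕ, l.natAbs = n + 1 := ⟨l.natAbs - 1, by omega⟩
  have hlog := log_two_bounds
  have hL : (0 : ℝ) < Real.log 2 := by linarith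
  set t : ℝ := 2 * Real.pi * l / Real.log 2 with ht
  have hlr : (l : ℝ) ≠ 0 := by exact_mod_cast hl
  have ht0 : t ≠ 0 := by
    rw [ht]; have := Real.pi_pos; positivity
  have habs : |(l : ℝ)| = n + 1 := by
    have : ((l.natAbs : ℤ) : ℝ) = |(l : ℝ)| := by rw [Int.natCast_natAbs]; push_cast; rfl
    rw [← this, hn]; push_cast; ring
  set P : ℝ := Real.pi ^ 2 / Real.log 2 with hP
  have hP1 : 14.2387 < P := pi_sq_div_log_two_gt
  have hP2 : P < 14.2389 := by
    rw [hP, div_lt_iff₀ hL]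
    nlinarith [Real.pi_lt_d6, Real.pi_pos]
  have hsq : ‖harmCoef l‖ ^ 2 = (2 * P * (n + 1) / Real.sinh (2 * P * (n + 1))) / Real.log 2 ^ 2 := by
    rw [harmCoef, norm_div, div_pow, norm_Gamma_one_add_mul_I_sq t ht0, Complex.norm_real,
      Real.norm_of_nonneg hL.le]
    congr 1
    have e : Real.pi * t = 2 * P * l := by rw [ht, hP]; field_simp
    rw [e]
    rcases abs_cases (l : ℝ) with ⟨h, _⟩ | ⟨h, _⟩
    · rw [← h, habs]
    · have : (l : ℝ) = -((n : ℝ) + 1) := by linarith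
      rw [this, mul_neg, Real.sinh_neg, neg_div_neg_eq]
  set z := 2 * P * ((n : ℝ) + 1) with hz
  have hz28 : 28 ≤ z := by rw [hz]; nlinarith [Nat.cast_nonneg (α := ℝ) n]
  -- Since z ≥ 28, the term e^(-z) in sinh is absorbed by lowering 1/2 to 0.4999.
  have hsinh : 0.4999 * Real.exp z ≤ Real.sinh z := by
    rw [Real.sinh_eq]
    have e1 : Real.exp (-z) ≤ 1 := Real.exp_le_one_iff.2 (by linarith)
    have e2 : z ^ 3 / 6 ≤ Real.exp z := by
      have := Real.pow_div_factorial_le_exp (x := z) (by linarith) 3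
      simpa [Nat.factorial] using this
    have e3 : (28 : ℝ) ^ 4 / 24 ≤ Real.exp z := by
      have := Real.pow_div_factorial_le_exp (x := z) (by linarith) 4
      have h4 : (28 : ℝ) ^ 4 ≤ z ^ 4 := by gcongr
      simp [Nat.factorial] at this
      linarith
    norm_num at e3
    linarith
  have hexp : Real.exp z = (Real.exp P ^ (n + 1)) ^ 2 := by
    rw [← Real.exp_nat_mul, ← Real.exp_nat_mul]; congr 1; rw [hz]; push_cast; ring
  have hE : (6.552e-7 : ℝ)⁻¹ ≤ Real.exp P := by
    have h1 : Real.exp (-P) < 6.552e-7 :=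
      lt_of_le_of_lt (Real.exp_le_exp.2 (by linarith)) exp_neg_lt
    rw [Real.exp_neg] at h1
    exact inv_le_of_inv_le₀ (Real.exp_pos P) h1.le
  have hE2 : ((6.552e-7 : ℝ)⁻¹ ^ (n + 1)) ^ 2 ≤ Real.exp z := by
    rw [hexp]; gcongr
  rw [hn, Nat.add_sub_cancel]
  refine le_of_sq_le_sq ?_ (by positivity)
  rw [hsq, div_le_iff₀ (by positivity), div_le_iff₀ (by linarith [Real.exp_pos z])]
  have hn1 : (1 : ℝ) ≤ n + 1 := by linarith [Nat.cast_nonneg (α := ℝ) n]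
  have hcancel : (6.552e-7 : ℝ) ^ n * (6.552e-7 : ℝ)⁻¹ ^ (n + 1) = (6.552e-7 : ℝ)⁻¹ := by
    rw [pow_succ, ← mul_assoc, ← mul_pow, mul_inv_cancel₀ (by norm_num), one_pow, one_mul]
  calc z ≤ 28.4778 * (n + 1) ^ 2 := by rw [hz]; nlinarith
    _ ≤ (7.14e-6) ^ 2 * (n + 1) ^ 2 * ((6.552e-7 : ℝ)⁻¹) ^ 2 * 0.693147 ^ 2 * 0.4999 := by
        have : (28.4778 : ℝ) ≤ (7.14e-6) ^ 2 * ((6.552e-7 : ℝ)⁻¹) ^ 2 * 0.693147 ^ 2 * 0.4999 := by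
          norm_num
        nlinarith [sq_nonneg ((n : ℝ) + 1)]
    _ = (7.14e-6 * (((n + 1 : ℕ) : ℝ) * 6.552e-7 ^ n)) ^ 2 * 0.693147 ^ 2 *
          (0.4999 * ((6.552e-7 : ℝ)⁻¹ ^ (n + 1)) ^ 2) := by
        generalize (6.552e-7 : ℝ)⁻¹ = w at *
        generalize (6.552e-7 : ℝ) = v at *
        push_cast
        linear_combination (-((7.14e-6) ^ 2 * ((n : ℝ) + 1) ^ 2 * 0.693147 ^ 2 * 0.4999)) *
          congrArg (· ^ 2) hcancel
    _ ≤ (7.14e-6 * (((n + 1 : ℕ) : ℝ) * 6.552e-7 ^ n)) ^ 2 * Real.log 2 ^ 2 * Real.sinh z := by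
        have : 0.4999 * ((6.552e-7 : ℝ)⁻¹ ^ (n + 1)) ^ 2 ≤ Real.sinh z := by linarith
        gcongr
        exact hlog.1.le
    _ = _ := by ring

theorem hasSum_geometric_int {r : ℝ} (h0 : 0 ≤ r) (h1 : r < 1) :
    HasSum (fun l : ℤ => if l = 0 then 0 else r ^ (l.natAbs - 1)) (2 / (1 - r)) := by
  set F : ℤ → ℝ := fun l => if l = 0 then 0 else r ^ (l.natAbs - 1) with hF
  have hg := hasSum_geometric_of_lt_one h0 h1
  have e2 : ∀ n : ℕ, F ((n + 1 : ℕ) : ℤ) = r ^ n := fun n => by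
    simp only [hF]
    rw [if_neg (by omega), Int.natAbs_natCast, Nat.add_sub_cancel]
  have e3 : ∀ n : ℕ, F (-((n : ℤ) + 1)) = r ^ n := fun n => by
    simp only [hF]
    rw [if_neg (by omega), Int.natAbs_neg, show ((n : ℤ) + 1).natAbs = n + 1 by omega,
      Nat.add_sub_cancel]
  have h2 : HasSum (fun n : ℕ => F n) (1 - r)⁻¹ := by
    rw [← hasSum_nat_add_iff' 1]
    simp_rw [e2]
    simpa [hF] using hg
  have h3 : HasSum (fun n : ℕ => F (-((n : ℤ) + 1))) (1 - r)⁻¹ := by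
    simp_rw [e3]; exact hg
  have h4 := HasSum.of_nat_of_neg_add_one h2 h3
  rwa [← two_mul, ← div_eq_mul_inv] at h4

theorem harmCoef_zero : harmCoef 0 = (1 / Real.log 2 : ℝ) := by
  simp [harmCoef]

/-- The frequency `2πl / log 2`. -/
noncomputable def freq (l : ℤ) : ℝ := 2 * Real.pi * l / Real.log 2

theorem natCast_le_two_pow_pred {n : ℕ} (hn : n ≠ 0) : (n : ℝ) ≤ 2 ^ (n - 1) := by
  obtain ⟨k, rfl⟩ := Nat.exists_eq_succ_of_ne_zero hn
  have : k + 1 ≤ 2 ^ k := Nat.lt_two_pow_self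
  simp only [Nat.succ_eq_add_one, Nat.add_sub_cancel]
  exact_mod_cast this

/-- The factor |l| ≤ 2^(|l|-1) goes into the ratio. The ratio 1e-5 is generous, since only the first
harmonic matters. -/
theorem norm_harmCoef_le_geom (l : ℤ) (hl : l ≠ 0) :
    ‖harmCoef l‖ ≤ 7.14e-6 * (1e-5) ^ (l.natAbs - 1) := by
  refine (norm_harmCoef_le l hl).trans ?_
  have h := natCast_le_two_pow_pred (Int.natAbs_ne_zero.2 hl)
  gcongr
  calc (l.natAbs : ℝ) * 6.552e-7 ^ (l.natAbs - 1)
      ≤ 2 ^ (l.natAbs - 1) * 6.552e-7 ^ (l.natAbs - 1) := by gcongr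
    _ = (2 * 6.552e-7) ^ (l.natAbs - 1) := by rw [mul_pow]
    _ ≤ _ := by gcongr; norm_num

theorem abs_freq (l : ℤ) : |freq l| = 2 * Real.pi / Real.log 2 * l.natAbs := by
  have hL : (0 : ℝ) < Real.log 2 := Real.log_pos (by norm_num)
  rw [freq, abs_div, abs_mul, abs_of_pos hL, abs_of_pos (by have := Real.pi_pos; positivity),
    Nat.cast_natAbs, Int.cast_abs]
  ring

theorem freq_bounds : 9.0646 < 2 * Real.pi / Real.log 2 ∧ 2 * Real.pi / Real.log 2 < 9.0648 := by
  have h := log_two_bounds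
  constructor
  · rw [lt_div_iff₀ (by linarith)]; linarith [Real.pi_gt_d6]
  · rw [div_lt_iff₀ (by linarith)]; linarith [Real.pi_lt_d6]

/-- The number 9.12 bounds √(1 + (2π/log 2)²). These products are the Lipschitz constants of the
harmonics in the variable 1/c. -/
theorem norm_harmCoef_mul_le_geom (l : ℤ) (hl : l ≠ 0) :
    ‖harmCoef l‖ * ‖1 + freq l * Complex.I‖ ≤ 7.14e-6 * 9.12 * (1e-5) ^ (l.natAbs - 1) := by
  have h1 : ‖1 + freq l * Complex.I‖ ≤ 9.12 * l.natAbs := by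
    refine le_of_sq_le_sq ?_ (by positivity)
    rw [← Complex.normSq_eq_norm_sq, Complex.normSq_apply]
    have hf := freq_bounds
    have h2 : freq l ^ 2 = (2 * Real.pi / Real.log 2) ^ 2 * l.natAbs ^ 2 := by
      rw [← sq_abs, abs_freq, mul_pow]
    have h3 : (1 : ℝ) ≤ l.natAbs := by
      exact_mod_cast Nat.one_le_iff_ne_zero.2 (Int.natAbs_ne_zero.2 hl)
    have h4 : (2 * Real.pi / Real.log 2) ^ 2 ≤ 9.0648 ^ 2 := by
      have := hf.1; gcongr; exact hf.2.le
    have h5 : (1 : ℝ) ≤ (l.natAbs : ℝ) ^ 2 := by nlinarith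
    have h6 : (1 + freq l * Complex.I).re * (1 + freq l * Complex.I).re
        + (1 + freq l * Complex.I).im * (1 + freq l * Complex.I).im = 1 + freq l ^ 2 := by
      simp; ring
    rw [h6, h2]
    nlinarith [mul_le_mul_of_nonneg_right h4 (sq_nonneg (l.natAbs : ℝ))]
  have h := natCast_le_two_pow_pred (Int.natAbs_ne_zero.2 hl)
  calc ‖harmCoef l‖ * ‖1 + freq l * Complex.I‖
      ≤ (7.14e-6 * (l.natAbs * (6.552e-7) ^ (l.natAbs - 1))) * (9.12 * l.natAbs) := by
        gcongr; exact norm_harmCoef_le l hl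
    _ = 7.14e-6 * 9.12 * ((l.natAbs * l.natAbs) * (6.552e-7) ^ (l.natAbs - 1)) := by ring
    _ ≤ 7.14e-6 * 9.12 * ((2 ^ (l.natAbs - 1) * 2 ^ (l.natAbs - 1))
          * (6.552e-7) ^ (l.natAbs - 1)) := by gcongr
    _ = 7.14e-6 * 9.12 * (2 * 2 * 6.552e-7) ^ (l.natAbs - 1) := by rw [mul_pow, mul_pow]
    _ ≤ _ := by gcongr; norm_num

theorem summable_harmCoef : Summable fun l : ℤ => ‖harmCoef l‖ := by
  have h := (hasSum_geometric_int (r := 1e-5) (by norm_num) (by norm_num)).summable.mul_left 7.14e-6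
  refine (h.add (summable_of_ne_finset_zero (f := fun l : ℤ => if l = 0 then ‖harmCoef 0‖ else 0)
    (s := {0}) (by intro b hb; exact if_neg (by simpa using hb)))).of_nonneg_of_le (fun _ => norm_nonneg _) ?_
  intro l
  by_cases hl : l = 0
  · simp [hl]
  · simp only [hl, if_false, add_zero]; exact norm_harmCoef_le_geom l hl

/-- Poisson summation for the profile over the lattice ℤ - log₂ y. -/
theorem tsum_gumbel (y : ℝ) (hy : 0 < y) :
    ((∑' k : ℤ, y * 2 ^ k * Real.exp (-(y * 2 ^ k)) : ℝ) : ℂ)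
      = ∑' l : ℤ, harmCoef l * Complex.exp (-(freq l * Real.log y * Complex.I)) := by
  have hL : (0 : ℝ) < Real.log 2 := Real.log_pos (by norm_num)
  have hsum : Summable fun n : ℤ => FourierTransform.fourier gumbelProfile (n : ℝ) := by
    simp_rw [fourier_gumbelProfile]
    exact summable_harmCoef.of_norm
  have h := Real.tsum_eq_tsum_fourier_of_rpow_decay_of_summable continuous_gumbelProfile
    (by norm_num : (1 : ℝ) < 2) gumbelProfile_isBigO hsum (-(Real.log y / Real.log 2))
  simp_rw [fourier_gumbelProfile] at h
  have e1 : ∀ l : ℤ, harmCoef l * Complex.exp (-(freq l * Real.log y * Complex.I))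
      = harmCoef l * fourier l ((-(Real.log y / Real.log 2) : ℝ) : UnitAddCircle) := by
    intro l
    rw [fourier_coe_apply]
    congr 2
    rw [freq]; push_cast; ring
  simp_rw [e1, ← h]
  rw [Complex.ofReal_tsum, ← (Equiv.neg ℤ).tsum_eq]
  congr 1 with k
  simp only [gumbelProfile, Equiv.neg_apply]
  congr 2
  all_goals
    have : -(Real.log 2 * (-(Real.log y / Real.log 2) + (k : ℝ))) = Real.log y + (-k : ℤ) * Real.log 2 := by
      push_cast; field_simp
      ring
    rw [this, Real.exp_add, Real.exp_log hy, ← Real.log_zpow, Real.exp_log (by positivity)]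

/-! ### Size, regularity and scaling of the fluctuation -/

/-- The fluctuation of `∑ₖ x 2ᵏ exp (-c x 2ᵏ)` around its mean `1 / (c log 2)`. -/
noncomputable def fluct (x c : ℝ) : ℝ :=
  (∑' k : ℤ, x * 2 ^ k * Real.exp (-(c * (x * 2 ^ k)))) - 1 / (c * Real.log 2)

/-- The oscillating factor `c^(-1-iτ)`. -/
noncomputable def osc (τ c : ℝ) : ℂ := Complex.exp (-(τ * Real.log c * Complex.I)) / c

theorem norm_cexp_ofReal_mul_I_neg (r : ℝ) : ‖Complex.exp (-(r * Complex.I))‖ = 1 := by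
  rw [← neg_mul, ← Complex.ofReal_neg, Complex.norm_exp_ofReal_mul_I]

theorem norm_osc (τ c : ℝ) (hc : 0 < c) : ‖osc τ c‖ = 1 / c := by
  rw [osc, norm_div, ← Complex.ofReal_mul, norm_cexp_ofReal_mul_I_neg, Complex.norm_real,
    Real.norm_of_nonneg hc.le]

/-- In the variable w = 1/c the factor is w^(1+iτ), whose derivative has constant modulus |1 + iτ|;
the mean value inequality applies on the half-line. -/
theorem norm_osc_sub_le (τ : ℝ) {a b : ℝ} (ha : 0 < a) (hb : 0 < b) :
    ‖osc τ a - osc τ b‖ ≤ ‖1 + τ * Complex.I‖ * |1 / a - 1 / b| := by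
  have hE : ∀ w ∈ Set.Ioi (0 : ℝ), HasDerivWithinAt
      (fun w : ℝ => Complex.exp (τ * Real.log w * Complex.I) * (w : ℂ))
      ((1 + τ * Complex.I) * Complex.exp (τ * Real.log w * Complex.I)) (Set.Ioi 0) w := by
    intro w hw
    have hw' : w ≠ 0 := ne_of_gt hw
    have hwc : (w : ℂ) ≠ 0 := by exact_mod_cast hw'
    have h1 : HasDerivAt (fun w : ℝ => ((Real.log w : ℝ) : ℂ)) ((w⁻¹ : ℝ) : ℂ) w :=
      (Real.hasDerivAt_log hw').ofReal_comp
    have h2 : HasDerivAt (fun w : ℝ => (w : ℂ)) ((1 : ℝ) : ℂ) w := (hasDerivAt_id w).ofReal_comp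
    have h3 := (((h1.const_mul (τ : ℂ)).mul_const Complex.I).cexp).mul h2
    refine (h3.congr_deriv ?_).hasDerivWithinAt
    push_cast
    field_simp
    ring
  have hn : ∀ w ∈ Set.Ioi (0 : ℝ),
      ‖(1 + τ * Complex.I) * Complex.exp (τ * Real.log w * Complex.I)‖ ≤ ‖1 + τ * Complex.I‖ := by
    intro w _
    rw [norm_mul, ← Complex.ofReal_mul, Complex.norm_exp_ofReal_mul_I, mul_one]
  have key := (convex_Ioi (0 : ℝ)).norm_image_sub_le_of_norm_hasDerivWithin_le hE hn
    (Set.mem_Ioi.2 (inv_pos.2 hb)) (Set.mem_Ioi.2 (inv_pos.2 ha))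
  have e : ∀ c : ℝ, osc τ c
      = Complex.exp (τ * Real.log c⁻¹ * Complex.I) * ((c⁻¹ : ℝ) : ℂ) := by
    intro c
    rw [osc, Real.log_inv, div_eq_mul_inv]
    push_cast
    ring_nf
  rw [e a, e b, one_div, one_div, ← Real.norm_eq_abs]
  exact key

theorem continuousOn_osc (τ : ℝ) : ContinuousOn (osc τ) (Set.Ioi 0) := by
  unfold osc
  refine ContinuousOn.div ?_ (by fun_prop) (fun c hc => by exact_mod_cast (ne_of_gt hc))
  refine ContinuousOn.cexp (ContinuousOn.neg (ContinuousOn.mul (ContinuousOn.mul (by fun_prop) ?_)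
    (by fun_prop)))
  exact Complex.continuous_ofReal.comp_continuousOn
    (Real.continuousOn_log.mono fun c hc => ne_of_gt hc)

/-- The primitive (i/τ) c^(-iτ) has constant modulus, so the bound does not depend on the length of
the interval. -/
theorem norm_integral_osc_le (τ : ℝ) (hτ : τ ≠ 0) {a b : ℝ} (ha : 0 < a) (hb : 0 < b) :
    ‖∫ c in a..b, osc τ c‖ ≤ 2 / |τ| := by
  have hτc : (τ : ℂ) ≠ 0 := by exact_mod_cast hτ
  have hsub : Set.uIcc a b ⊆ Set.Ioi 0 := fun c hc =>
    lt_of_lt_of_le (lt_min ha hb) hc.1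
  have hd : ∀ c ∈ Set.uIcc a b, HasDerivAt
      (fun c : ℝ => Complex.exp (-(τ * Real.log c * Complex.I)) * (Complex.I / τ)) (osc τ c) c := by
    intro c hc
    have hc0 : c ≠ 0 := ne_of_gt (hsub hc)
    have hcc : (c : ℂ) ≠ 0 := by exact_mod_cast hc0
    have h1 : HasDerivAt (fun w : ℝ => ((Real.log w : ℝ) : ℂ)) ((c⁻¹ : ℝ) : ℂ) c :=
      (Real.hasDerivAt_log hc0).ofReal_comp
    have h3 := ((((h1.const_mul (τ : ℂ)).mul_const Complex.I).neg).cexp).mul_const (Complex.I / τ)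
    refine h3.congr_deriv ?_
    rw [osc, Pi.neg_apply]
    push_cast
    field_simp
    linear_combination (-1) * Complex.I_sq
  rw [intervalIntegral.integral_eq_sub_of_hasDerivAt hd
    ((continuousOn_osc τ).mono hsub).intervalIntegrable, ← sub_mul, norm_mul, norm_div,
    Complex.norm_I, Complex.norm_real, Real.norm_eq_abs, mul_one_div]
  gcongr
  refine (norm_sub_le _ _).trans ?_
  rw [← Complex.ofReal_mul, ← Complex.ofReal_mul, norm_cexp_ofReal_mul_I_neg,
    norm_cexp_ofReal_mul_I_neg]
  norm_num

/-- The `l`-th harmonic of `fluct x`. -/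
noncomputable def harm (x : ℝ) (l : ℤ) (c : ℝ) : ℂ :=
  if l = 0 then 0 else harmCoef l * Complex.exp (-(freq l * Real.log x * Complex.I)) * osc (freq l) c

theorem norm_harm_le (x : ℝ) (l : ℤ) {c : ℝ} (hc : 0 < c) :
    ‖harm x l c‖ ≤ 7.14e-6 * (if l = 0 then 0 else (1e-5) ^ (l.natAbs - 1)) / c := by
  rw [harm]
  split_ifs with hl
  · simp
  · rw [norm_mul, norm_mul, norm_osc _ _ hc, ← Complex.ofReal_mul, norm_cexp_ofReal_mul_I_neg,
      mul_one, mul_one_div]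
    gcongr
    exact norm_harmCoef_le_geom l hl

theorem hasSum_geom_majorant (K : ℝ) :
    HasSum (fun l : ℤ => K * (if l = 0 then 0 else (1e-5 : ℝ) ^ (l.natAbs - 1)))
      (K * (2 / (1 - 1e-5))) :=
  (hasSum_geometric_int (by norm_num) (by norm_num)).mul_left K

theorem summable_harm (x : ℝ) {c : ℝ} (hc : 0 < c) : Summable fun l => harm x l c :=
  .of_norm_bounded ((hasSum_geom_majorant 7.14e-6).summable.div_const c)
    fun l => norm_harm_le x l hc

/-- This is the Fourier series of `tsum_gumbel` at y = cx divided by c; its zeroth term is exactly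
the mean that `fluct` subtracts. -/
theorem fluct_eq_tsum {x c : ℝ} (hx : 0 < x) (hc : 0 < c) :
    (fluct x c : ℂ) = ∑' l : ℤ, harm x l c := by
  have hL : Real.log 2 ≠ 0 := (Real.log_pos (by norm_num)).ne'
  have hcc : (c : ℂ) ≠ 0 := by exact_mod_cast hc.ne'
  have h := tsum_gumbel (c * x) (by positivity)
  have e1 : ∀ l : ℤ, harmCoef l * Complex.exp (-(freq l * Real.log (c * x) * Complex.I))
      = c * (harm x l c + if l = 0 then ((1 / (c * Real.log 2) : ℝ) : ℂ) else 0) := by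
    intro l
    rw [harm]
    split_ifs with hl
    · subst hl
      have : freq 0 = 0 := by simp [freq]
      rw [harmCoef_zero, this]
      push_cast
      simp
      field_simp
    · rw [osc, Real.log_mul hc.ne' hx.ne', add_zero]
      have : Complex.exp (-(freq l * ((Real.log c + Real.log x : ℝ) : ℂ) * Complex.I))
          = Complex.exp (-(freq l * Real.log x * Complex.I))
            * Complex.exp (-(freq l * Real.log c * Complex.I)) := by
        rw [← Complex.exp_add]; congr 1; push_cast; ring
      rw [this]
      field_simp
  have e2 : (∑' k : ℤ, c * x * 2 ^ k * Real.exp (-(c * x * 2 ^ k)))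
      = c * ∑' k : ℤ, x * 2 ^ k * Real.exp (-(c * (x * 2 ^ k))) := by
    rw [← tsum_mul_left]; congr 1 with k; ring_nf
  have hs0 : HasSum (fun l : ℤ => if l = 0 then ((1 / (c * Real.log 2) : ℝ) : ℂ) else 0)
      ((1 / (c * Real.log 2) : ℝ) : ℂ) := hasSum_ite_eq 0 _
  simp_rw [e1] at h
  rw [e2, tsum_mul_left, (summable_harm x hc).tsum_add hs0.summable, hs0.tsum_eq] at h
  rw [Complex.ofReal_mul] at h
  have h' := mul_left_cancel₀ hcc h
  rw [fluct, Complex.ofReal_sub, h']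
  ring

/-- The constant is twice 7.14e-6, for l = ±1, plus the negligible higher harmonics. The constants
1.303e-4 and 3.152e-6 below arise in the same way after multiplication by 9.12 and by 2/9.0646. -/
theorem abs_fluct_le {x c : ℝ} (hx : 0 < x) (hc : 0 < c) : |fluct x c| ≤ 1.43e-5 / c := by
  have h1 : |fluct x c| = ‖∑' l : ℤ, harm x l c‖ := by
    rw [← fluct_eq_tsum hx hc, Complex.norm_real, Real.norm_eq_abs]
  rw [h1]
  refine (tsum_of_norm_bounded ((hasSum_geom_majorant 7.14e-6).div_const c)
    fun l => norm_harm_le x l hc).trans ?_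
  gcongr
  norm_num

theorem abs_fluct_sub_le {x a b : ℝ} (hx : 0 < x) (ha : 0 < a) (hb : 0 < b) :
    |fluct x a - fluct x b| ≤ 1.303e-4 * |1 / a - 1 / b| := by
  have h1 : |fluct x a - fluct x b| = ‖∑' l : ℤ, (harm x l a - harm x l b)‖ := by
    rw [(summable_harm x ha).tsum_sub (summable_harm x hb), ← fluct_eq_tsum hx ha,
      ← fluct_eq_tsum hx hb, ← Complex.ofReal_sub, Complex.norm_real, Real.norm_eq_abs]
  rw [h1]
  refine (tsum_of_norm_bounded ((hasSum_geom_majorant (7.14e-6 * 9.12)).mul_right |1 / a - 1 / b|)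
    fun l => ?_).trans ?_
  · rw [harm, harm]
    split_ifs with hl
    · simp
    · rw [← mul_sub, norm_mul, norm_mul, ← Complex.ofReal_mul, norm_cexp_ofReal_mul_I_neg, mul_one]
      calc ‖harmCoef l‖ * ‖osc (freq l) a - osc (freq l) b‖
          ≤ ‖harmCoef l‖ * (‖1 + freq l * Complex.I‖ * |1 / a - 1 / b|) := by
            gcongr; exact norm_osc_sub_le _ ha hb
        _ = (‖harmCoef l‖ * ‖1 + freq l * Complex.I‖) * |1 / a - 1 / b| := by ring
        _ ≤ _ := mul_le_mul_of_nonneg_right (norm_harmCoef_mul_le_geom l hl) (abs_nonneg _)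
  · gcongr
    norm_num

theorem continuousOn_fluct {x : ℝ} (hx : 0 < x) : ContinuousOn (fluct x) (Set.Ioi 0) := by
  intro c hc
  have hc' : (0 : ℝ) < c := hc
  have h0 : Tendsto (fun b => 1.303e-4 * |1 / b - 1 / c|) (𝓝[Set.Ioi 0] c) (𝓝 0) := by
    have : Tendsto (fun b : ℝ => 1.303e-4 * |1 / b - 1 / c|) (𝓝 c)
        (𝓝 (1.303e-4 * |1 / c - 1 / c|)) := by
      refine Tendsto.const_mul _ (Tendsto.abs (Tendsto.sub_const ?_ _))
      exact tendsto_const_nhds.div tendsto_id hc'.ne'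
    simpa using this.mono_left nhdsWithin_le_nhds
  refine tendsto_iff_norm_sub_tendsto_zero.2 (squeeze_zero' (Eventually.of_forall fun _ => norm_nonneg _)
    ?_ h0)
  filter_upwards [self_mem_nhdsWithin] with b hb
  exact abs_fluct_sub_le hx hb hc'

theorem intervalIntegrable_fluct {x a b : ℝ} (hx : 0 < x) (ha : 0 < a) (hb : 0 < b) :
    IntervalIntegrable (fluct x) volume a b :=
  ((continuousOn_fluct hx).mono fun _ hc => lt_of_lt_of_le (lt_min ha hb) hc.1).intervalIntegrable

theorem abs_integral_fluct_le {x a b : ℝ} (hx : 0 < x) (ha : 0 < a) (hb : 0 < b) :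
    |∫ c in a..b, fluct x c| ≤ 3.152e-6 := by
  have hsub : Set.uIcc a b ⊆ Set.Ioi 0 := fun c hc => lt_of_lt_of_le (lt_min ha hb) hc.1
  have hsub' : Set.uIoc a b ⊆ Set.Ioi 0 := Set.uIoc_subset_uIcc.trans hsub
  have hcont : ∀ l, ContinuousOn (harm x l) (Set.Ioi 0) := by
    intro l
    by_cases hl : l = 0
    · unfold harm; simp only [hl, if_true]; fun_prop
    · unfold harm; simp only [hl, if_false]; exact continuousOn_const.mul (continuousOn_osc _)
  have hS := (hasSum_geom_majorant 7.14e-6).summable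
  have hsum : HasSum (fun l => ∫ c in a..b, harm x l c) (∫ c in a..b, ∑' l, harm x l c) := by
    refine intervalIntegral.hasSum_integral_of_dominated_convergence
      (fun l c => 7.14e-6 * (if l = 0 then 0 else (1e-5) ^ (l.natAbs - 1)) / c)
      (fun l => ((hcont l).mono hsub').aestronglyMeasurable measurableSet_uIoc)
      (fun l => Eventually.of_forall fun c hc => norm_harm_le x l (hsub' hc))
      (Eventually.of_forall fun c _ => hS.div_const c) ?_
      (Eventually.of_forall fun c hc => (summable_harm x (hsub' hc)).hasSum)
    simp_rw [tsum_div_const]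
    refine ContinuousOn.intervalIntegrable ?_
    exact continuousOn_const.div continuousOn_id fun c hc => ne_of_gt (hsub hc)
  have h1 : |∫ c in a..b, fluct x c| = ‖∑' l, ∫ c in a..b, harm x l c‖ := by
    rw [hsum.tsum_eq, ← Real.norm_eq_abs, ← Complex.norm_real, ← intervalIntegral.integral_ofReal]
    congr 1
    exact intervalIntegral.integral_congr fun c hc => fluct_eq_tsum hx (hsub hc)
  rw [h1]
  refine (tsum_of_norm_bounded (hasSum_geom_majorant (7.14e-6 * (2 / 9.0646)))
    fun l => ?_).trans (by norm_num)
  by_cases hl : l = 0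
  · simp [harm, hl]
  · simp only [harm, hl, if_false]
    rw [intervalIntegral.integral_const_mul, norm_mul, norm_mul, ← Complex.ofReal_mul,
      norm_cexp_ofReal_mul_I_neg, mul_one]
    have hf0 : 9.0646 ≤ |freq l| := by
      rw [abs_freq]
      have h3 : (1 : ℝ) ≤ l.natAbs := by
        exact_mod_cast Nat.one_le_iff_ne_zero.2 (Int.natAbs_ne_zero.2 hl)
      nlinarith [freq_bounds.1]
    have hf : freq l ≠ 0 := by intro h; rw [h] at hf0; norm_num at hf0
    calc ‖harmCoef l‖ * ‖∫ c in a..b, osc (freq l) c‖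
        ≤ (7.14e-6 * (1e-5) ^ (l.natAbs - 1)) * (2 / 9.0646) := by
          gcongr
          · exact norm_harmCoef_le_geom l hl
          · refine (norm_integral_osc_le _ hf ha hb).trans ?_
            gcongr
      _ = _ := by ring

/-- Doubling c shifts the summation index by one. -/
theorem fluct_two_mul (x c : ℝ) : fluct x (2 * c) = fluct x c / 2 := by
  have : ∑' k : ℤ, x * 2 ^ k * Real.exp (-(c * (x * 2 ^ k)))
      = 2 * ∑' k : ℤ, x * 2 ^ k * Real.exp (-(2 * c * (x * 2 ^ k))) := by
    rw [← (Equiv.addRight (1 : ℤ)).tsum_eq, ← tsum_mul_left]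
    congr 1 with k
    simp only [Equiv.coe_addRight]
    rw [zpow_add_one₀ (by norm_num : (2 : ℝ) ≠ 0)]
    ring_nf
  rw [fluct, fluct, this]
  by_cases hc : c = 0
  · simp [hc]
  · have hL : Real.log 2 ≠ 0 := (Real.log_pos (by norm_num)).ne'
    generalize ∑' k : ℤ, x * 2 ^ k * Real.exp (-(2 * c * (x * 2 ^ k))) = S
    field_simp

theorem integral_fluct_two_mul (x a b : ℝ) :
    ∫ c in (2 * a)..(2 * b), fluct x c = ∫ c in a..b, fluct x c := by
  have h := intervalIntegral.integral_comp_mul_left (a := a) (b := b) (fluct x)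
    (two_ne_zero : (2 : ℝ) ≠ 0)
  simp_rw [fluct_two_mul] at h
  rw [intervalIntegral.integral_div, smul_eq_mul] at h
  linarith

/-- By scale invariance the integral over [1, 2ⁿ] is n times this one, but it stays bounded in n. -/
theorem integral_fluct_one_two {x : ℝ} (hx : 0 < x) : ∫ c in (1 : ℝ)..2, fluct x c = 0 := by
  have h : ∀ n : ℕ, ∫ c in (1 : ℝ)..2 ^ n, fluct x c = n * ∫ c in (1 : ℝ)..2, fluct x c := by
    intro n
    induction n with
    | zero => simp
    | succ n ih =>
      have h1 := integral_fluct_two_mul x 1 (2 ^ n)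
      rw [mul_one, ← pow_succ'] at h1
      rw [← intervalIntegral.integral_add_adjacent_intervals
        (intervalIntegrable_fluct hx one_pos two_pos)
        (intervalIntegrable_fluct hx two_pos (by positivity)), h1, ih]
      push_cast; ring
  by_contra hne
  obtain ⟨n, hn⟩ := exists_nat_gt (3.152e-6 / |∫ c in (1 : ℝ)..2, fluct x c|)
  have h2 := abs_integral_fluct_le hx one_pos (b := 2 ^ n) (by positivity)
  rw [h, abs_mul, Nat.abs_cast] at h2
  rw [div_lt_iff₀ (abs_pos.2 hne)] at hn
  linarith

theorem summable_mul_exp {x c : ℝ} (hx : 0 < x) (hc : 0 < c) :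
    Summable fun k : ℤ => x * 2 ^ k * Real.exp (-(c * (x * 2 ^ k))) := by
  have hg : Summable fun n : ℕ => (1 / 2 : ℝ) ^ n := summable_geometric_two
  refine Summable.of_nat_of_neg ?_ ?_
  · refine (hg.mul_left (2 / (c ^ 2 * x))).of_nonneg_of_le (fun _ => by positivity) fun n => ?_
    set y : ℝ := x * 2 ^ (n : ℤ) with hy
    have hy0 : 0 < y := by positivity
    have h1 : (c * y) ^ 2 / 2 ≤ Real.exp (c * y) := by
      have := Real.quadratic_le_exp_of_nonneg (x := c * y) (by positivity)
      nlinarith [mul_pos hc hy0]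
    have h2 : Real.exp (-(c * y)) ≤ ((c * y) ^ 2 / 2)⁻¹ := by
      rw [Real.exp_neg]; gcongr
    have h3 : y * ((c * y) ^ 2 / 2)⁻¹ = 2 / (c ^ 2 * x) * (1 / 2) ^ n := by
      rw [hy, zpow_natCast, one_div, inv_pow]; field_simp
    calc y * Real.exp (-(c * y)) ≤ y * ((c * y) ^ 2 / 2)⁻¹ := by gcongr
      _ = _ := h3
  · refine (hg.mul_left x).of_nonneg_of_le (fun _ => by positivity) fun n => ?_
    have h1 : Real.exp (-(c * (x * 2 ^ (-(n : ℤ))))) ≤ 1 :=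
      Real.exp_le_one_iff.2 (by simp; positivity)
    have h2 : (2 : ℝ) ^ (-(n : ℤ)) = (1 / 2) ^ n := by
      rw [zpow_neg, zpow_natCast, one_div, inv_pow]
    rw [h2] at h1 ⊢
    exact mul_le_of_le_one_right (by positivity) h1

/-- Integrating the series for 1/(c log 2) + `fluct x c` over [a, b] term by term produces these
differences. The terms at c = a dominate. The mean contributes the logarithm, which is how the
logarithms of f arise. -/
theorem hasSum_exp_sub_exp {x a b : ℝ} (hx : 0 < x) (ha : 0 < a) (hab : a ≤ b) :
    HasSum (fun k : ℤ => Real.exp (-(a * (x * 2 ^ k))) - Real.exp (-(b * (x * 2 ^ k))))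
      (Real.logb 2 (b / a) + ∫ c in a..b, fluct x c) := by
  have hb : 0 < b := ha.trans_le hab
  have hsub : Set.uIcc a b ⊆ Set.Ioi 0 := fun c hc => lt_of_lt_of_le (lt_min ha hb) hc.1
  have hle : ∀ c ∈ Set.uIoc a b, a ≤ c := fun c hc => by
    rw [Set.uIoc_of_le hab] at hc; exact hc.1.le
  have key := intervalIntegral.hasSum_integral_of_dominated_convergence (a := a) (b := b)
    (μ := volume) (F := fun (k : ℤ) c => x * 2 ^ k * Real.exp (-(c * (x * 2 ^ k))))
    (f := fun c => 1 / (c * Real.log 2) + fluct x c)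
    (fun k _ => x * 2 ^ k * Real.exp (-(a * (x * 2 ^ k))))
    (fun k => by fun_prop)
    (fun k => Eventually.of_forall fun c hc => by
      rw [Real.norm_of_nonneg (by positivity)]
      have := hle c hc
      gcongr)
    (Eventually.of_forall fun c _ => summable_mul_exp hx ha)
    intervalIntegrable_const
    (Eventually.of_forall fun c hc => by
      have hc0 : 0 < c := ha.trans_le (hle c hc)
      have := (summable_mul_exp hx hc0).hasSum
      convert! this using 1
      rw [fluct]; ring)
  convert! key using 1
  · funext k
    have hy : (x * 2 ^ k : ℝ) ≠ 0 := by positivity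
    have hd : ∀ c ∈ Set.uIcc a b, HasDerivAt (fun c => -Real.exp (-(c * (x * 2 ^ k))))
        (x * 2 ^ k * Real.exp (-(c * (x * 2 ^ k)))) c := by
      intro c _
      have h1 : HasDerivAt (fun c : ℝ => -(c * (x * 2 ^ k))) (-(1 * (x * 2 ^ k))) c :=
        ((hasDerivAt_id c).mul_const _).neg
      exact (h1.exp.neg).congr_deriv (by ring)
    rw [intervalIntegral.integral_eq_sub_of_hasDerivAt hd (by
      apply Continuous.intervalIntegrable; fun_prop)]
    ring
  · rw [intervalIntegral.integral_add _ (intervalIntegrable_fluct hx ha hb)]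
    · congr 1
      have : ∀ c : ℝ, 1 / (c * Real.log 2) = (1 / Real.log 2) * (1 / c) := fun c => by ring
      simp_rw [this]
      rw [intervalIntegral.integral_const_mul, integral_one_div_of_pos ha hb, Real.logb]
      ring
    · refine ContinuousOn.intervalIntegrable ?_
      have hL : Real.log 2 ≠ 0 := (Real.log_pos (by norm_num)).ne'
      exact continuousOn_const.div (by fun_prop) fun c hc => mul_ne_zero (ne_of_gt (hsub hc)) hL

/-! ### The log-periodic profile and its decomposition into mean and deviation -/

/-- The weight `E[exp (-u y 2ᵏ z); C₁ = k]` of a row in the Poisson model, where `y` is the mean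
number of elements of the row whose value exceeds `k`. -/
noncomputable def rowWeight (y t : ℝ) : ℝ :=
  Real.exp (-y) * (1 - Real.exp (-y)) *
    ((1 - Real.exp (-(2 * y))) * Real.exp (-t) + Real.exp (-(2 * y)) * Real.exp (-(3 * t)))

/-- The log-periodic limit profile of the Laplace transform of a row. -/
noncomputable def profile (x u : ℝ) : ℝ := ∑' k : ℤ, rowWeight (x * 2 ^ k) (u * (x * 2 ^ k))

/-- The deviation of `profile x` from its mean `f`. -/
noncomputable def dev (x u : ℝ) : ℝ :=
  (∫ c in (1 + u)..(2 + u), fluct x c) - (∫ c in (3 + u)..(4 + u), fluct x c)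
    + ∫ c in (3 + 3 * u)..(4 + 3 * u), fluct x c

theorem rowWeight_nonneg {y : ℝ} (hy : 0 ≤ y) (t : ℝ) : 0 ≤ rowWeight y t := by
  have h1 : Real.exp (-y) ≤ 1 := Real.exp_le_one_iff.2 (by linarith)
  have h2 : Real.exp (-(2 * y)) ≤ 1 := Real.exp_le_one_iff.2 (by linarith)
  have h3 : 0 ≤ 1 - Real.exp (-y) := by linarith
  have h4 : 0 ≤ 1 - Real.exp (-(2 * y)) := by linarith
  unfold rowWeight
  positivity

/-- The weight is arranged as three differences of exponentials, because a single exponential is not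
summable over all dyadic scales. Each difference yields one logarithm of f and one integral of
`dev`. -/
theorem rowWeight_eq (y u : ℝ) : rowWeight y (u * y) =
    (Real.exp (-((1 + u) * y)) - Real.exp (-((2 + u) * y)))
    - (Real.exp (-((3 + u) * y)) - Real.exp (-((4 + u) * y)))
    + (Real.exp (-((3 + 3 * u) * y)) - Real.exp (-((4 + 3 * u) * y))) := by
  have e1 : Real.exp (-((1 + u) * y)) = Real.exp (-y) * Real.exp (-(u * y)) := by
    rw [← Real.exp_add]; ring_nf
  have e2 : Real.exp (-((2 + u) * y)) = Real.exp (-y) * Real.exp (-y) * Real.exp (-(u * y)) := by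
    rw [← Real.exp_add, ← Real.exp_add]; ring_nf
  have e3 : Real.exp (-((3 + u) * y)) = Real.exp (-y) * Real.exp (-(2 * y)) * Real.exp (-(u * y)) := by
    rw [← Real.exp_add, ← Real.exp_add]; ring_nf
  have e4 : Real.exp (-((4 + u) * y))
      = Real.exp (-y) * Real.exp (-y) * Real.exp (-(2 * y)) * Real.exp (-(u * y)) := by
    rw [← Real.exp_add, ← Real.exp_add, ← Real.exp_add]; ring_nf
  have e5 : Real.exp (-((3 + 3 * u) * y))
      = Real.exp (-y) * Real.exp (-(2 * y)) * Real.exp (-(3 * (u * y))) := by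
    rw [← Real.exp_add, ← Real.exp_add]; ring_nf
  have e6 : Real.exp (-((4 + 3 * u) * y))
      = Real.exp (-y) * Real.exp (-y) * Real.exp (-(2 * y)) * Real.exp (-(3 * (u * y))) := by
    rw [← Real.exp_add, ← Real.exp_add, ← Real.exp_add]; ring_nf
  rw [e1, e2, e3, e4, e5, e6, rowWeight]
  ring

theorem hasSum_rowWeight {x u : ℝ} (hx : 0 < x) (hu : 0 ≤ u) :
    HasSum (fun k : ℤ => rowWeight (x * 2 ^ k) (u * (x * 2 ^ k))) (f u + dev x u) := by
  simp_rw [rowWeight_eq]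
  have h1 := hasSum_exp_sub_exp hx (a := 1 + u) (b := 2 + u) (by linarith) (by linarith)
  have h2 := hasSum_exp_sub_exp hx (a := 3 + u) (b := 4 + u) (by linarith) (by linarith)
  have h3 := hasSum_exp_sub_exp hx (a := 3 + 3 * u) (b := 4 + 3 * u) (by linarith) (by linarith)
  convert! (h1.sub h2).add h3 using 1
  rw [f, dev]
  ring

theorem profile_eq {x u : ℝ} (hx : 0 < x) (hu : 0 ≤ u) : profile x u = f u + dev x u :=
  (hasSum_rowWeight hx hu).tsum_eq

theorem profile_nonneg {x : ℝ} (hx : 0 < x) (u : ℝ) : 0 ≤ profile x u :=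
  tsum_nonneg fun _ => rowWeight_nonneg (by positivity) _

/-- The deviation as a second difference and a first difference that vanish at `u = 0`. -/
theorem dev_eq {x u : ℝ} (hx : 0 < x) (hu : 0 ≤ u) :
    dev x u = ((∫ c in (4 + u)..(4 + 2 * u), fluct x c)
        - ∫ c in (4 + 3 * u)..(4 + 4 * u), fluct x c)
      - ∫ c in (3 + u)..(3 + 3 * u), fluct x c := by
  have hI : ∀ a b : ℝ, 0 < a → 0 < b → IntervalIntegrable (fluct x) volume a b :=
    fun a b ha hb => intervalIntegrable_fluct hx ha hb
  have hq : ∀ a b : ℝ, 0 < a → 0 < b →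
      ∫ c in a..b, fluct x c = (∫ c in (1 : ℝ)..b, fluct x c) - ∫ c in (1 : ℝ)..a, fluct x c := by
    intro a b ha hb
    rw [intervalIntegral.integral_interval_sub_left (hI _ _ one_pos hb) (hI _ _ one_pos ha)]
  -- The primitive from 1 is invariant under doubling, as its integral over [1, 2] vanishes. So the
  -- endpoints 1 + u and 2 + u may be moved to 4 + 4u and 4 + 2u, after which every remaining
  -- interval shrinks to a point as u → 0.
  have hd : ∀ b : ℝ, 0 < b → ∫ c in (1 : ℝ)..(2 * b), fluct x c = ∫ c in (1 : ℝ)..b, fluct x c := by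
    intro b hb
    have h1 := integral_fluct_two_mul x 1 b
    rw [mul_one] at h1
    rw [← intervalIntegral.integral_add_adjacent_intervals (hI 1 2 one_pos two_pos)
      (hI 2 _ two_pos (by positivity)), h1, integral_fluct_one_two hx, zero_add]
  have e1 : ∫ c in (1 : ℝ)..(4 + 4 * u), fluct x c = ∫ c in (1 : ℝ)..(1 + u), fluct x c := by
    rw [show 4 + 4 * u = 2 * (2 * (1 + u)) by ring, hd _ (by positivity), hd _ (by positivity)]
  have e2 : ∫ c in (1 : ℝ)..(4 + 2 * u), fluct x c = ∫ c in (1 : ℝ)..(2 + u), fluct x c := by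
    rw [show 4 + 2 * u = 2 * (2 + u) by ring, hd _ (by positivity)]
  rw [dev, hq (1 + u) (2 + u) (by positivity) (by positivity),
    hq (3 + u) (4 + u) (by positivity) (by positivity),
    hq (3 + 3 * u) (4 + 3 * u) (by positivity) (by positivity),
    hq (4 + u) (4 + 2 * u) (by positivity) (by positivity),
    hq (4 + 3 * u) (4 + 4 * u) (by positivity) (by positivity),
    hq (3 + u) (3 + 3 * u) (by positivity) (by positivity), e1, e2]
  ring

/-! ### Rational bounds for f -/

theorem f_eq_log {u : ℝ} (hu : 0 ≤ u) : f u = (Real.log (2 + u) - 2 * Real.log (1 + u)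
    + Real.log (4 + 3 * u) - Real.log (4 + u) + Real.log (3 + u) - Real.log 3) / Real.log 2 := by
  rw [f, Real.logb, Real.logb, Real.logb, Real.log_div (by positivity) (by positivity),
    Real.log_div (by positivity) (by positivity), Real.log_div (by positivity) (by positivity),
    show 3 + 3 * u = 3 * (1 + u) by ring, Real.log_mul (by norm_num) (by positivity)]
  ring

theorem f_zero : f 0 = 1 := by
  have hL : Real.log 2 ≠ 0 := (Real.log_pos (by norm_num)).ne'
  rw [f_eq_log le_rfl]; simp [hL]

/-- The absolute value of the derivative of `f`. -/
noncomputable def slope (u : ℝ) : ℝ :=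
  (64 + 72 * u + 21 * u ^ 2 + u ^ 3) /
    (Real.log 2 * ((1 + u) * (2 + u) * (3 + u) * (4 + u) * (4 + 3 * u)))

theorem hasDerivAt_log_add (p q u : ℝ) (h : 0 < p + q * u) :
    HasDerivAt (fun u => Real.log (p + q * u)) (q / (p + q * u)) u := by
  have h1 : HasDerivAt (fun u => p + q * u) (q * 1) u := ((hasDerivAt_id u).const_mul q).const_add p
  simpa using h1.log h.ne'

theorem hasDerivAt_f {u : ℝ} (hu : 0 < u) : HasDerivAt f (-slope u) u := by
  have hL : Real.log 2 ≠ 0 := (Real.log_pos (by norm_num)).ne'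
  have h : HasDerivAt (fun u => (Real.log (2 + 1 * u) - 2 * Real.log (1 + 1 * u)
      + Real.log (4 + 3 * u) - Real.log (4 + 1 * u) + Real.log (3 + 1 * u) - Real.log 3)
        / Real.log 2)
      ((1 / (2 + 1 * u) - 2 * (1 / (1 + 1 * u)) + 3 / (4 + 3 * u) - 1 / (4 + 1 * u)
        + 1 / (3 + 1 * u)) / Real.log 2) u :=
    ((((((hasDerivAt_log_add 2 1 u (by positivity)).sub
      ((hasDerivAt_log_add 1 1 u (by positivity)).const_mul 2)).add
      (hasDerivAt_log_add 4 3 u (by positivity))).sub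
      (hasDerivAt_log_add 4 1 u (by positivity))).add
      (hasDerivAt_log_add 3 1 u (by positivity))).sub_const _).div_const _
  have e : f =ᶠ[𝓝 u] fun u => (Real.log (2 + 1 * u) - 2 * Real.log (1 + 1 * u)
      + Real.log (4 + 3 * u) - Real.log (4 + 1 * u) + Real.log (3 + 1 * u) - Real.log 3)
        / Real.log 2 := by
    filter_upwards [lt_mem_nhds hu] with v hv
    rw [f_eq_log hv.le]; simp only [one_mul]
  refine (h.congr_of_eventuallyEq e).congr_deriv ?_
  rw [slope]
  simp only [one_mul]
  field_simp
  ring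

theorem continuousOn_f : ContinuousOn f (Set.Ici 0) := by
  have : ContinuousOn (fun u => (Real.log (2 + u) - 2 * Real.log (1 + u)
    + Real.log (4 + 3 * u) - Real.log (4 + u) + Real.log (3 + u) - Real.log 3) / Real.log 2)
    (Set.Ici 0) := by
    have key : ∀ p q : ℝ, 0 < p → 0 ≤ q →
        ContinuousOn (fun u : ℝ => Real.log (p + q * u)) (Set.Ici 0) := by
      intro p q hp hq
      refine ContinuousOn.log (by fun_prop) fun u hu => ?_
      have : (0 : ℝ) ≤ u := hu
      positivity
    have h2 := key 2 1 (by norm_num) (by norm_num)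
    have h1 := key 1 1 (by norm_num) (by norm_num)
    have h43 := key 4 3 (by norm_num) (by norm_num)
    have h4 := key 4 1 (by norm_num) (by norm_num)
    have h3 := key 3 1 (by norm_num) (by norm_num)
    simp only [one_mul] at h2 h1 h4 h3
    exact (((((h2.sub (continuousOn_const.mul h1)).add h43).sub h4).add h3).sub
      continuousOn_const).div_const _
  exact this.congr fun u hu => f_eq_log hu

theorem tendsto_f_atTop : Tendsto f atTop (𝓝 0) := by
  have key : ∀ p q r s : ℝ, 0 < q → q = s → Tendsto (fun u : ℝ => Real.logb 2 ((p + q * u) / (r + s * u)))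
      atTop (𝓝 0) := by
    intro p q r s hq hqs
    subst hqs
    have h1 : Tendsto (fun u : ℝ => 1 + (p - r) / (r + q * u)) atTop (𝓝 (1 + 0)) := by
      refine Tendsto.const_add _ (Tendsto.const_div_atTop ?_ _)
      exact tendsto_atTop_add_const_left _ _ (tendsto_id.const_mul_atTop hq)
    rw [add_zero] at h1
    have h2 : Tendsto (fun u : ℝ => Real.logb 2 (1 + (p - r) / (r + q * u))) atTop (𝓝 0) := by
      have h3 := (Real.continuousAt_log one_ne_zero).tendsto.comp h1
      have := h3.div_const (Real.log 2)
      simpa [Real.logb, Function.comp_def] using this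
    refine h2.congr' ?_
    have h4 : Tendsto (fun u : ℝ => r + q * u) atTop atTop :=
      tendsto_atTop_add_const_left _ _ (tendsto_id.const_mul_atTop hq)
    filter_upwards [h4.eventually_gt_atTop 0] with u hu
    congr 1
    field_simp
    ring
  have h := ((key 2 1 1 1 one_pos rfl).add (key 4 3 3 3 (by norm_num) rfl)).sub
    (key 4 1 3 1 one_pos rfl)
  simp only [one_mul, add_zero, sub_zero] at h
  exact h

/-- A function that vanishes at infinity and first increases, then decreases is nonnegative. -/
theorem nonneg_of_unimodal {D D' : ℝ → ℝ} {p : ℝ} (hc : ContinuousOn D (Set.Ici p))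
    (hD : ∀ u, p < u → HasDerivAt D (D' u) u) (hp : 0 ≤ D p) (hlim : Tendsto D atTop (𝓝 0))
    (hs : ∀ u v, p < u → u ≤ v → 0 ≤ D' v → 0 ≤ D' u) {u : ℝ} (hu : p ≤ u) : 0 ≤ D u := by
  rcases hu.eq_or_lt with rfl | hpu
  · exact hp
  by_cases h : 0 ≤ D' u
  · have hm : MonotoneOn D (Set.Icc p u) := by
      refine monotoneOn_of_deriv_nonneg (convex_Icc p u) (hc.mono Set.Icc_subset_Ici_self) ?_ ?_
      · intro v hv
        rw [interior_Icc] at hv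
        exact (hD v hv.1).differentiableAt.differentiableWithinAt
      · intro v hv
        rw [interior_Icc] at hv
        rw [(hD v hv.1).deriv]
        exact hs v u hv.1 hv.2.le h
    exact hp.trans (hm (Set.left_mem_Icc.2 hu) (Set.right_mem_Icc.2 hu) hu)
  · have hm : AntitoneOn D (Set.Ici u) := by
      refine antitoneOn_of_deriv_nonpos (convex_Ici u) (hc.mono (Set.Ici_subset_Ici.2 hu)) ?_ ?_
      · intro v hv
        rw [interior_Ici] at hv
        exact (hD v (hpu.trans hv)).differentiableAt.differentiableWithinAt
      · intro v hv
        rw [interior_Ici] at hv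
        rw [(hD v (hpu.trans hv)).deriv]
        by_contra hcon
        exact h (hs u v hpu (le_of_lt hv) (not_le.1 hcon).le)
    refine le_of_tendsto hlim ?_
    filter_upwards [eventually_ge_atTop u] with v hv
    exact hm Set.self_mem_Ici hv hv

/-- A polynomial whose coefficients change sign once, from `+` to `-`, has this sign pattern. -/
theorem poly_nonneg_of_sign_change {c0 c1 c2 c3 c4 c5 c6 u v : ℝ} (h0 : 0 ≤ c0) (h1 : 0 ≤ c1)
    (h2 : 0 ≤ c2) (h4 : c4 ≤ 0) (h5 : c5 ≤ 0) (h6 : c6 ≤ 0) (hu : 0 < u)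
    (huv : u ≤ v)
    (hv : 0 ≤ c0 + c1 * v + c2 * v ^ 2 + c3 * v ^ 3 + c4 * v ^ 4 + c5 * v ^ 5 + c6 * v ^ 6) :
    0 ≤ c0 + c1 * u + c2 * u ^ 2 + c3 * u ^ 3 + c4 * u ^ 4 + c5 * u ^ 5 + c6 * u ^ 6 := by
  have hv0 : 0 < v := hu.trans_le huv
  have d1 : 0 ≤ v - u := by linarith
  have d2 : 0 ≤ v ^ 2 - u ^ 2 := by have := pow_le_pow_left₀ hu.le huv 2; linarith
  have d3 : 0 ≤ v ^ 3 - u ^ 3 := by have := pow_le_pow_left₀ hu.le huv 3; linarith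
  -- The quotient p(u)/u³ is decreasing, since the terms below degree 3 have nonnegative
  -- coefficients and those above have nonpositive ones. The pivot c3 may have either sign.
  have key : 0 ≤ (c0 + c1 * u + c2 * u ^ 2 + c3 * u ^ 3 + c4 * u ^ 4 + c5 * u ^ 5 + c6 * u ^ 6)
      * v ^ 3 := by
    have e : (c0 + c1 * u + c2 * u ^ 2 + c3 * u ^ 3 + c4 * u ^ 4 + c5 * u ^ 5 + c6 * u ^ 6) * v ^ 3
        = (c0 + c1 * v + c2 * v ^ 2 + c3 * v ^ 3 + c4 * v ^ 4 + c5 * v ^ 5 + c6 * v ^ 6) * u ^ 3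
          + c0 * (v ^ 3 - u ^ 3) + c1 * (u * v * (v ^ 2 - u ^ 2)) + c2 * (u ^ 2 * v ^ 2 * (v - u))
          + (-c4) * (u ^ 3 * v ^ 3 * (v - u)) + (-c5) * (u ^ 3 * v ^ 3 * (v ^ 2 - u ^ 2))
          + (-c6) * (u ^ 3 * v ^ 3 * (v ^ 3 - u ^ 3)) := by ring
    rw [e]
    have h4' : 0 ≤ -c4 := by linarith
    have h5' : 0 ≤ -c5 := by linarith
    have h6' : 0 ≤ -c6 := by linarith
    positivity
  exact nonneg_of_mul_nonneg_left key (by positivity)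

/-- The value `-f'(0) = 2 / (3 log 2)`. -/
noncomputable def slope0 : ℝ := 2 / (3 * Real.log 2)

theorem slope0_bounds : 0.9617 < slope0 ∧ slope0 < 0.9619 := by
  have h := log_two_bounds
  rw [slope0]
  constructor
  · rw [lt_div_iff₀ (by linarith)]; linarith
  · rw [div_lt_iff₀ (by linarith)]; linarith

theorem slope0_mul_log : slope0 * Real.log 2 = 2 / 3 := by
  have h := log_two_bounds
  have : Real.log 2 ≠ 0 := by linarith
  rw [slope0]; field_simp

theorem hasDerivAt_inv_lin {p q u : ℝ} (h : 0 < p + q * u) :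
    HasDerivAt (fun u => 1 / (p + q * u)) (-q / (p + q * u) ^ 2) u := by
  have h1 : HasDerivAt (fun u => p + q * u) (q * 1) u := ((hasDerivAt_id u).const_mul q).const_add p
  have h2 := h1.inv h.ne'
  rw [mul_one] at h2
  exact h2.congr_of_eventuallyEq (Eventually.of_forall fun v => by simp)

theorem tendsto_inv_lin {p q : ℝ} (hq : 0 < q) :
    Tendsto (fun u : ℝ => 1 / (p + q * u)) atTop (𝓝 0) :=
  Tendsto.const_div_atTop (tendsto_atTop_add_const_left _ _ (tendsto_id.const_mul_atTop hq)) _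

/-- A function vanishing at infinity is nonnegative beyond `p` if its derivative has the sign of a
polynomial in `u - p` with one sign change of the coefficients. -/
theorem nonneg_of_deriv_poly {D Q : ℝ → ℝ} {p : ℝ} (c0 c1 c2 c3 c4 c5 c6 : ℝ)
    (hc : ContinuousOn D (Set.Ici p)) (hp : 0 ≤ D p) (hlim : Tendsto D atTop (𝓝 0))
    (hQ : ∀ w, 0 < w → 0 < Q (p + w))
    (hD : ∀ w, 0 < w → HasDerivAt D ((c0 + c1 * w + c2 * w ^ 2 + c3 * w ^ 3 + c4 * w ^ 4
      + c5 * w ^ 5 + c6 * w ^ 6) / Q (p + w)) (p + w))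
    (h0 : 0 ≤ c0) (h1 : 0 ≤ c1) (h2 : 0 ≤ c2) (h4 : c4 ≤ 0) (h5 : c5 ≤ 0) (h6 : c6 ≤ 0)
    {u : ℝ} (hu : p ≤ u) : 0 ≤ D u := by
  refine nonneg_of_unimodal (D' := fun u => (c0 + c1 * (u - p) + c2 * (u - p) ^ 2
    + c3 * (u - p) ^ 3 + c4 * (u - p) ^ 4 + c5 * (u - p) ^ 5 + c6 * (u - p) ^ 6) / Q u)
    hc ?_ hp hlim ?_ hu
  · intro u hu
    have := hD (u - p) (by linarith)
    rwa [add_sub_cancel] at this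
  · intro u v hu huv hv
    have qu := hQ (u - p) (by linarith)
    have qv := hQ (v - p) (by linarith)
    rw [add_sub_cancel] at qu qv
    refine div_nonneg ?_ qu.le
    refine poly_nonneg_of_sign_change h0 h1 h2 h4 h5 h6 (v := v - p) (by linarith) (by linarith) ?_
    by_contra hcon
    exact absurd hv (not_le.2 (div_neg_of_neg_of_pos (not_le.1 hcon) qv))

/-- The difference vanishes at 0 and at infinity. The numerator of its derivative is N(u)(1 + au)² -
(2/3)P(u), with N and P·log 2 the numerator and denominator of `slope`. The tangency a = -f'(0)
removes the constant term, and the remaining coefficients change sign once. -/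
theorem f_le_inv {u : ℝ} (hu : 0 ≤ u) : f u ≤ 1 / (1 + slope0 * u) := by
  have ha := slope0_bounds
  have haL := slope0_mul_log
  have hL0 : 0 < Real.log 2 := by linarith [log_two_bounds.1]
  set a := slope0
  have ha0 : 0 < a := by linarith
  have key := nonneg_of_deriv_poly (p := 0) (D := fun u => 1 / (1 + a * u) - f u)
    (Q := fun u => Real.log 2 * ((1 + u) * (2 + u) * (3 + u) * (4 + u) * (4 + 3 * u))
      * (1 + a * u) ^ 2)
    0 (72 + 128 * a - 544 / 3) (21 + 144 * a + 64 * a ^ 2 - 580 / 3)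
    (1 + 42 * a + 72 * a ^ 2 - 290 / 3) (2 * a + 21 * a ^ 2 - 68 / 3) (a ^ 2 - 2) 0
    (ContinuousOn.sub (continuousOn_const.div (by fun_prop) fun u hu => by
      have : (0 : ℝ) ≤ u := hu
      positivity) continuousOn_f)
    (by simp [f_zero])
    (by simpa using (tendsto_inv_lin (p := 1) ha0).sub tendsto_f_atTop)
    (fun w hw => by simp only [zero_add]; positivity)
    (fun w hw => by
      simp only [zero_add]
      refine ((hasDerivAt_inv_lin (by positivity)).sub (hasDerivAt_f hw)).congr_deriv ?_
      rw [slope]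
      field_simp
      linear_combination (-3 * ((1 + w) * (2 + w) * (3 + w) * (4 + w) * (4 + 3 * w))) * haL)
    le_rfl (by nlinarith) (by nlinarith) (by nlinarith) (by nlinarith) le_rfl hu
  linarith

/-- The same one-sign-change argument as for the upper bound. Half the slope and the exponent 2 make
the minorant tangent to f at 0 too. -/
theorem f_ge_inv_sq {u : ℝ} (hu : 0 ≤ u) : 1 / (1 + slope0 / 2 * u) ^ 2 ≤ f u := by
  have ha := slope0_bounds
  have haL := slope0_mul_log
  have hL0 : 0 < Real.log 2 := by linarith [log_two_bounds.1]
  obtain ⟨b, hb⟩ : ∃ b, b = slope0 / 2 := ⟨_, rfl⟩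
  have hbL : b * Real.log 2 = 1 / 3 := by rw [hb]; linarith
  have hb1 : 0.4808 < b := by rw [hb]; linarith
  have hb2 : b < 0.481 := by rw [hb]; linarith
  have hb0 : 0 < b := by linarith
  have hb3 : b ^ 2 < 0.481 ^ 2 := by gcongr
  have hb4 : b ^ 3 < 0.481 ^ 3 := by gcongr
  have hb5 : 0.4808 ^ 2 < b ^ 2 := by gcongr
  have hb6 : 0.4808 ^ 3 < b ^ 3 := by gcongr
  rw [← hb]
  have hd : ∀ w, 0 < w → HasDerivAt (fun u => 1 / (1 + b * u) ^ 2) (-(2 * b) / (1 + b * w) ^ 3) w := by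
    intro w hw
    have h1 : HasDerivAt (fun u => 1 + b * u) b w := by
      simpa using ((hasDerivAt_id w).const_mul b).const_add 1
    have h0 : 0 < 1 + b * w := by positivity
    have h2 := (h1.pow 2).inv (pow_pos h0 2).ne'
    refine (h2.congr_of_eventuallyEq (Eventually.of_forall fun v => by simp)).congr_deriv ?_
    simp only [Pi.pow_apply]
    field_simp
    norm_num
    ring
  have key := nonneg_of_deriv_poly (p := 0) (D := fun u => f u - 1 / (1 + b * u) ^ 2)
    (Q := fun u => Real.log 2 * ((1 + u) * (2 + u) * (3 + u) * (4 + u) * (4 + 3 * u))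
      * (1 + b * u) ^ 3)
    0 (544 / 3 - 72 - 192 * b) (580 / 3 - 21 - 216 * b - 192 * b ^ 2)
    (290 / 3 - 1 - 63 * b - 216 * b ^ 2 - 64 * b ^ 3)
    (68 / 3 - 3 * b - 63 * b ^ 2 - 72 * b ^ 3) (2 - 3 * b ^ 2 - 21 * b ^ 3) (-b ^ 3)
    (continuousOn_f.sub (continuousOn_const.div (by fun_prop) fun u hu => by
      have : (0 : ℝ) ≤ u := hu
      positivity))
    (by simp [f_zero])
    (by
      have h1 := (tendsto_inv_lin (p := 1) hb0)
      have h2 := tendsto_f_atTop.sub (h1.pow 2)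
      simpa using h2)
    (fun w hw => by simp only [zero_add]; positivity)
    (fun w hw => by
      simp only [zero_add]
      refine HasDerivAt.congr_deriv (HasDerivAt.fun_sub (hasDerivAt_f hw) (hd w hw)) ?_
      rw [slope]
      field_simp
      linear_combination (6 * ((1 + w) * (2 + w) * (3 + w) * (4 + w) * (4 + 3 * w))) * hbL)
    le_rfl (by nlinarith) (by nlinarith) (by nlinarith) (by nlinarith) (by linarith [pow_pos hb0 3]) hu
  linarith

theorem f_one_le : f 1 ≤ 50 / 103 := by
  have h : f 1 = Real.logb 2 1.4 := by
    rw [f, ← Real.logb_mul (by norm_num) (by norm_num), ← Real.logb_div (by norm_num) (by norm_num)]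
    norm_num
  rw [h, Real.logb_le_iff_le_rpow (by norm_num) (by norm_num)]
  -- The fraction 50/103 lies just above log₂ 1.4, and the comparison becomes the integer-power
  -- inequality 1.4^103 ≤ 2^50.
  have : ((1.4 : ℝ)) ^ (103 : ℕ) ≤ ((2 : ℝ) ^ (50 / 103 : ℝ)) ^ (103 : ℕ) := by
    rw [← Real.rpow_mul_natCast (by norm_num)]
    norm_num
  exact le_of_pow_le_pow_left₀ (by norm_num) (by positivity) this

/-- The majorant tangent at 0 loses too much for large u. This sharper one, started at u = 1, serves
the case m = 3. -/
theorem f_le_inv_of_one_le {u : ℝ} (hu : 1 ≤ u) : f u ≤ 1 / (0.91 + 1.149 * u) := by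
  have hL := log_two_bounds
  have hL0 : 0 < Real.log 2 := by linarith
  set L := Real.log 2 with hLd
  have key := nonneg_of_deriv_poly (p := 1) (D := fun u => 1 / (0.91 + 1.149 * u) - f u)
    (Q := fun u => L * ((1 + u) * (2 + u) * (3 + u) * (4 + u) * (4 + 3 * u))
      * (0.91 + 1.149 * u) ^ 2)
    (158 * 2.059 ^ 2 - 1.149 * L * 840) (158 * (2 * 2.059 * 1.149) + 117 * 2.059 ^ 2 - 1.149 * L * 1438)
    (158 * 1.149 ^ 2 + 117 * (2 * 2.059 * 1.149) + 24 * 2.059 ^ 2 - 1.149 * L * 959)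
    (117 * 1.149 ^ 2 + 24 * (2 * 2.059 * 1.149) + 2.059 ^ 2 - 1.149 * L * 311)
    (24 * 1.149 ^ 2 + 2 * 2.059 * 1.149 - 1.149 * L * 49) (1.149 ^ 2 - 1.149 * L * 3) 0
    (ContinuousOn.sub (continuousOn_const.div (by fun_prop) fun u hu => by
      have : (1 : ℝ) ≤ u := hu
      positivity) (continuousOn_f.mono (Set.Ici_subset_Ici.2 (by norm_num))))
    (by have := f_one_le; norm_num; linarith)
    (by simpa using (tendsto_inv_lin (p := 0.91) (q := 1.149) (by norm_num)).sub tendsto_f_atTop)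
    (fun w hw => by positivity)
    (fun w hw => by
      refine ((hasDerivAt_inv_lin (by positivity)).sub (hasDerivAt_f (by linarith))).congr_deriv ?_
      rw [slope, ← hLd]
      rw [div_sub', div_eq_div_iff] <;> try positivity
      field_simp
      ring)
    (by linarith) (by linarith) (by linarith) (by linarith) (by linarith) le_rfl hu
  linarith

theorem f_pos {u : ℝ} (hu : 0 ≤ u) : 0 < f u :=
  lt_of_lt_of_le (by have : 0 < slope0 := by linarith [slope0_bounds.1]
                     positivity) (f_ge_inv_sq hu)

/-! ### Pointwise bounds for the deviation -/

/-- This is s ≤ sinh s at s = log t. Applied to t = b/a it is the trapezoidal upper bound for ∫ dc/c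
over [a, b]. -/
theorem log_le_half_sub_inv {t : ℝ} (ht : 1 ≤ t) : Real.log t ≤ (t - t⁻¹) / 2 := by
  rw [← Real.sinh_log (by linarith)]
  exact Real.self_le_sinh_iff.2 (Real.log_nonneg ht)

theorem abs_integral_fluct_le_log {x a b : ℝ} (hx : 0 < x) (ha : 0 < a) (hab : a ≤ b) :
    |∫ c in a..b, fluct x c| ≤ 1.43e-5 * Real.log (b / a) := by
  have hb : 0 < b := ha.trans_le hab
  have h := intervalIntegral.norm_integral_le_of_norm_le (μ := volume) (f := fluct x)
    (g := fun c => 1.43e-5 * (1 / c)) hab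
    (Eventually.of_forall fun c hc => by
      rw [Real.norm_eq_abs, mul_one_div]
      exact abs_fluct_le hx (ha.trans hc.1))
    (by
      refine ContinuousOn.intervalIntegrable (continuousOn_const.mul
        (continuousOn_const.div continuousOn_id fun c hc => ?_))
      exact ne_of_gt (lt_of_lt_of_le (lt_min ha hb) hc.1))
  rwa [intervalIntegral.integral_const_mul, integral_one_div_of_pos ha hb] at h

theorem abs_integral_fluct_le_trapezoid {x a b : ℝ} (hx : 0 < x) (ha : 0 < a) (hab : a ≤ b) :
    |∫ c in a..b, fluct x c| ≤ 1.43e-5 * ((b - a) * (1 / a + 1 / b) / 2) := by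
  have hb : 0 < b := ha.trans_le hab
  refine (abs_integral_fluct_le_log hx ha hab).trans ?_
  have h := log_le_half_sub_inv ((one_le_div ha).2 hab)
  have e : (b / a - (b / a)⁻¹) / 2 = (b - a) * (1 / a + 1 / b) / 2 := by
    field_simp; ring
  rw [e] at h
  gcongr

theorem abs_integral_fluct_le_left {x a b : ℝ} (hx : 0 < x) (ha : 0 < a) (hab : a ≤ b) :
    |∫ c in a..b, fluct x c| ≤ 1.43e-5 * ((b - a) / a) := by
  refine (abs_integral_fluct_le_log hx ha hab).trans ?_
  have h := Real.log_le_sub_one_of_pos (div_pos (ha.trans_le hab) ha)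
  have e : b / a - 1 = (b - a) / a := by field_simp
  rw [e] at h
  gcongr

/-- Both intervals have length u and are translates by 2u, so the Lipschitz bound for `fluct` in 1/c
makes the difference quadratic in u. -/
theorem abs_second_diff_le {x u : ℝ} (hx : 0 < x) (hu : 0 ≤ u) :
    |(∫ c in (4 + u)..(4 + 2 * u), fluct x c) - ∫ c in (4 + 3 * u)..(4 + 4 * u), fluct x c|
      ≤ 1.303e-4 * (2 * u ^ 2 / ((4 + u) * (4 + 3 * u))) := by
  have h1 : ∫ c in (4 + 3 * u)..(4 + 4 * u), fluct x c
      = ∫ c in (4 + u)..(4 + 2 * u), fluct x (c + 2 * u) := by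
    rw [intervalIntegral.integral_comp_add_right (fluct x) (2 * u)]
    congr 1 <;> ring
  have hI2 : IntervalIntegrable (fun c => fluct x (c + 2 * u)) volume (4 + u) (4 + 2 * u) := by
    have := (intervalIntegrable_fluct hx (a := 4 + u + 2 * u) (b := 4 + 2 * u + 2 * u)
      (by positivity) (by positivity)).comp_add_right (2 * u)
    simpa using this
  rw [h1, ← intervalIntegral.integral_sub (intervalIntegrable_fluct hx (by positivity)
    (by positivity)) hI2]
  have h2 := intervalIntegral.norm_integral_le_of_norm_le_const
    (f := fun c => fluct x c - fluct x (c + 2 * u)) (a := 4 + u) (b := 4 + 2 * u)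
    (C := 1.303e-4 * (2 * u / ((4 + u) * (4 + 3 * u)))) (by
      intro c hc
      rw [Set.uIoc_of_le (by linarith)] at hc
      have hc0 : 4 + u < c := hc.1
      have hcp : 0 < c := by linarith
      refine (abs_fluct_sub_le hx hcp (by positivity)).trans ?_
      have e : 1 / c - 1 / (c + 2 * u) = 2 * u / (c * (c + 2 * u)) := by
        field_simp; ring
      rw [e, abs_of_nonneg (by positivity)]
      have h3 : (4 + u) * (4 + 3 * u) ≤ c * (c + 2 * u) :=
        mul_le_mul hc0.le (by linarith) (by positivity) hcp.le
      gcongr 1.303e-4 * (_ / ?_))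
  rw [Real.norm_eq_abs] at h2
  refine h2.trans (le_of_eq ?_)
  rw [abs_of_nonneg (by linarith)]
  field_simp
  ring

/-- Freezing `fluct` at c = 3 on an interval of length 2u isolates the linear term of `dev`, with
slope -2·`fluct x 3`. The Lipschitz bound controls the remainder. -/
theorem abs_first_diff_sub_linear_le {x u : ℝ} (hx : 0 < x) (hu : 0 ≤ u) :
    |(∫ c in (3 + u)..(3 + 3 * u), fluct x c) - 2 * u * fluct x 3|
      ≤ 1.303e-4 * (4 * u ^ 2 / (3 * (3 + u))) := by
  have e0 : 2 * u * fluct x 3 = ∫ _ in (3 + u)..(3 + 3 * u), fluct x 3 := by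
    rw [intervalIntegral.integral_const, smul_eq_mul]; ring
  rw [e0, ← intervalIntegral.integral_sub (intervalIntegrable_fluct hx (by positivity)
    (by positivity)) intervalIntegrable_const]
  have h := intervalIntegral.norm_integral_le_of_norm_le (μ := volume)
    (f := fun c => fluct x c - fluct x 3) (a := 3 + u) (b := 3 + 3 * u)
    (g := fun c => 1.303e-4 / (3 * (3 + u)) * (c - 3)) (by linarith)
    (Eventually.of_forall fun c hc => by
      have hc0 : 3 + u < c := hc.1
      have hcp : 0 < c := by linarith
      refine (abs_fluct_sub_le hx hcp (by norm_num)).trans ?_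
      have e : |1 / c - 1 / 3| = (c - 3) / (3 * c) := by
        rw [abs_sub_comm, abs_of_nonneg]
        · field_simp
        · rw [sub_nonneg]; gcongr; linarith
      rw [e, div_mul_eq_mul_div, mul_div_assoc]
      have : 0 ≤ c - 3 := by linarith
      gcongr)
    (by apply Continuous.intervalIntegrable; fun_prop)
  rw [Real.norm_eq_abs] at h
  refine h.trans (le_of_eq ?_)
  rw [intervalIntegral.integral_const_mul, intervalIntegral.integral_sub
    (by apply Continuous.intervalIntegrable; fun_prop) intervalIntegrable_const, integral_id,
    intervalIntegral.integral_const, smul_eq_mul]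
  field_simp
  ring

theorem abs_dev_le_near {x u : ℝ} (hx : 0 < x) (hu : 0 ≤ u) :
    |dev x u| ≤ 1.43e-5 * (18.224 * u ^ 2 / ((4 + u) * (4 + 3 * u))
      + u * (1 / (3 + u) + 1 / (3 + 3 * u))) := by
  rw [dev_eq hx hu]
  refine (abs_sub _ _).trans ?_
  have h1 := abs_second_diff_le hx hu
  have h2 := abs_integral_fluct_le_trapezoid hx (a := 3 + u) (b := 3 + 3 * u)
    (by positivity) (by linarith)
  have e1 : 1.303e-4 * (2 * u ^ 2 / ((4 + u) * (4 + 3 * u)))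
      ≤ 1.43e-5 * (18.224 * u ^ 2 / ((4 + u) * (4 + 3 * u))) := by
    rw [mul_div_assoc', mul_div_assoc']
    gcongr ?_ / _
    nlinarith [sq_nonneg u]
  have e2 : (3 + 3 * u - (3 + u)) * (1 / (3 + u) + 1 / (3 + 3 * u)) / 2
      = u * (1 / (3 + u) + 1 / (3 + 3 * u)) := by ring
  rw [e2] at h2
  rw [mul_add]
  exact add_le_add (h1.trans e1) h2

/-- The long interval uses the length-independent bound 3.152e-6, which is at most 0.2205 · 1.43e-5.
The two others use the pointwise bound. `abs_dev_le_const` uses the uniform bound for all three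
intervals. -/
theorem abs_dev_le_mid {x u : ℝ} (hx : 0 < x) (hu : 0 ≤ u) :
    |dev x u| ≤ 1.43e-5 * (u / (4 + u) + u / (4 + 3 * u) + 0.2205) := by
  rw [dev_eq hx hu]
  refine (abs_sub _ _).trans ?_
  have h1 := abs_integral_fluct_le_left hx (a := 4 + u) (b := 4 + 2 * u) (by positivity) (by linarith)
  have h2 := abs_integral_fluct_le_left hx (a := 4 + 3 * u) (b := 4 + 4 * u)
    (by positivity) (by linarith)
  have h3 := abs_integral_fluct_le hx (a := 3 + u) (b := 3 + 3 * u) (by positivity) (by positivity)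
  have h4 := abs_sub (∫ c in (4 + u)..(4 + 2 * u), fluct x c)
    (∫ c in (4 + 3 * u)..(4 + 4 * u), fluct x c)
  rw [show 4 + 2 * u - (4 + u) = u by ring] at h1
  rw [show 4 + 4 * u - (4 + 3 * u) = u by ring] at h2
  linarith

theorem abs_dev_le_const {x u : ℝ} (hx : 0 < x) (hu : 0 ≤ u) :
    |dev x u| ≤ 1.43e-5 * 0.6615 := by
  rw [dev_eq hx hu]
  refine (abs_sub _ _).trans ?_
  have h1 := abs_integral_fluct_le hx (a := 4 + u) (b := 4 + 2 * u) (by positivity) (by positivity)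
  have h2 := abs_integral_fluct_le hx (a := 4 + 3 * u) (b := 4 + 4 * u)
    (by positivity) (by positivity)
  have h3 := abs_integral_fluct_le hx (a := 3 + u) (b := 3 + 3 * u) (by positivity) (by positivity)
  have h4 := abs_sub (∫ c in (4 + u)..(4 + 2 * u), fluct x c)
    (∫ c in (4 + 3 * u)..(4 + 4 * u), fluct x c)
  linarith

/-- For large u the definition of `dev` is better than `dev_eq`: its intervals keep length 1 while
moving to infinity, which gives decay. -/
theorem abs_dev_le_tail {x u : ℝ} (hx : 0 < x) (hu : 0 ≤ u) :
    |dev x u| ≤ 1.43e-5 * ((1 / (1 + u) + 1 / (2 + u)) / 2 + (1 / (3 + u) + 1 / (4 + u)) / 2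
      + (1 / (3 + 3 * u) + 1 / (4 + 3 * u)) / 2) ∧
    |dev x u| ≤ 1.43e-5 * (0.2205 + (1 / (3 + u) + 1 / (4 + u)) / 2
      + (1 / (3 + 3 * u) + 1 / (4 + 3 * u)) / 2) := by
  have h1 := abs_integral_fluct_le_trapezoid hx (a := 1 + u) (b := 2 + u) (by positivity) (by linarith)
  have h1' := abs_integral_fluct_le hx (a := 1 + u) (b := 2 + u) (by positivity) (by positivity)
  have h2 := abs_integral_fluct_le_trapezoid hx (a := 3 + u) (b := 4 + u) (by positivity) (by linarith)
  have h3 := abs_integral_fluct_le_trapezoid hx (a := 3 + 3 * u) (b := 4 + 3 * u)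
    (by positivity) (by linarith)
  rw [show 2 + u - (1 + u) = 1 by ring, one_mul] at h1
  rw [show 4 + u - (3 + u) = 1 by ring, one_mul] at h2
  rw [show 4 + 3 * u - (3 + 3 * u) = 1 by ring, one_mul] at h3
  rw [dev]
  have h4 := abs_add_le ((∫ c in (1 + u)..(2 + u), fluct x c) - ∫ c in (3 + u)..(4 + u), fluct x c)
    (∫ c in (3 + 3 * u)..(4 + 3 * u), fluct x c)
  have h5 := abs_sub (∫ c in (1 + u)..(2 + u), fluct x c) (∫ c in (3 + u)..(4 + u), fluct x c)
  constructor <;> linarith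

/-- The right side is 1.3u/(1 + 0.95u)² + 2.2u²/(1 + 0.95u)³, the form required by
`abs_varFun_sub_le`. On each of the four ranges of u one of the preceding bounds lies below it. -/
theorem abs_dev_le {x u : ℝ} (hx : 0 < x) (hu : 0 ≤ u) :
    |dev x u| ≤ 1.43e-5 * (u * (1.3 + 3.435 * u) / (1 + 0.95 * u) ^ 3) := by
  rcases le_total u 0.5 with h1 | h1
  · refine (abs_dev_le_near hx hu).trans ?_
    gcongr
    have hw : 0 ≤ 0.5 - u := by linarith
    rw [div_add_div _ _ (by positivity) (by positivity), mul_div_assoc', div_add_div _ _ (by positivity) (by positivity), div_le_div_iff₀ (by positivity) (by positivity)]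
    rw [← sub_nonneg]
    ring_nf
    nlinarith [pow_nonneg hu 2, pow_nonneg hu 3, pow_nonneg hu 4, pow_nonneg hu 5, pow_nonneg hu 6, mul_nonneg hu hw, mul_nonneg (pow_nonneg hu 2) hw, mul_nonneg (pow_nonneg hu 3) hw, mul_nonneg (pow_nonneg hu 4) hw, mul_nonneg (pow_nonneg hu 5) hw]
  rcases le_total u 1.4 with h2 | h2
  · refine (abs_dev_le_mid hx hu).trans ?_
    gcongr
    obtain ⟨w, rfl⟩ : ∃ w, u = 0.5 + w := ⟨u - 0.5, by ring⟩
    have hw : 0 ≤ w := by linarith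
    have hv : 0 ≤ 0.9 - w := by linarith
    rw [div_add_div _ _ (by positivity) (by positivity), div_add' _ _ _ (by positivity), div_le_div_iff₀ (by positivity) (by positivity)]
    rw [← sub_nonneg]
    ring_nf
    nlinarith [pow_nonneg hw 2, pow_nonneg hw 3, pow_nonneg hw 4, pow_nonneg hw 5, pow_nonneg hw 6, mul_nonneg hw hv, mul_nonneg (pow_nonneg hw 2) hv, mul_nonneg (pow_nonneg hw 3) hv, mul_nonneg (pow_nonneg hw 4) hv]
  rcases le_total u 2.1 with h3 | h3
  · refine (abs_dev_le_const hx hu).trans ?_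
    gcongr
    have hw : 0 ≤ u - 1.4 := by linarith
    have hv : 0 ≤ 2.1 - u := by linarith
    rw [le_div_iff₀ (by positivity)]
    nlinarith [mul_nonneg hw hv, mul_nonneg hw (mul_nonneg hw hv), mul_nonneg hv (mul_nonneg hw hv)]
  · refine (abs_dev_le_tail hx hu).1.trans ?_
    gcongr
    obtain ⟨w, rfl⟩ : ∃ w, u = 2.1 + w := ⟨u - 2.1, by ring⟩
    have hw : 0 ≤ w := by linarith
    rw [← sub_nonneg]
    have : 0 ≤ 1 + (2.1 + w) := by positivity
    field_simp
    ring_nf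
    positivity

/-- This bound and the next one are tighter than `abs_dev_le` in simpler shapes; both are meant for
m = 3. -/
theorem abs_dev_le_of_le_one {x u : ℝ} (hx : 0 < x) (hu : 0 ≤ u) (h1 : u ≤ 1) :
    |dev x u| ≤ 1.43e-5 * u := by
  rcases le_total u 0.5 with h2 | h2
  · refine (abs_dev_le_near hx hu).trans ?_
    gcongr
    have e : 18.224 * u ^ 2 / ((4 + u) * (4 + 3 * u)) + u * (1 / (3 + u) + 1 / (3 + 3 * u))
        = u * (18.224 * u / ((4 + u) * (4 + 3 * u)) + (1 / (3 + u) + 1 / (3 + 3 * u))) := by ring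
    rw [e]
    refine mul_le_of_le_one_right hu ?_
    have hw : 0 ≤ 0.5 - u := by linarith
    rw [div_add_div _ _ (by positivity) (by positivity), div_add_div _ _ (by positivity)
      (by positivity), div_le_one (by positivity)]
    nlinarith [pow_nonneg hu 2, pow_nonneg hu 3, pow_nonneg hu 4, mul_nonneg hu hw,
      mul_nonneg (pow_nonneg hu 2) hw, mul_nonneg (pow_nonneg hu 3) hw]
  · refine (abs_dev_le_mid hx hu).trans ?_
    gcongr
    rw [div_add_div _ _ (by positivity) (by positivity), div_add' _ _ _ (by positivity),
      div_le_iff₀ (by positivity)]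
    obtain ⟨w, rfl⟩ : ∃ w, u = 0.5 + w := ⟨u - 0.5, by ring⟩
    have hw : 0 ≤ w := by linarith
    nlinarith [pow_nonneg hw 2, pow_nonneg hw 3]

theorem abs_dev_le_of_one_le {x u : ℝ} (hx : 0 < x) (h1 : 1 ≤ u) :
    |dev x u| ≤ 1.43e-5 * (2.45 / (u + 2.3)) := by
  have hu : 0 ≤ u := by linarith
  rcases le_total u 3.1 with h2 | h2
  · refine (abs_dev_le_tail hx hu).2.trans ?_
    gcongr
    obtain ⟨w, rfl⟩ : ∃ w, u = 1 + w := ⟨u - 1, by ring⟩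
    have hw : 0 ≤ w := by linarith
    have hv : 0 ≤ 2.1 - w := by linarith
    rw [← sub_nonneg]
    have : 0 ≤ (2.1 - w) * (2.1 - w) := by positivity
    field_simp
    ring_nf
    nlinarith [pow_nonneg hw 2, pow_nonneg hw 3, pow_nonneg hw 4, mul_nonneg hw hv,
      mul_nonneg (pow_nonneg hw 2) hv, mul_nonneg (pow_nonneg hw 3) hv,
      mul_nonneg (pow_nonneg hw 4) hv]
  · refine (abs_dev_le_tail hx hu).1.trans ?_
    gcongr
    obtain ⟨w, rfl⟩ : ∃ w, u = 3.1 + w := ⟨u - 3.1, by ring⟩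
    have hw : 0 ≤ w := by linarith
    rw [← sub_nonneg]
    field_simp
    ring_nf
    positivity

/-! ### Removing the linear part of the deviation by a dilation -/

theorem slope0_sub_slope_le {t : ℝ} (ht : 0 ≤ t) :
    |slope0 - slope t| ≤ 1.65 * t := by
  have hL := log_two_bounds
  have hL0 : 0 < Real.log 2 := by linarith
  have e : slope0 - slope t = t * (328 + 517 * t + 287 * t ^ 2 + 68 * t ^ 3 + 6 * t ^ 4) /
      (3 * Real.log 2 * ((1 + t) * (2 + t) * (3 + t) * (4 + t) * (4 + 3 * t))) := by
    rw [slope0, slope]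
    field_simp
    ring
  rw [e, abs_of_nonneg (by positivity), div_le_iff₀ (by positivity)]
  have h1 : 3.43 ≤ 1.65 * (3 * Real.log 2) := by linarith
  have h2 : 328 + 517 * t + 287 * t ^ 2 + 68 * t ^ 3 + 6 * t ^ 4
      ≤ 3.43 * ((1 + t) * (2 + t) * (3 + t) * (4 + t) * (4 + 3 * t)) := by
    rw [← sub_nonneg]; ring_nf; positivity
  calc t * (328 + 517 * t + 287 * t ^ 2 + 68 * t ^ 3 + 6 * t ^ 4)
      ≤ t * (1.65 * (3 * Real.log 2) * ((1 + t) * (2 + t) * (3 + t) * (4 + t) * (4 + 3 * t))) := by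
        gcongr
        refine h2.trans ?_
        gcongr
    _ = _ := by ring

theorem slope_nonneg {t : ℝ} (ht : 0 ≤ t) : 0 ≤ slope t := by
  have hL0 : 0 < Real.log 2 := by linarith [log_two_bounds.1]
  unfold slope; positivity

theorem slope_le {t : ℝ} (ht : 0 ≤ t) : slope t ≤ 1.2024 / (1 + t) ^ 2 := by
  have hL := log_two_bounds
  have hL0 : 0 < Real.log 2 := by linarith
  rw [slope, div_le_div_iff₀ (by positivity) (by positivity)]
  have h1 : 0.8334 ≤ 1.2024 * Real.log 2 := by linarith
  have h2 : (64 + 72 * t + 21 * t ^ 2 + t ^ 3) * (1 + t)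
      ≤ 0.8334 * ((2 + t) * (3 + t) * (4 + t) * (4 + 3 * t)) := by
    rw [← sub_nonneg]; ring_nf; positivity
  calc (64 + 72 * t + 21 * t ^ 2 + t ^ 3) * (1 + t) ^ 2
      = ((64 + 72 * t + 21 * t ^ 2 + t ^ 3) * (1 + t)) * (1 + t) := by ring
    _ ≤ (1.2024 * Real.log 2 * ((2 + t) * (3 + t) * (4 + t) * (4 + 3 * t))) * (1 + t) := by
        refine mul_le_mul_of_nonneg_right (h2.trans ?_) (by linarith)
        gcongr
    _ = _ := by ring

/-- The dilation factor for which `f (dilation x * u)` and `profile x u` have the same slope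
at `u = 0`. -/
noncomputable def dilation (x : ℝ) : ℝ := 1 + 2 * fluct x 3 / slope0

/-- Near 0, f(λu) - f(u) ≈ -`slope0`(λ-1)u, while `dev x u` ≈ -2u·`fluct x 3`; equating the two
fixes λ. The bound is 2 · 1.43e-5/3 divided by 0.9617. -/
theorem abs_dilation_sub_one_le {x : ℝ} (hx : 0 < x) : |dilation x - 1| ≤ 1e-5 := by
  have h := abs_fluct_le hx (c := 3) (by norm_num)
  have ha := slope0_bounds
  have ha0 : 0 < slope0 := by linarith
  rw [dilation, add_sub_cancel_left, abs_div, abs_of_pos ha0, div_le_iff₀ ha0, abs_mul, abs_two]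
  linarith

/-- Mean value inequality for f(t) + `slope0`·t, whose derivative is O(t). The far version applies
it to f itself with the decay of `slope`. -/
theorem abs_f_mul_sub_le_near {l u : ℝ} (hl : |l - 1| ≤ 1e-5) (hu : 0 < u) :
    |f (l * u) - f u + slope0 * (l - 1) * u| ≤ 1.651e-5 * u ^ 2 := by
  have hl' := abs_le.1 hl
  have hlu : 0 < l * u := mul_pos (by linarith) hu
  have hd : ∀ t ∈ Set.uIcc u (l * u), HasDerivWithinAt (fun t => f t + slope0 * t)
      (slope0 - slope t) (Set.uIcc u (l * u)) t := by
    intro t ht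
    have ht0 : 0 < t := lt_of_lt_of_le (lt_min hu hlu) ht.1
    have h2 : HasDerivAt (fun t => slope0 * t) slope0 t := by
      simpa using (hasDerivAt_id t).const_mul slope0
    exact (((hasDerivAt_f ht0).add h2).congr_deriv (by ring)).hasDerivWithinAt
  have hb : ∀ t ∈ Set.uIcc u (l * u), ‖slope0 - slope t‖ ≤ 1.65 * (1.00001 * u) := by
    intro t ht
    have ht0 : 0 < t := lt_of_lt_of_le (lt_min hu hlu) ht.1
    refine (slope0_sub_slope_le ht0.le).trans ?_
    gcongr
    refine ht.2.trans (max_le (by linarith) ?_)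
    gcongr
    linarith
  have key := (convex_uIcc u (l * u)).norm_image_sub_le_of_norm_hasDerivWithin_le hd hb
    Set.left_mem_uIcc Set.right_mem_uIcc
  have e1 : f (l * u) + slope0 * (l * u) - (f u + slope0 * u)
      = f (l * u) - f u + slope0 * (l - 1) * u := by ring
  have e2 : l * u - u = (l - 1) * u := by ring
  rw [Real.norm_eq_abs, Real.norm_eq_abs, e1, e2, abs_mul, abs_of_pos hu] at key
  refine key.trans ?_
  calc 1.65 * (1.00001 * u) * (|l - 1| * u) ≤ 1.65 * (1.00001 * u) * (1e-5 * u) := by gcongr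
    _ ≤ 1.651e-5 * u ^ 2 := by nlinarith [sq_nonneg u]

theorem abs_f_mul_sub_le_far {l u : ℝ} (hl : |l - 1| ≤ 1e-5) (hu : 0 < u) :
    |f (l * u) - f u| ≤ 1.203e-5 * (u / (1 + u) ^ 2) := by
  have hl' := abs_le.1 hl
  have hlu : 0 < l * u := mul_pos (by linarith) hu
  have hd : ∀ t ∈ Set.uIcc u (l * u), HasDerivWithinAt f (-slope t) (Set.uIcc u (l * u)) t := by
    intro t ht
    have ht0 : 0 < t := lt_of_lt_of_le (lt_min hu hlu) ht.1
    exact (hasDerivAt_f ht0).hasDerivWithinAt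
  have hb : ∀ t ∈ Set.uIcc u (l * u), ‖-slope t‖ ≤ 1.203 / (1 + u) ^ 2 := by
    intro t ht
    have ht0 : 0 < t := lt_of_lt_of_le (lt_min hu hlu) ht.1
    have ht1 : 0.99999 * u ≤ t := by
      refine le_trans (le_min (by linarith) ?_) ht.1
      gcongr
      linarith
    rw [norm_neg, Real.norm_of_nonneg (slope_nonneg ht0.le)]
    refine (slope_le ht0.le).trans ?_
    calc 1.2024 / (1 + t) ^ 2 ≤ 1.2024 / (0.99999 * (1 + u)) ^ 2 := by gcongr; linarith
      _ ≤ 1.203 / (1 + u) ^ 2 := by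
        rw [mul_pow, ← div_div]
        gcongr
        norm_num
  have key := (convex_uIcc u (l * u)).norm_image_sub_le_of_norm_hasDerivWithin_le hd hb
    Set.left_mem_uIcc Set.right_mem_uIcc
  have e2 : l * u - u = (l - 1) * u := by ring
  rw [Real.norm_eq_abs, Real.norm_eq_abs, e2, abs_mul, abs_of_pos hu] at key
  refine key.trans ?_
  calc 1.203 / (1 + u) ^ 2 * (|l - 1| * u) ≤ 1.203 / (1 + u) ^ 2 * (1e-5 * u) := by gcongr
    _ = _ := by ring

/-- For u ≤ 0.28 the linear terms cancel by the choice of the dilation and only second-order errors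
remain. Beyond 0.28 the quadratic right side is large enough to dominate the two errors separately.
-/
theorem abs_profile_sub_f_dilation_le {x u : ℝ} (hx : 0 < x) (hu : 0 < u) :
    |profile x u - f (dilation x * u)| ≤ 1.43e-5 * (12 * u ^ 2 / (1 + 0.95 * u) ^ 3) := by
  have hl := abs_dilation_sub_one_le hx
  rw [profile_eq hx hu.le]
  rcases le_total u 0.28 with h | h
  · have h1 := abs_f_mul_sub_le_near hl hu
    have h2 := abs_first_diff_sub_linear_le hx hu.le
    have h3 := abs_second_diff_le hx hu.le
    have ha0 : slope0 ≠ 0 := by linarith [slope0_bounds.1]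
    have e : slope0 * (dilation x - 1) * u = 2 * u * fluct x 3 := by
      rw [dilation]; field_simp; ring
    rw [e] at h1
    rw [dev_eq hx hu.le]
    have h4 := abs_le.1 h1
    have h5 := abs_le.1 h2
    have h6 := abs_le.1 h3
    have key : 1.303e-4 * (2 * u ^ 2 / ((4 + u) * (4 + 3 * u)))
        + 1.303e-4 * (4 * u ^ 2 / (3 * (3 + u))) + 1.651e-5 * u ^ 2
        ≤ 1.43e-5 * (12 * u ^ 2 / (1 + 0.95 * u) ^ 3) := by
      have e1 : 1.303e-4 * (2 * u ^ 2 / ((4 + u) * (4 + 3 * u)))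
        + 1.303e-4 * (4 * u ^ 2 / (3 * (3 + u))) + 1.651e-5 * u ^ 2
        = (1.303e-4 * (2 / ((4 + u) * (4 + 3 * u)))
        + 1.303e-4 * (4 / (3 * (3 + u))) + 1.651e-5) * u ^ 2 := by ring
      have e2 : 1.43e-5 * (12 * u ^ 2 / (1 + 0.95 * u) ^ 3)
        = 1.43e-5 * (12 / (1 + 0.95 * u) ^ 3) * u ^ 2 := by ring
      rw [e1, e2]
      gcongr ?_ * _
      have hv : 0 ≤ 0.28 - u := by linarith
      rw [← sub_nonneg]
      field_simp
      ring_nf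
      nlinarith [pow_nonneg hu.le 2, pow_nonneg hu.le 3, pow_nonneg hu.le 4, mul_nonneg hu.le hv,
        mul_nonneg (pow_nonneg hu.le 2) hv, mul_nonneg (pow_nonneg hu.le 3) hv,
        mul_nonneg (pow_nonneg hu.le 4) hv, mul_nonneg (pow_nonneg hu.le 5) hv]
    rw [abs_le]
    constructor <;> linarith
  · have h1 := abs_f_mul_sub_le_far hl hu
    have h2 := abs_dev_le hx hu.le
    have h4 := abs_le.1 h1
    have h5 := abs_le.1 h2
    have key : 1.43e-5 * (u * (1.3 + 3.435 * u) / (1 + 0.95 * u) ^ 3)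
        + 1.203e-5 * (u / (1 + u) ^ 2) ≤ 1.43e-5 * (12 * u ^ 2 / (1 + 0.95 * u) ^ 3) := by
      obtain ⟨w, rfl⟩ : ∃ w, u = 0.28 + w := ⟨u - 0.28, by ring⟩
      have hw : 0 ≤ w := by linarith
      rw [← sub_nonneg]
      field_simp
      ring_nf
      positivity
    rw [abs_le]
    constructor <;> linarith

/-! ### Beta integrals and perturbation of the variance functional -/

theorem integral_inv_pow {a : ℝ} (ha : 0 < a) (n : ℕ) :
    IntegrableOn (fun u : ℝ => 1 / (1 + a * u) ^ (n + 2)) (Set.Ioi 0) ∧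
      ∫ u in Set.Ioi (0 : ℝ), 1 / (1 + a * u) ^ (n + 2) = 1 / ((n + 1) * a) := by
  have hd : ∀ u ∈ Set.Ici (0 : ℝ), HasDerivAt
      (fun u => -(1 / ((n + 1) * a)) * (1 / (1 + a * u)) ^ (n + 1))
      (1 / (1 + a * u) ^ (n + 2)) u := by
    intro u hu
    have hu' : 0 < 1 + a * u := by have : (0 : ℝ) ≤ u := hu; positivity
    have h := ((hasDerivAt_inv_lin hu').pow (n + 1)).const_mul (-(1 / ((n + 1) * a)))
    refine h.congr_deriv ?_
    have : (n : ℝ) + 1 ≠ 0 := by positivity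
    rw [Nat.add_sub_cancel, div_pow, one_pow, pow_add]
    push_cast
    field_simp
  have ht : Tendsto (fun u : ℝ => -(1 / ((n + 1) * a)) * (1 / (1 + a * u)) ^ (n + 1)) atTop
      (𝓝 0) := by
    simpa using ((tendsto_inv_lin (p := 1) ha).pow (n + 1)).const_mul (-(1 / ((n + 1) * a)))
  have hpos : ∀ u ∈ Set.Ioi (0 : ℝ), 0 ≤ 1 / (1 + a * u) ^ (n + 2) := by
    intro u hu
    have : (0 : ℝ) < u := hu
    positivity
  refine ⟨integrableOn_Ioi_deriv_of_nonneg' hd hpos ht, ?_⟩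
  rw [integral_Ioi_of_hasDerivAt_of_nonneg' hd hpos ht]
  simp

/-- Induction on j through u = ((1 + au) - 1)/a, which trades one power of u for a difference of two
denominators. -/
theorem integral_pow_div_pow {a : ℝ} (ha : 0 < a) (j n : ℕ) :
    IntegrableOn (fun u : ℝ => u ^ j / (1 + a * u) ^ (n + j + 2)) (Set.Ioi 0) ∧
      ∫ u in Set.Ioi (0 : ℝ), u ^ j / (1 + a * u) ^ (n + j + 2)
        = j.factorial * n.factorial / ((n + j + 1).factorial * a ^ (j + 1)) := by
  induction j generalizing n with
  | zero =>
    obtain ⟨h1, h2⟩ := integral_inv_pow ha n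
    refine ⟨by simpa using h1, ?_⟩
    simp only [pow_zero, Nat.add_zero]
    rw [h2, Nat.factorial_succ]
    have : (n.factorial : ℝ) ≠ 0 := by positivity
    push_cast
    simp
    field_simp
  | succ j ih =>
    have he : ∀ u ∈ Set.Ioi (0 : ℝ), u ^ (j + 1) / (1 + a * u) ^ (n + (j + 1) + 2)
        = 1 / a * (u ^ j / (1 + a * u) ^ (n + j + 2)
          - u ^ j / (1 + a * u) ^ (n + 1 + j + 2)) := by
      intro u hu
      have : (0 : ℝ) < u := hu
      have h1 : 0 < 1 + a * u := by positivity
      rw [show n + (j + 1) + 2 = n + j + 2 + 1 by ring, show n + 1 + j + 2 = n + j + 2 + 1 by ring]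
      field_simp
      ring
    obtain ⟨h1, h2⟩ := ih n
    obtain ⟨h3, h4⟩ := ih (n + 1)
    refine ⟨?_, ?_⟩
    · exact IntegrableOn.congr_fun ((h1.sub h3).const_mul (1 / a))
        (fun u hu => (he u hu).symm) measurableSet_Ioi
    · rw [setIntegral_congr_fun measurableSet_Ioi he, integral_const_mul, integral_sub h1 h3, h2,
        h4, show n + 1 + j + 1 = (n + j + 1) + 1 by ring,
        show n + (j + 1) + 1 = (n + j + 1) + 1 by ring, Nat.factorial_succ (n + j + 1),
        Nat.factorial_succ n, Nat.factorial_succ j]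
      have : ((n + j + 1).factorial : ℝ) ≠ 0 := by positivity
      push_cast
      field_simp
      ring

/-- The variance functional of a Laplace transform with `m` independent rows. -/
noncomputable def varFun (g : ℝ → ℝ) (m : ℕ) : ℝ :=
  (∫ u in Set.Ioi (0 : ℝ), u * g u ^ m) - (∫ u in Set.Ioi (0 : ℝ), g u ^ m) ^ 2

/-- `g` is measurable on the half-line and lies between `0` and `(1 + a u)⁻¹`. -/
structure Majorised (g : ℝ → ℝ) (a : ℝ) : Prop where
  pos : 0 < a
  meas : AEStronglyMeasurable g (volume.restrict (Set.Ioi 0))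
  nonneg : ∀ u, 0 < u → 0 ≤ g u
  le : ∀ u, 0 < u → g u ≤ 1 / (1 + a * u)

namespace Majorised

variable {g : ℝ → ℝ} {a : ℝ}

theorem pow_le (hg : Majorised g a) (m : ℕ) {u : ℝ} (hu : 0 < u) :
    g u ^ m ≤ 1 / (1 + a * u) ^ m := by
  have := pow_le_pow_left₀ (hg.nonneg u hu) (hg.le u hu) m
  rwa [div_pow, one_pow] at this

theorem integrableOn_pow (hg : Majorised g a) {m : ℕ} (hm : 2 ≤ m) :
    IntegrableOn (fun u => g u ^ m) (Set.Ioi 0) := by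
  obtain ⟨n, rfl⟩ := Nat.exists_eq_add_of_le' hm
  refine (integral_inv_pow hg.pos n).1.mono' (hg.meas.pow _) ?_
  filter_upwards [ae_restrict_mem measurableSet_Ioi] with u hu
  rw [Real.norm_of_nonneg (pow_nonneg (hg.nonneg u hu) _)]
  exact hg.pow_le _ hu

theorem integrableOn_mul_pow (hg : Majorised g a) {m : ℕ} (hm : 3 ≤ m) :
    IntegrableOn (fun u => u * g u ^ m) (Set.Ioi 0) := by
  obtain ⟨n, rfl⟩ := Nat.exists_eq_add_of_le' hm
  refine (integral_pow_div_pow hg.pos 1 n).1.mono'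
    (measurable_id.aestronglyMeasurable.mul (hg.meas.pow _)) ?_
  filter_upwards [ae_restrict_mem measurableSet_Ioi] with u hu
  have hu0 : (0 : ℝ) < u := hu
  rw [Real.norm_of_nonneg (mul_nonneg hu0.le (pow_nonneg (hg.nonneg u hu) _)), pow_one,
    div_eq_mul_one_div]
  exact mul_le_mul_of_nonneg_left (hg.pow_le _ hu) hu0.le

theorem integral_pow_le (hg : Majorised g a) (n : ℕ) :
    ∫ u in Set.Ioi (0 : ℝ), g u ^ (n + 2) ≤ 1 / ((n + 1) * a) := by
  rw [← (integral_inv_pow hg.pos n).2]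
  exact setIntegral_mono_on (hg.integrableOn_pow (by omega)) (integral_inv_pow hg.pos n).1
    measurableSet_Ioi fun u hu => hg.pow_le _ hu

theorem integral_mul_pow_le (hg : Majorised g a) (n : ℕ) :
    ∫ u in Set.Ioi (0 : ℝ), u * g u ^ (n + 3) ≤ 1 / ((n + 1) * (n + 2) * a ^ 2) := by
  have h := (integral_pow_div_pow hg.pos 1 n).2
  have : ((1 : ℕ).factorial * n.factorial / ((n + 1 + 1).factorial * a ^ (1 + 1)) : ℝ)
      = 1 / ((n + 1) * (n + 2) * a ^ 2) := by
    rw [Nat.factorial_succ (n + 1), Nat.factorial_succ n]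
    have : (n.factorial : ℝ) ≠ 0 := by positivity
    have := hg.pos
    push_cast
    simp
    field_simp
    ring
  rw [← this, ← h]
  refine setIntegral_mono_on (hg.integrableOn_mul_pow (by omega)) (integral_pow_div_pow hg.pos 1 n).1
    measurableSet_Ioi fun u hu => ?_
  have hu0 : (0 : ℝ) < u := hu
  rw [pow_one, div_eq_mul_one_div]
  exact mul_le_mul_of_nonneg_left (hg.pow_le _ hu) hu0.le

theorem le_integral_pow (hg : Majorised g a) {b : ℝ} (hb : 0 < b)
    (h : ∀ u, 0 < u → 1 / (1 + b * u) ^ 2 ≤ g u) (n : ℕ) :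
    1 / ((2 * n + 3) * b) ≤ ∫ u in Set.Ioi (0 : ℝ), g u ^ (n + 2) := by
  have h1 := integral_inv_pow hb (2 * n + 2)
  have h2 : (1 : ℝ) / ((2 * n + 3) * b) = 1 / ((((2 * n + 2 : ℕ) : ℝ) + 1) * b) := by
    push_cast; ring
  rw [h2, ← h1.2]
  refine setIntegral_mono_on h1.1 (hg.integrableOn_pow (by omega)) measurableSet_Ioi fun u hu => ?_
  have hu0 : (0 : ℝ) < u := hu
  have := pow_le_pow_left₀ (by positivity) (h u hu) (n + 2)
  rw [div_pow, one_pow, ← pow_mul] at this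
  rwa [show 2 * n + 2 + 2 = 2 * (n + 2) by ring]

theorem le_integral_mul_pow (hg : Majorised g a) {b : ℝ} (hb : 0 < b)
    (h : ∀ u, 0 < u → 1 / (1 + b * u) ^ 2 ≤ g u) (n : ℕ) :
    1 / ((2 * n + 4) * (2 * n + 5) * b ^ 2) ≤ ∫ u in Set.Ioi (0 : ℝ), u * g u ^ (n + 3) := by
  have h1 := integral_pow_div_pow hb 1 (2 * n + 3)
  have h2 : (1 : ℝ) / ((2 * n + 4) * (2 * n + 5) * b ^ 2) = ((1 : ℕ).factorial *
      (2 * n + 3).factorial / ((2 * n + 3 + 1 + 1).factorial * b ^ (1 + 1)) : ℝ) := by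
    rw [Nat.factorial_succ (2 * n + 3 + 1), Nat.factorial_succ (2 * n + 3)]
    have : ((2 * n + 3).factorial : ℝ) ≠ 0 := by positivity
    push_cast
    simp
    field_simp
    ring
  rw [h2, ← h1.2]
  refine setIntegral_mono_on h1.1 (hg.integrableOn_mul_pow (by omega)) measurableSet_Ioi
    fun u hu => ?_
  have hu0 : (0 : ℝ) < u := hu
  have := pow_le_pow_left₀ (by positivity) (h u hu) (n + 3)
  rw [div_pow, one_pow, ← pow_mul] at this
  rw [show 2 * n + 3 + 1 + 2 = 2 * (n + 3) by ring, pow_one, div_eq_mul_one_div]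
  exact mul_le_mul_of_nonneg_left this hu0.le

/-- Factoring the difference of squares turns the difference of functionals into one integral with
weight u - T, where T is the sum of the two first-order integrals. Keeping the moments together
preserves the cancellation between them. -/
theorem varFun_sub {h : ℝ → ℝ} {b : ℝ} (hg : Majorised g a) (hh : Majorised h b) {m : ℕ}
    (hm : 3 ≤ m) :
    IntegrableOn (fun u => (g u ^ m - h u ^ m) * (u - ((∫ u in Set.Ioi (0 : ℝ), g u ^ m)
        + ∫ u in Set.Ioi (0 : ℝ), h u ^ m))) (Set.Ioi 0) ∧
    varFun g m - varFun h m = ∫ u in Set.Ioi (0 : ℝ), (g u ^ m - h u ^ m) *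
      (u - ((∫ u in Set.Ioi (0 : ℝ), g u ^ m) + ∫ u in Set.Ioi (0 : ℝ), h u ^ m)) := by
  set A := ∫ u in Set.Ioi (0 : ℝ), g u ^ m with hA
  set B := ∫ u in Set.Ioi (0 : ℝ), h u ^ m with hB
  have g0 := hg.integrableOn_pow (show 2 ≤ m by omega)
  have h0 := hh.integrableOn_pow (show 2 ≤ m by omega)
  have g1 := hg.integrableOn_mul_pow hm
  have h1 := hh.integrableOn_mul_pow hm
  have he : (fun u => (g u ^ m - h u ^ m) * (u - (A + B))) =
      fun u => (u * g u ^ m - u * h u ^ m) - (A + B) * (g u ^ m - h u ^ m) := by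
    funext u; ring
  rw [he]
  have i1 : IntegrableOn (fun u => u * g u ^ m - u * h u ^ m) (Set.Ioi 0) := g1.sub h1
  have i2 : IntegrableOn (fun u => g u ^ m - h u ^ m) (Set.Ioi 0) := g0.sub h0
  refine ⟨i1.sub (i2.const_mul _), ?_⟩
  rw [integral_sub i1 (i2.const_mul _), integral_sub g1 h1, integral_const_mul, integral_sub g0 h0,
    varFun, varFun, ← hA, ← hB]
  ring

end Majorised

/-- `F` is integrable on the half-line with integral `v`. -/
def HasIntegral (F : ℝ → ℝ) (v : ℝ) : Prop :=
  IntegrableOn F (Set.Ioi 0) ∧ ∫ u in Set.Ioi (0 : ℝ), F u = v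

namespace HasIntegral

variable {F G : ℝ → ℝ} {v w : ℝ}

theorem add (hF : HasIntegral F v) (hG : HasIntegral G w) :
    HasIntegral (fun u => F u + G u) (v + w) :=
  ⟨hF.1.add hG.1, by rw [integral_add hF.1 hG.1, hF.2, hG.2]⟩

theorem sub (hF : HasIntegral F v) (hG : HasIntegral G w) :
    HasIntegral (fun u => F u - G u) (v - w) :=
  ⟨hF.1.sub hG.1, by rw [integral_sub hF.1 hG.1, hF.2, hG.2]⟩

theorem const_mul (hF : HasIntegral F v) (c : ℝ) : HasIntegral (fun u => c * F u) (c * v) :=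
  ⟨Integrable.const_mul hF.1 c, by rw [integral_const_mul, hF.2]⟩

end HasIntegral

section Moments

variable {a : ℝ}

theorem hasIntegral_div_pow_one (ha : 0 < a) (n : ℕ) :
    HasIntegral (fun u => u / (1 + a * u) ^ (n + 3)) (1 / ((n + 1) * (n + 2) * a ^ 2)) := by
  have h := integral_pow_div_pow ha 1 n
  simp only [pow_one] at h
  rw [show n + 3 = n + 1 + 2 by ring]
  refine ⟨h.1, ?_⟩
  rw [h.2, Nat.factorial_succ (n + 1), Nat.factorial_succ n]
  have : (n.factorial : ℝ) ≠ 0 := by positivity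
  push_cast
  simp only [Nat.factorial]
  field_simp
  push_cast
  ring

theorem hasIntegral_div_pow_two (ha : 0 < a) (n : ℕ) :
    HasIntegral (fun u => u ^ 2 / (1 + a * u) ^ (n + 4))
      (2 / ((n + 1) * (n + 2) * (n + 3) * a ^ 3)) := by
  rw [show n + 4 = n + 2 + 2 by ring]
  refine ⟨(integral_pow_div_pow ha 2 n).1, ?_⟩
  rw [(integral_pow_div_pow ha 2 n).2,
    Nat.factorial_succ (n + 2), Nat.factorial_succ (n + 1), Nat.factorial_succ n]
  have : (n.factorial : ℝ) ≠ 0 := by positivity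
  push_cast
  simp only [Nat.factorial]
  field_simp
  push_cast
  ring

theorem hasIntegral_div_pow_three (ha : 0 < a) (n : ℕ) :
    HasIntegral (fun u => u ^ 3 / (1 + a * u) ^ (n + 5))
      (6 / ((n + 1) * (n + 2) * (n + 3) * (n + 4) * a ^ 4)) := by
  rw [show n + 5 = n + 3 + 2 by ring]
  refine ⟨(integral_pow_div_pow ha 3 n).1, ?_⟩
  rw [(integral_pow_div_pow ha 3 n).2,
    Nat.factorial_succ (n + 3), Nat.factorial_succ (n + 2), Nat.factorial_succ (n + 1),
    Nat.factorial_succ n]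
  have : (n.factorial : ℝ) ≠ 0 := by positivity
  push_cast
  simp only [Nat.factorial]
  field_simp
  push_cast
  ring

theorem hasIntegral_div_pow_four (ha : 0 < a) (n : ℕ) :
    HasIntegral (fun u => u ^ 4 / (1 + a * u) ^ (n + 6))
      (24 / ((n + 1) * (n + 2) * (n + 3) * (n + 4) * (n + 5) * a ^ 5)) := by
  rw [show n + 6 = n + 4 + 2 by ring]
  refine ⟨(integral_pow_div_pow ha 4 n).1, ?_⟩
  rw [(integral_pow_div_pow ha 4 n).2,
    Nat.factorial_succ (n + 4), Nat.factorial_succ (n + 3), Nat.factorial_succ (n + 2),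
    Nat.factorial_succ (n + 1), Nat.factorial_succ n]
  have : (n.factorial : ℝ) ≠ 0 := by positivity
  push_cast
  simp only [Nat.factorial]
  field_simp
  push_cast
  ring

end Moments

theorem abs_pow_sub_pow_le_of_le {g h M : ℝ} (hg : 0 ≤ g) (hh : 0 ≤ h) (hgM : g ≤ M) (hhM : h ≤ M)
    (n : ℕ) : |g ^ (n + 1) - h ^ (n + 1)| ≤ (n + 1) * M ^ n * |g - h| := by
  have h1 := abs_pow_sub_pow_le (a := g) (b := h) (n := n + 1)
  have h2 : max |g| |h| ^ n ≤ M ^ n := by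
    rw [abs_of_nonneg hg, abs_of_nonneg hh]
    exact pow_le_pow_left₀ (hg.trans (le_max_left _ _)) (max_le hgM hhM) n
  calc |g ^ (n + 1) - h ^ (n + 1)| ≤ |g - h| * (n + 1 : ℕ) * max |g| |h| ^ (n + 1 - 1) := h1
    _ ≤ |g - h| * (n + 1 : ℕ) * M ^ n := by rw [Nat.add_sub_cancel]; gcongr
    _ = _ := by push_cast; ring

/-- Perturbation bound for the variance functional. The weight `|u - T|` is estimated by
the arithmetic-geometric mean inequality with parameter `s`. -/
theorem abs_varFun_sub_le {g h : ℝ → ℝ} {a κ α β s L H : ℝ} (hg : Majorised g a)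
    (hh : Majorised h a) (hκ : 0 ≤ κ) (hα : 0 ≤ α) (hβ : 0 ≤ β) (hs : 0 < s) (hL : 0 ≤ L) (p : ℕ)
    (hgh : ∀ u, 0 < u → |g u - h u| ≤
      κ * (α * u / (1 + a * u) ^ 2 + β * u ^ 2 / (1 + a * u) ^ 3))
    (hTL : L ≤ (∫ u in Set.Ioi (0 : ℝ), g u ^ (p + 3)) + ∫ u in Set.Ioi (0 : ℝ), h u ^ (p + 3))
    (hTH : (∫ u in Set.Ioi (0 : ℝ), g u ^ (p + 3)) + (∫ u in Set.Ioi (0 : ℝ), h u ^ (p + 3)) ≤ H) :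
    |varFun g (p + 3) - varFun h (p + 3)| ≤ (p + 3) * κ / 2 *
      (1 / s * (α * (6 / ((p + 1) * (p + 2) * (p + 3) * (p + 4) * a ^ 4)
            - 2 * L * (2 / ((p + 2) * (p + 3) * (p + 4) * a ^ 3))
            + H ^ 2 * (1 / ((p + 3) * (p + 4) * a ^ 2)))
          + β * (24 / ((p + 1) * (p + 2) * (p + 3) * (p + 4) * (p + 5) * a ^ 5)
            - 2 * L * (6 / ((p + 2) * (p + 3) * (p + 4) * (p + 5) * a ^ 4))
            + H ^ 2 * (2 / ((p + 3) * (p + 4) * (p + 5) * a ^ 3))))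
        + s * (α * (1 / ((p + 1) * (p + 2) * a ^ 2))
          + β * (2 / ((p + 1) * (p + 2) * (p + 3) * a ^ 3)))) := by
  obtain ⟨hi, he⟩ := hg.varFun_sub hh (show 3 ≤ p + 3 by omega)
  set T := (∫ u in Set.Ioi (0 : ℝ), g u ^ (p + 3)) + ∫ u in Set.Ioi (0 : ℝ), h u ^ (p + 3)
    with hT
  have ha := hg.pos
  have e1 := hasIntegral_div_pow_one ha p
  have e1' := hasIntegral_div_pow_one ha (p + 2)
  have e2 := hasIntegral_div_pow_two ha p
  have e2' := hasIntegral_div_pow_two ha (p + 1)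
  have e2'' := hasIntegral_div_pow_two ha (p + 2)
  have e3 := hasIntegral_div_pow_three ha p
  have e3' := hasIntegral_div_pow_three ha (p + 1)
  have e4 := hasIntegral_div_pow_four ha p
  rw [show p + 2 + 3 = p + 5 by ring] at e1'
  rw [show p + 1 + 4 = p + 5 by ring] at e2'
  rw [show p + 2 + 4 = p + 6 by ring] at e2''
  rw [show p + 1 + 5 = p + 6 by ring] at e3'
  have j1 := (e3.sub (e2'.const_mul (2 * T))).add (e1'.const_mul (T ^ 2))
  have j2 := (e4.sub (e3'.const_mul (2 * T))).add (e2''.const_mul (T ^ 2))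
  have j3 := ((j1.const_mul α).add (j2.const_mul β)).const_mul (1 / s)
  have j4 := ((e1.const_mul α).add (e2.const_mul β)).const_mul s
  have j5 := (j3.add j4).const_mul ((p + 3) * κ / 2)
  have hle : ∀ u ∈ Set.Ioi (0 : ℝ), ‖(g u ^ (p + 3) - h u ^ (p + 3)) * (u - T)‖ ≤
      (p + 3) * κ / 2 * (1 / s * (α * (u ^ 3 / (1 + a * u) ^ (p + 5)
          - 2 * T * (u ^ 2 / (1 + a * u) ^ (p + 5)) + T ^ 2 * (u / (1 + a * u) ^ (p + 5)))
        + β * (u ^ 4 / (1 + a * u) ^ (p + 6)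
          - 2 * T * (u ^ 3 / (1 + a * u) ^ (p + 6)) + T ^ 2 * (u ^ 2 / (1 + a * u) ^ (p + 6))))
        + s * (α * (u / (1 + a * u) ^ (p + 3)) + β * (u ^ 2 / (1 + a * u) ^ (p + 4)))) := by
    intro u hu
    have hu0 : (0 : ℝ) < u := hu
    have hD : 0 < 1 + a * u := by positivity
    rw [Real.norm_eq_abs, abs_mul]
    have b1 := abs_pow_sub_pow_le_of_le (hg.nonneg u hu) (hh.nonneg u hu) (hg.le u hu)
      (hh.le u hu) (p + 2)
    have b2 := hgh u hu
    -- The factor 1 + au inside the inequality keeps every resulting integral of the form u^j/(1 +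
    -- au)^k, so that it is evaluated exactly.
    have b3 : |u - T| ≤ 1 / 2 * ((u - T) ^ 2 / (s * (1 + a * u)) + s * (1 + a * u)) := by
      have : 0 < s * (1 + a * u) := by positivity
      rw [← sq_abs (u - T)]
      set w := |u - T|
      rw [← sub_nonneg]
      have : 1 / 2 * (w ^ 2 / (s * (1 + a * u)) + s * (1 + a * u)) - w
          = (w - s * (1 + a * u)) ^ 2 / (2 * (s * (1 + a * u))) := by
        field_simp; ring
      rw [this]; positivity
    calc |g u ^ (p + 3) - h u ^ (p + 3)| * |u - T|
        ≤ ((((p + 2 : ℕ) : ℝ) + 1) * (1 / (1 + a * u)) ^ (p + 2) *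
            (κ * (α * u / (1 + a * u) ^ 2 + β * u ^ 2 / (1 + a * u) ^ 3))) *
            (1 / 2 * ((u - T) ^ 2 / (s * (1 + a * u)) + s * (1 + a * u))) := by
          refine mul_le_mul (b1.trans ?_) b3 (abs_nonneg _) (by positivity)
          gcongr
      _ = _ := by
          rw [div_pow, one_pow]
          push_cast
          simp only [pow_add]
          field_simp
          ring
  have key : |varFun g (p + 3) - varFun h (p + 3)| ≤ (p + 3) * κ / 2 *
      (1 / s * (α * (6 / ((p + 1) * (p + 2) * (p + 3) * (p + 4) * a ^ 4)
            - 2 * T * (2 / ((p + 2) * (p + 3) * (p + 4) * a ^ 3))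
            + T ^ 2 * (1 / ((p + 3) * (p + 4) * a ^ 2)))
          + β * (24 / ((p + 1) * (p + 2) * (p + 3) * (p + 4) * (p + 5) * a ^ 5)
            - 2 * T * (6 / ((p + 2) * (p + 3) * (p + 4) * (p + 5) * a ^ 4))
            + T ^ 2 * (2 / ((p + 3) * (p + 4) * (p + 5) * a ^ 3))))
        + s * (α * (1 / ((p + 1) * (p + 2) * a ^ 2))
          + β * (2 / ((p + 1) * (p + 2) * (p + 3) * a ^ 3)))) := by
    rw [he, ← Real.norm_eq_abs]
    refine (norm_integral_le_integral_norm _).trans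
      ((setIntegral_mono_on hi.norm j5.1 measurableSet_Ioi hle).trans (le_of_eq ?_))
    rw [j5.2]
    push_cast
    ring
  refine key.trans ?_
  -- T enters linearly with a negative coefficient and quadratically with a positive one, so the
  -- lower bound L replaces it in the former and the upper bound H in the latter.
  have hT0 : 0 ≤ T := hL.trans hTL
  gcongr

/-! ### The oscillation of the variance functional for every m ≥ 3 -/

theorem measurable_rowWeight (y : ℝ) : Measurable fun u => rowWeight y u := by
  unfold rowWeight
  fun_prop

theorem measurable_profile {x : ℝ} (hx : 0 < x) :
    AEStronglyMeasurable (profile x) (volume.restrict (Set.Ioi 0)) := by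
  have h : Measurable fun u =>
      (∑' k : ℤ, ENNReal.ofReal (rowWeight (x * 2 ^ k) (u * (x * 2 ^ k)))).toReal := by
    refine Measurable.ennreal_toReal (Measurable.tsum fun k => ?_)
    exact ((measurable_rowWeight _).comp (measurable_id.mul_const _)).ennreal_ofReal
  refine h.aestronglyMeasurable.congr ?_
  filter_upwards [ae_restrict_mem measurableSet_Ioi] with u hu
  rw [profile, ← ENNReal.ofReal_tsum_of_nonneg (fun k => rowWeight_nonneg (by positivity) _)
    (hasSum_rowWeight hx (le_of_lt hu)).summable, ENNReal.toReal_ofReal]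
  exact tsum_nonneg fun k => rowWeight_nonneg (by positivity) _

theorem slope0_pos : 0 < slope0 := by linarith [slope0_bounds.1]

theorem majorised_f : Majorised f slope0 where
  pos := slope0_pos
  meas := (continuousOn_f.mono Set.Ioi_subset_Ici_self).aestronglyMeasurable measurableSet_Ioi
  nonneg _ hu := (f_pos hu.le).le
  le _ hu := f_le_inv hu.le

theorem Majorised.mono {g : ℝ → ℝ} {a b : ℝ} (hg : Majorised g a) (hb : 0 < b) (hba : b ≤ a) :
    Majorised g b where
  pos := hb
  meas := hg.meas
  nonneg := hg.nonneg
  le u hu := (hg.le u hu).trans (by gcongr)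

theorem majorised_f_comp {l b : ℝ} (hb : 0 < b) (hl : 0 < l) (h : b ≤ slope0 * l) :
    Majorised (fun u => f (l * u)) b where
  pos := hb
  meas := by
    refine ContinuousOn.aestronglyMeasurable ?_ measurableSet_Ioi
    refine continuousOn_f.comp (by fun_prop) fun u hu => ?_
    have : (0 : ℝ) < u := hu
    exact (by positivity : 0 ≤ l * u)
  nonneg u hu := (f_pos (by positivity)).le
  le u hu := by
    refine (f_le_inv (by positivity)).trans ?_
    rw [← mul_assoc]
    gcongr

/-- Lowering the slope from 0.9617 to 0.95 leaves room for `dev`. -/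
theorem majorised_profile {x : ℝ} (hx : 0 < x) : Majorised (profile x) 0.95 where
  pos := by norm_num
  meas := measurable_profile hx
  nonneg u _ := profile_nonneg hx u
  le u hu := by
    rw [profile_eq hx hu.le]
    have h1 := f_le_inv hu.le
    have h2 := (abs_le.1 (abs_dev_le hx hu.le)).2
    have h3 : 1 / (1 + slope0 * u) ≤ 1 / (1 + 0.9617 * u) := by
      gcongr; exact slope0_bounds.1.le
    have h4 : 1 / (1 + 0.9617 * u) + 1.43e-5 * (u * (1.3 + 3.435 * u) / (1 + 0.95 * u) ^ 3)
        ≤ 1 / (1 + 0.95 * u) := by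
      rw [← sub_nonneg]
      field_simp
      ring_nf
      positivity
    linarith

/-- The first logarithm of f dominates the third, and the second alone is at least 1/(4 + 3u) before
division by log 2. This linear decay beats the inverse-square minorant at infinity, where f must
absorb `dev`. -/
theorem f_ge_inv {u : ℝ} (hu : 0 ≤ u) : 1.44 / (4 + 3 * u) ≤ f u := by
  have hL := log_two_bounds
  have h1 : Real.log ((4 + u) / (3 + u)) ≤ Real.log ((2 + u) / (1 + u)) := by
    refine Real.log_le_log (by positivity) ?_
    rw [div_le_div_iff₀ (by positivity) (by positivity)]
    nlinarith
  have h2 := Real.one_sub_inv_le_log_of_pos (x := (4 + 3 * u) / (3 + 3 * u)) (by positivity)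
  have h3 : 1 - ((4 + 3 * u) / (3 + 3 * u))⁻¹ = 1 / (4 + 3 * u) := by field_simp; ring
  rw [h3] at h2
  have h4 : f u = (Real.log ((2 + u) / (1 + u)) + Real.log ((4 + 3 * u) / (3 + 3 * u))
    - Real.log ((4 + u) / (3 + u))) / Real.log 2 := by
    simp only [f, Real.logb]; ring
  rw [h4, le_div_iff₀ (by linarith)]
  calc 1.44 / (4 + 3 * u) * Real.log 2 = (1.44 * Real.log 2) * (1 / (4 + 3 * u)) := by ring
    _ ≤ 1 * (1 / (4 + 3 * u)) := by gcongr; linarith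
    _ ≤ _ := by linarith

theorem inv_sq_le_f {u : ℝ} (hu : 0 ≤ u) : 1 / (1 + 0.481 * u) ^ 2 ≤ f u := by
  refine le_trans ?_ (f_ge_inv_sq hu)
  have := slope0_pos
  gcongr
  linarith [slope0_bounds.2]

theorem inv_sq_le_profile {x u : ℝ} (hx : 0 < x) (hu : 0 ≤ u) :
    1 / (1 + 0.49 * u) ^ 2 ≤ profile x u := by
  rw [profile_eq hx hu]
  have h1 := inv_sq_le_f hu
  have h2 := f_ge_inv hu
  have h3 := (abs_le.1 (abs_dev_le hx hu)).1
  have h4 : 1.43e-5 * (u * (1.3 + 3.435 * u) / (1 + 0.95 * u) ^ 3)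
      -- The deviation costs at most the fraction 0.01u/(1 + 0.481u) of f. The factor left over is
      -- (1 + 0.471u)/(1 + 0.481u), which the passage from 0.481 to 0.49 pays for.
      ≤ 0.01 * u / (1 + 0.481 * u) * (1.44 / (4 + 3 * u)) := by
    rw [← sub_nonneg]
    field_simp
    ring_nf
    positivity
  have h5 : 0.01 * u / (1 + 0.481 * u) * (1.44 / (4 + 3 * u)) ≤ 0.01 * u / (1 + 0.481 * u) * f u := by
    gcongr
  have h6 : (1 + 0.471 * u) / (1 + 0.481 * u) * (1 / (1 + 0.481 * u) ^ 2) ≤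
      (1 + 0.471 * u) / (1 + 0.481 * u) * f u := by
    gcongr
  have h7 : 1 / (1 + 0.49 * u) ^ 2 ≤
      (1 + 0.471 * u) / (1 + 0.481 * u) * (1 / (1 + 0.481 * u) ^ 2) := by
    rw [← sub_nonneg]
    field_simp
    ring_nf
    positivity
  have h8 : (1 + 0.471 * u) / (1 + 0.481 * u) * f u = f u - 0.01 * u / (1 + 0.481 * u) * f u := by
    field_simp
    ring
  linarith

theorem le_I₀ (p : ℕ) : 1 / (0.481 * (2 * p + 5)) ≤ I₀ (p + 3) := by
  have := majorised_f.le_integral_pow (b := 0.481) (by norm_num)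
    (fun u hu => inv_sq_le_f hu.le) (p + 1)
  rw [show p + 1 + 2 = p + 3 by ring] at this
  refine le_trans (le_of_eq ?_) this
  push_cast
  ring

/-- The profile is compared with f directly, without a dilation; for each of these finitely many m
the perturbation bound is a number to check. The parameter s is of order 1/m, the scale on which |u
- T| lives. -/
theorem abs_varFun_profile_sub_le_of_small {x : ℝ} (hx : 0 < x) (m : ℕ) (h4 : 4 ≤ m) (hm : m ≤ 20) :
    |varFun (profile x) m - varFun f m| ≤ 8.4e-5 / m ∧
      |varFun (profile x) m - varFun f m| ≤ 1e-3 / m * I₀ m ^ 2 := by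
  obtain ⟨p, rfl⟩ := Nat.exists_eq_add_of_le' (show 3 ≤ m by omega)
  have hg := majorised_profile hx
  have hf := majorised_f.mono (b := 0.95) (by norm_num) (by linarith [slope0_bounds.1])
  have l1 := hg.le_integral_pow (b := 0.49) (by norm_num)
    (fun u hu => inv_sq_le_profile hx hu.le) (p + 1)
  have l2 := hf.le_integral_pow (b := 0.49) (by norm_num)
    (fun u hu => le_trans (by gcongr; norm_num) (inv_sq_le_f hu.le)) (p + 1)
  have r1 := hg.integral_pow_le (p + 1)
  have r2 := hf.integral_pow_le (p + 1)
  rw [show p + 1 + 2 = p + 3 by ring] at l1 l2 r1 r2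
  have key := abs_varFun_sub_le (κ := 1.43e-5) (α := 1.3) (β := 2.2) (s := 1.8 / (p + 3) / 0.95)
    hg hf (by norm_num) (by norm_num) (by norm_num) (by positivity) (by positivity) p
    (fun u hu => ?_) (add_le_add l1 l2) (add_le_add r1 r2)
  · have hI := le_I₀ p
    have hI2 : (1 / (0.481 * (2 * p + 5))) ^ 2 ≤ I₀ (p + 3) ^ 2 := by gcongr
    have hI3 : (1e-3 : ℝ) / (p + 3 : ℕ) * (1 / (0.481 * (2 * p + 5))) ^ 2 ≤
      1e-3 / (p + 3 : ℕ) * I₀ (p + 3) ^ 2 := by gcongr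
    refine ⟨key.trans ?_, key.trans (le_trans ?_ hI3)⟩
    all_goals
      clear key hI hI2 hI3 l1 l2 r1 r2
      have h1 : 1 ≤ p := by omega
      have h2 : p ≤ 17 := by omega
      interval_cases p <;> norm_num
  · rw [profile_eq hx hu.le, add_sub_cancel_left]
    refine (abs_dev_le hx hu.le).trans (le_of_eq ?_)
    field_simp
    ring

theorem integral_pow_comp_mul (g : ℝ → ℝ) {l : ℝ} (hl : 0 < l) (m : ℕ) :
    ∫ u in Set.Ioi (0 : ℝ), g (l * u) ^ m = l⁻¹ * ∫ u in Set.Ioi (0 : ℝ), g u ^ m := by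
  have h := integral_comp_mul_left_Ioi (fun u => g u ^ m) 0 hl
  simpa using h

theorem varFun_comp_mul (g : ℝ → ℝ) {l : ℝ} (hl : 0 < l) (m : ℕ) :
    varFun (fun u => g (l * u)) m = varFun g m / l ^ 2 := by
  have h := integral_comp_mul_left_Ioi (fun u => u * g u ^ m) 0 hl
  simp only [mul_zero, smul_eq_mul, mul_assoc, integral_const_mul] at h
  have h' : ∫ u in Set.Ioi (0 : ℝ), u * g (l * u) ^ m =
      (l ^ 2)⁻¹ * ∫ u in Set.Ioi (0 : ℝ), u * g u ^ m := by
    set X := ∫ u in Set.Ioi (0 : ℝ), u * g (l * u) ^ m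
    set Z := ∫ u in Set.Ioi (0 : ℝ), u * g u ^ m
    field_simp at h ⊢
    exact h
  rw [varFun, varFun, h', integral_pow_comp_mul g hl]
  field_simp

/-- The tangent sandwich determines both moments of f^m up to a relative error O(1/m) with equal
leading terms, so their combination is O(m⁻³). Hence a dilation of size 1e-5 is harmless for large
m. -/
theorem abs_varFun_f_le (p : ℕ) :
    |varFun f (p + 3)| ≤ 1.0815 * (1 / ((p + 1) * (p + 2)) - 4 / (2 * p + 5) ^ 2) := by
  have hs := slope0_pos
  have hb : ∀ u, 0 < u → 1 / (1 + slope0 / 2 * u) ^ 2 ≤ f u := fun u hu => f_ge_inv_sq hu.le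
  have u1 := majorised_f.integral_mul_pow_le p
  have u0 := majorised_f.integral_pow_le (p + 1)
  have l1 := majorised_f.le_integral_mul_pow (b := slope0 / 2) (by positivity) hb p
  have l0 := majorised_f.le_integral_pow (b := slope0 / 2) (by positivity) hb (p + 1)
  rw [show p + 1 + 2 = p + 3 by ring] at u0 l0
  push_cast at u0 l0
  set A := ∫ u in Set.Ioi (0 : ℝ), f u ^ (p + 3)
  have hA0 : 0 ≤ 1 / ((2 * ((p : ℝ) + 1) + 3) * (slope0 / 2)) := by positivity
  have l0' := pow_le_pow_left₀ hA0 l0 2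
  have u0' := pow_le_pow_left₀ (hA0.trans l0) u0 2
  have hd : 0 ≤ 1 / (((p : ℝ) + 1) * (p + 2)) - 4 / (2 * p + 5) ^ 2 := by
    rw [sub_nonneg, div_le_div_iff₀ (by positivity) (by positivity)]
    nlinarith
  have hc : (1 / slope0) ^ 2 ≤ 1.0815 := by
    have : 1 / slope0 ≤ 1 / 0.9617 := by gcongr; exact slope0_bounds.1.le
    calc (1 / slope0) ^ 2 ≤ (1 / 0.9617) ^ 2 := by gcongr
      _ ≤ 1.0815 := by norm_num
  refine le_trans ?_ (mul_le_mul_of_nonneg_right hc hd)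
  rw [varFun, abs_le]
  constructor
  · have e : -((1 / slope0) ^ 2 * (1 / (((p : ℝ) + 1) * (p + 2)) - 4 / (2 * p + 5) ^ 2)) ≤
        1 / ((2 * p + 4) * (2 * p + 5) * (slope0 / 2) ^ 2) - (1 / ((p + 1 + 1) * slope0)) ^ 2 := by
      rw [← sub_nonneg]
      field_simp
      ring_nf
      positivity
    linarith
  · have e : 1 / (((p : ℝ) + 1) * (p + 2) * slope0 ^ 2)
        - (1 / ((2 * ((p : ℝ) + 1) + 3) * (slope0 / 2))) ^ 2
        = (1 / slope0) ^ 2 * (1 / (((p : ℝ) + 1) * (p + 2)) - 4 / (2 * p + 5) ^ 2) := by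
      field_simp
      ring
    linarith

theorem abs_inv_sq_sub_one_le {l : ℝ} (hl : |l - 1| ≤ 1e-5) : |1 / l ^ 2 - 1| ≤ 2.01e-5 := by
  obtain ⟨h1, h2⟩ := abs_le.1 hl
  have hl0 : 0 < l := by linarith
  rw [abs_le]
  constructor
  · rw [← sub_nonneg]
    have : 1 / l ^ 2 - 1 - -2.01e-5 = (1 - (1 - 2.01e-5) * l ^ 2) / l ^ 2 := by
      field_simp; ring
    rw [this]
    apply div_nonneg _ (by positivity)
    nlinarith
  · rw [sub_le_iff_le_add, div_le_iff₀ (by positivity)]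
    nlinarith

theorem large_numeric {q : ℝ} (hq : 17 ≤ q) :
    (q + 3) * 1.43e-5 / 2 * (1 / (2.1 / (q + 3) / 0.95) *
      (12 * (24 / ((q + 1) * (q + 2) * (q + 3) * (q + 4) * (q + 5) * 0.95 ^ 5)
        - 2 * (2 / (0.49 * (2 * q + 5))) * (6 / ((q + 2) * (q + 3) * (q + 4) * (q + 5) * 0.95 ^ 4))
        + (2 / (0.95 * (q + 2))) ^ 2 * (2 / ((q + 3) * (q + 4) * (q + 5) * 0.95 ^ 3))))
      + 2.1 / (q + 3) / 0.95 * (12 * (2 / ((q + 1) * (q + 2) * (q + 3) * 0.95 ^ 3))))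
    + 1.0815 * (1 / ((q + 1) * (q + 2)) - 4 / (2 * q + 5) ^ 2) * 2.01e-5
    ≤ 1e-3 / (q + 3) * (1 / (0.481 * (2 * q + 5))) ^ 2 := by
  obtain ⟨w, hw, rfl⟩ : ∃ w, 0 ≤ w ∧ q = 17 + w := ⟨q - 17, by linarith, by ring⟩
  rw [← sub_nonneg]
  field_simp
  ring_nf
  positivity
-- Triangle inequality through the dilated f. The first step is a perturbation with no linear term
-- (α = 0, β = 12). The second is exact scaling by the inverse square of the dilation. Both are
-- O(m⁻³), matching 1e-3/m times I₀².
theorem abs_varFun_profile_sub_le_of_large {x : ℝ} (hx : 0 < x) (m : ℕ) (hm : 20 ≤ m) :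
    |varFun (profile x) m - varFun f m| ≤ 8.4e-5 / m ∧
      |varFun (profile x) m - varFun f m| ≤ 1e-3 / m * I₀ m ^ 2 := by
  obtain ⟨p, rfl⟩ := Nat.exists_eq_add_of_le' (show 3 ≤ m by omega)
  have hd := abs_dilation_sub_one_le hx
  obtain ⟨d1, d2⟩ := abs_le.1 hd
  have hl : 0 < dilation x := by linarith
  obtain ⟨s1, s2⟩ := slope0_bounds
  have hg := majorised_profile hx
  have hf := majorised_f_comp (b := 0.95) (l := dilation x) (by norm_num) hl (by nlinarith)
  have l1 := hg.le_integral_pow (b := 0.49) (by norm_num)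
    (fun u hu => inv_sq_le_profile hx hu.le) (p + 1)
  have l2 := hf.le_integral_pow (b := 0.49) (by norm_num)
    (fun u hu => le_trans (by
      rw [← mul_assoc]; gcongr; nlinarith) (inv_sq_le_f (u := dilation x * u) (by positivity)))
    (p + 1)
  have r1 := hg.integral_pow_le (p + 1)
  have r2 := hf.integral_pow_le (p + 1)
  rw [show p + 1 + 2 = p + 3 by ring] at l1 l2 r1 r2
  have key := abs_varFun_sub_le (κ := 1.43e-5) (α := 0) (β := 12) (s := 2.1 / (p + 3) / 0.95)
    hg hf (by norm_num) le_rfl (by norm_num) (by positivity) (by positivity) p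
    (fun u hu => ?_) (add_le_add l1 l2) (add_le_add r1 r2)
  · have hI := le_I₀ p
    have hI2 : (1 / (0.481 * (2 * p + 5))) ^ 2 ≤ I₀ (p + 3) ^ 2 := by gcongr
    have hI3 : (1e-3 : ℝ) / (p + 3 : ℕ) * (1 / (0.481 * (2 * p + 5))) ^ 2 ≤
      1e-3 / (p + 3 : ℕ) * I₀ (p + 3) ^ 2 := by gcongr
    have hp : (17 : ℝ) ≤ p := by exact_mod_cast (show 17 ≤ p by omega)
    have hn := large_numeric hp
    have hv : |varFun (fun u => f (dilation x * u)) (p + 3) - varFun f (p + 3)| ≤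
        1.0815 * (1 / ((p + 1) * (p + 2)) - 4 / (2 * p + 5) ^ 2) * 2.01e-5 := by
      rw [varFun_comp_mul f hl, show varFun f (p + 3) / dilation x ^ 2 - varFun f (p + 3)
        = varFun f (p + 3) * (1 / dilation x ^ 2 - 1) by ring, abs_mul]
      exact mul_le_mul (abs_varFun_f_le p) (abs_inv_sq_sub_one_le hd) (abs_nonneg _)
        ((abs_nonneg _).trans (abs_varFun_f_le p))
    have htot : |varFun (profile x) (p + 3) - varFun f (p + 3)| ≤
        1e-3 / (p + 3) * (1 / (0.481 * (2 * p + 5))) ^ 2 := by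
      refine (abs_sub_le _ (varFun (fun u => f (dilation x * u)) (p + 3)) _).trans
        ((add_le_add key hv).trans (le_trans (le_of_eq ?_) hn))
      push_cast
      ring
    push_cast at hI3 ⊢
    refine ⟨htot.trans ?_, htot.trans hI3⟩
    have : (1 / (0.481 * (2 * (p : ℝ) + 5))) ^ 2 ≤ (1 / (0.481 * (2 * 17 + 5))) ^ 2 := by gcongr
    calc 1e-3 / ((p : ℝ) + 3) * (1 / (0.481 * (2 * p + 5))) ^ 2
        ≤ 1e-3 / ((p : ℝ) + 3) * (1 / (0.481 * (2 * 17 + 5))) ^ 2 := by gcongr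
      _ = (1e-3 * (1 / (0.481 * (2 * 17 + 5))) ^ 2) / ((p : ℝ) + 3) := by ring
      _ ≤ 8.4e-5 / (p + 3) := by gcongr; norm_num
  · refine (abs_profile_sub_f_dilation_le hx hu).trans (le_of_eq ?_)
    ring

theorem integral_Ioi_one_weight :
    IntegrableOn (fun u : ℝ => (u - 0.81) / (u + 1.18) ^ 3) (Set.Ioi 1) ∧
      ∫ u in Set.Ioi (1 : ℝ), (u - 0.81) / (u + 1.18) ^ 3 = 1 / 2.18 - 1.99 / (2 * 2.18 ^ 2) := by
  have hd : ∀ u ∈ Set.Ici (1 : ℝ), HasDerivAt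
      (fun u : ℝ => -(1 / (1.18 + 1 * u)) + 1.99 / 2 * (1 / (1.18 + 1 * u)) ^ 2)
      ((u - 0.81) / (u + 1.18) ^ 3) u := by
    intro u hu
    have hu' : (1 : ℝ) ≤ u := hu
    have h1 : 0 < 1.18 + 1 * u := by linarith
    have h := hasDerivAt_inv_lin h1
    refine (h.neg.add ((h.pow 2).const_mul (1.99 / 2))).congr_deriv ?_
    have : 0 < u + 1.18 := by linarith
    have e : 1.18 + 1 * u = u + 1.18 := by ring
    rw [e]
    norm_num
    rw [← sub_eq_zero]
    field_simp
    ring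
  have ht : Tendsto (fun u : ℝ => -(1 / (1.18 + 1 * u)) + 1.99 / 2 * (1 / (1.18 + 1 * u)) ^ 2)
      atTop (𝓝 0) := by
    have h := tendsto_inv_lin (p := 1.18) (q := 1) one_pos
    simpa using h.neg.add ((h.pow 2).const_mul (1.99 / 2))
  have hpos : ∀ u ∈ Set.Ioi (1 : ℝ), 0 ≤ (u - 0.81) / (u + 1.18) ^ 3 := by
    intro u hu
    have : (1 : ℝ) < u := hu
    have : 0 < u - 0.81 := by linarith
    positivity
  refine ⟨integrableOn_Ioi_deriv_of_nonneg' hd hpos ht, ?_⟩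
  rw [integral_Ioi_of_hasDerivAt_of_nonneg' hd hpos ht]
  norm_num

/-- The integral is split at u = 1, and sharper bounds on `dev`, on f and on |u - T| are used on
either side. The target is 2.8e-5 = 8.4e-5/3. -/
theorem abs_varFun_profile_sub_le_of_three {x : ℝ} (hx : 0 < x) :
    |varFun (profile x) 3 - varFun f 3| ≤ 2.8e-5 := by
  have hg := majorised_profile hx
  have hf := majorised_f.mono (b := 0.95) (by norm_num) (by linarith [slope0_bounds.1])
  have l1 := hg.le_integral_pow (b := 0.49) (by norm_num)
    (fun u hu => inv_sq_le_profile hx hu.le) 1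
  have l2 := hf.le_integral_pow (b := 0.49) (by norm_num)
    (fun u hu => le_trans (by gcongr; norm_num) (inv_sq_le_f hu.le)) 1
  have r1 := hg.integral_pow_le 1
  have r2 := hf.integral_pow_le 1
  obtain ⟨hi, he⟩ := hg.varFun_sub hf (le_refl 3)
  norm_num at l1 l2 r1 r2
  set T := (∫ u in Set.Ioi (0 : ℝ), profile x u ^ 3) + ∫ u in Set.Ioi (0 : ℝ), f u ^ 3
  have hT1 : 0.816 ≤ T := by
    simp only [T]; linarith
  have hT2 : T ≤ 1.0527 := by
    simp only [T]; linarith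
  rw [he, ← Real.norm_eq_abs]
  refine (norm_integral_le_integral_norm _).trans ?_
  have hin : IntegrableOn (fun u => ‖(profile x u ^ 3 - f u ^ 3) * (u - T)‖) (Set.Ioi 0) :=
    hi.norm
  rw [← Set.Ioc_union_Ioi_eq_Ioi (zero_le_one (α := ℝ)), setIntegral_union
    (Set.Ioc_disjoint_Ioi le_rfl) measurableSet_Ioi (hin.mono_set Set.Ioc_subset_Ioi_self)
    (hin.mono_set (Set.Ioi_subset_Ioi zero_le_one))]
  have hnear : ∫ u in Set.Ioc (0 : ℝ) 1, ‖(profile x u ^ 3 - f u ^ 3) * (u - T)‖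
      ≤ ∫ u in Set.Ioc (0 : ℝ) 1, 3 * (1 - 0.48 * u) ^ 2 * (1.43e-5 * u) * (1.06 - 0.87 * u) := by
    refine setIntegral_mono_on (hin.mono_set Set.Ioc_subset_Ioi_self)
      (Continuous.integrableOn_Ioc (by fun_prop)) measurableSet_Ioc fun u hu => ?_
    obtain ⟨u0, u1⟩ := hu
    -- The convex majorant is replaced by a line above its chord on [0, 1], which makes the
    -- integrand a polynomial. The linear bound on |u - T| below serves the same purpose and covers
    -- all T in [0.816, 1.0527].
    have hM : 1 / (1 + 0.95 * u) ≤ 1 - 0.48 * u := by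
      rw [div_le_iff₀ (by positivity)]
      nlinarith
    have b1 := abs_pow_sub_pow_le_of_le (hg.nonneg u u0) (hf.nonneg u u0)
      ((hg.le u u0).trans hM) ((hf.le u u0).trans hM) 2
    have b2 := abs_dev_le_of_le_one hx u0.le u1
    have b3 : |u - T| ≤ 1.06 - 0.87 * u := by rw [abs_le]; constructor <;> linarith
    rw [profile_eq hx u0.le, add_sub_cancel_left, ← profile_eq hx u0.le] at b1
    rw [norm_mul, Real.norm_eq_abs, Real.norm_eq_abs]
    refine mul_le_mul (b1.trans ?_) b3 (abs_nonneg _) (by positivity)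
    norm_num at b2 ⊢
    gcongr
  have hfar : ∫ u in Set.Ioi (1 : ℝ), ‖(profile x u ^ 3 - f u ^ 3) * (u - T)‖
      ≤ ∫ u in Set.Ioi (1 : ℝ), 3 * 1.43e-5 * 2.45 / 1.1485 ^ 2 *
        ((u - 0.81) / (u + 1.18) ^ 3) := by
    refine setIntegral_mono_on (hin.mono_set (Set.Ioi_subset_Ioi zero_le_one))
      (integral_Ioi_one_weight.1.const_mul _) measurableSet_Ioi fun u hu => ?_
    have u1 : (1 : ℝ) < u := hu
    have u0 : (0 : ℝ) < u := by linarith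
    have b2 := abs_dev_le_of_one_le hx u1.le
    have hfM := f_le_inv_of_one_le u1.le
    -- A slight weakening of the majorant of f on u ≥ 1 makes room for `dev`, so that it also
    -- majorises the profile.
    have hM : 1 / (0.91 + 1.149 * u) + 1.43e-5 * (2.45 / (u + 2.3)) ≤ 1 / (0.9 + 1.1485 * u) := by
      rw [← sub_nonneg]
      field_simp
      ring_nf
      positivity
    have hM0 : 0 ≤ 1.43e-5 * (2.45 / (u + 2.3)) := by positivity
    have hgM : profile x u ≤ 1 / (0.9 + 1.1485 * u) := by
      rw [profile_eq hx u0.le]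
      linarith [(abs_le.1 b2).2]
    have b1 := abs_pow_sub_pow_le_of_le (hg.nonneg u u0) (hf.nonneg u u0) hgM
      (by linarith : f u ≤ 1 / (0.9 + 1.1485 * u)) 2
    have b3 : |u - T| ≤ u - 0.81 := by rw [abs_le]; constructor <;> linarith
    rw [profile_eq hx u0.le, add_sub_cancel_left, ← profile_eq hx u0.le] at b1
    rw [norm_mul, Real.norm_eq_abs, Real.norm_eq_abs]
    have b4 : ((2 : ℕ) + 1) * (1 / (0.9 + 1.1485 * u)) ^ 2 * |dev x u| ≤
        3 * 1.43e-5 * 2.45 / 1.1485 ^ 2 * (1 / (u + 1.18) ^ 3) := by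
      calc ((2 : ℕ) + 1) * (1 / (0.9 + 1.1485 * u)) ^ 2 * |dev x u|
          ≤ ((2 : ℕ) + 1) * (1 / (0.9 + 1.1485 * u)) ^ 2 * (1.43e-5 * (2.45 / (u + 2.3))) := by
            gcongr
        _ = 3 * 1.43e-5 * 2.45 * (1 / ((0.9 + 1.1485 * u) ^ 2 * (u + 2.3))) := by
            push_cast
            field_simp
            norm_num
        _ ≤ 3 * 1.43e-5 * 2.45 * (1 / (1.1485 ^ 2 * (u + 1.18) ^ 3)) := by
            gcongr 3 * 1.43e-5 * 2.45 * (1 / ?_)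
            obtain ⟨w, hw, rfl⟩ : ∃ w, 0 ≤ w ∧ u = 1 + w := ⟨u - 1, by linarith, by ring⟩
            rw [← sub_nonneg]
            ring_nf
            positivity
        _ = _ := by field_simp
    calc _ ≤ 3 * 1.43e-5 * 2.45 / 1.1485 ^ 2 * (1 / (u + 1.18) ^ 3) * (u - 0.81) :=
          mul_le_mul (b1.trans b4) b3 (abs_nonneg _) (by positivity)
      _ = _ := by ring
  have hpoly : ∫ u in Set.Ioc (0 : ℝ) 1,
      3 * (1 - 0.48 * u) ^ 2 * (1.43e-5 * u) * (1.06 - 0.87 * u) ≤ 5.7e-6 := by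
    rw [← intervalIntegral.integral_of_le zero_le_one]
    have e : ∀ u : ℝ, 3 * (1 - 0.48 * u) ^ 2 * (1.43e-5 * u) * (1.06 - 0.87 * u)
        = 4.29e-5 * (1.06 * u ^ 1 + -1.8876 * u ^ 2 + 1.079424 * u ^ 3 + -0.200448 * u ^ 4) := by
      intro u; ring
    simp_rw [e]
    rw [intervalIntegral.integral_const_mul]
    have hI : ∀ (c : ℝ) (k : ℕ), IntervalIntegrable (fun u : ℝ => c * u ^ k) volume 0 1 :=
      fun c k => (by fun_prop : Continuous fun u : ℝ => c * u ^ k).intervalIntegrable _ _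
    rw [intervalIntegral.integral_add (((hI _ _).add (hI _ _)).add (hI _ _)) (hI _ _),
      intervalIntegral.integral_add ((hI _ _).add (hI _ _)) (hI _ _),
      intervalIntegral.integral_add (hI _ _) (hI _ _)]
    simp only [intervalIntegral.integral_const_mul, integral_pow]
    norm_num
  rw [integral_const_mul, integral_Ioi_one_weight.2] at hfar
  norm_num at hfar hpoly hnear ⊢
  linarith

/-- The oscillation of the variance functional along the profiles is small, uniformly in `x`. -/
theorem abs_varFun_profile_sub_le {x : ℝ} (hx : 0 < x) {m : ℕ} (hm : 3 ≤ m) :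
    |varFun (profile x) m - varFun f m| ≤ 8.4e-5 / m ∧
      |varFun (profile x) m - varFun f m| ≤ 1e-3 / m * I₀ m ^ 2 := by
  rcases (show m = 3 ∨ (4 ≤ m ∧ m ≤ 20) ∨ 20 ≤ m by omega) with rfl | ⟨h1, h2⟩ | h
  · have h := abs_varFun_profile_sub_le_of_three hx
    have hI := le_I₀ 0
    have hI2 : (1 / (0.481 * (2 * (0 : ℕ) + 5)) : ℝ) ^ 2 ≤ I₀ 3 ^ 2 := by gcongr
    refine ⟨h.trans (by norm_num), h.trans ?_⟩
    norm_num at hI2 ⊢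
    linarith
  · exact abs_varFun_profile_sub_le_of_small hx m h1 h2
  · exact abs_varFun_profile_sub_le_of_large hx m h

/-! ### Expansion of the two integrals as m → ∞ -/

theorem abs_log_one_add_sub_le {t : ℝ} (h0 : 0 ≤ t) (h1 : t ≤ 1 / 2) :
    |Real.log (1 + t) - (t - t ^ 2 / 2)| ≤ 2 * t ^ 3 := by
  have h := Real.abs_log_sub_add_sum_range_le (x := -t) (by rw [abs_neg, abs_of_nonneg h0]; linarith) 2
  simp only [Finset.sum_range_succ, Finset.sum_range_zero, abs_neg, abs_of_nonneg h0] at h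
  have e : Real.log (1 + t) - (t - t ^ 2 / 2) = 0 + (-t) ^ (0 + 1) / ((0 : ℕ) + 1)
      + (-t) ^ (1 + 1) / ((1 : ℕ) + 1) + Real.log (1 - -t) := by
    rw [sub_neg_eq_add]; push_cast; ring
  rw [e]
  refine h.trans ?_
  rw [div_le_iff₀ (by linarith)]
  have : 0 ≤ t ^ 3 := by positivity
  norm_num
  nlinarith

/-- The second order coefficient of `f` relative to its majorant `(1 + slope0 * u)⁻¹`. -/
noncomputable def curv : ℝ := 41 / (72 * Real.log 2) - slope0 ^ 2

theorem abs_f_sub_taylor_le {u : ℝ} (h0 : 0 ≤ u) (h1 : u ≤ 1 / 2) :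
    |f u - (1 - slope0 * u + (slope0 ^ 2 + curv) * u ^ 2)| ≤ 10 * u ^ 3 := by
  obtain ⟨L1, L2⟩ := log_two_bounds
  have hL : 0 < Real.log 2 := by linarith
  have a1 := abs_le.1 (abs_log_one_add_sub_le h0 h1)
  have a2 := abs_le.1 (abs_log_one_add_sub_le (t := u / 2) (by linarith) (by linarith))
  have a3 := abs_le.1 (abs_log_one_add_sub_le (t := 3 * u / 4) (by linarith) (by linarith))
  have a4 := abs_le.1 (abs_log_one_add_sub_le (t := u / 4) (by linarith) (by linarith))
  have a5 := abs_le.1 (abs_log_one_add_sub_le (t := u / 3) (by linarith) (by linarith))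
  have e : f u * Real.log 2 = Real.log 2 + Real.log (1 + u / 2) - 2 * Real.log (1 + u)
      + Real.log (1 + 3 * u / 4) - Real.log (1 + u / 4) + Real.log (1 + u / 3) := by
    have b1 : Real.log ((2 + u) / (1 + u)) = Real.log 2 + Real.log (1 + u / 2) - Real.log (1 + u) := by
      rw [Real.log_div (by positivity) (by positivity), ← Real.log_mul (by positivity)
        (by positivity)]; ring_nf
    have b2 : Real.log ((4 + 3 * u) / (3 + 3 * u)) = Real.log (4 / 3) + Real.log (1 + 3 * u / 4)
        - Real.log (1 + u) := by
      rw [← Real.log_mul (by positivity) (by positivity), ← Real.log_div (by positivity)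
        (by positivity)]
      congr 1; field_simp
    have b3 : Real.log ((4 + u) / (3 + u)) = Real.log (4 / 3) + Real.log (1 + u / 4)
        - Real.log (1 + u / 3) := by
      rw [← Real.log_mul (by positivity) (by positivity), ← Real.log_div (by positivity)
        (by positivity)]
      congr 1; field_simp
    simp only [f, Real.logb]
    rw [b1, b2, b3]
    field_simp
    ring
  have hs := slope0_mul_log
  have hc : (slope0 ^ 2 + curv) * Real.log 2 = 41 / 72 := by rw [curv]; field_simp; ring
  have hu3 : 0 ≤ u ^ 3 := by positivity
  have key : |f u - (1 - slope0 * u + (slope0 ^ 2 + curv) * u ^ 2)| * Real.log 2 ≤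
      10 * u ^ 3 * Real.log 2 := by
    rw [← abs_of_pos hL, ← abs_mul, abs_of_pos hL]
    have e2 : (f u - (1 - slope0 * u + (slope0 ^ 2 + curv) * u ^ 2)) * Real.log 2
        = f u * Real.log 2 - Real.log 2 + (slope0 * Real.log 2) * u
          - ((slope0 ^ 2 + curv) * Real.log 2) * u ^ 2 := by ring
    rw [e2, e, hs, hc]
    have : 6.9 * u ^ 3 ≤ 10 * u ^ 3 * Real.log 2 := by nlinarith
    rw [abs_le]
    constructor <;> nlinarith
  exact le_of_mul_le_mul_right key hL

/-- The correction is curv·u²/(1 + au)³ rather than a Taylor term, so its product with the majorant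
power stays a beta integral. For u ≤ 1/2 this is Taylor's formula. For u ≥ 1/2 every term is bounded
while 8u³ ≥ 1. -/
theorem exists_abs_f_sub_le : ∃ C, 0 ≤ C ∧ ∀ u, 0 < u →
    |f u - (1 / (1 + slope0 * u) + curv * u ^ 2 / (1 + slope0 * u) ^ 3)| ≤ C * u ^ 3 := by
  have hs := slope0_pos
  refine ⟨10 + slope0 ^ 3 + 3 * slope0 * |curv| + 8 * (2 + |curv| / slope0 ^ 2), by positivity,
    fun u hu => ?_⟩
  have hM0 : 0 < 1 + slope0 * u := by positivity
  rcases le_total u (1 / 2) with h | h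
  · have h1 := abs_f_sub_taylor_le hu.le h
    set M := 1 / (1 + slope0 * u) with hM
    have hMp : 0 < M := by positivity
    have hM1 : M ≤ 1 := by rw [hM, div_le_one hM0]; nlinarith
    have e1 : 1 - slope0 * u + slope0 ^ 2 * u ^ 2 - M = slope0 ^ 3 * u ^ 3 * M := by
      rw [hM]; field_simp; ring
    have e2 : 1 - M ^ 3 = slope0 * u * M * (1 + M + M ^ 2) := by
      rw [hM]; field_simp; ring
    have e3 : f u - (M + curv * u ^ 2 / (1 + slope0 * u) ^ 3)
        = (f u - (1 - slope0 * u + (slope0 ^ 2 + curv) * u ^ 2)) + slope0 ^ 3 * u ^ 3 * M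
          + curv * u ^ 2 * (slope0 * u * M * (1 + M + M ^ 2)) := by
      have e0 : curv * u ^ 2 / (1 + slope0 * u) ^ 3 = curv * u ^ 2 * M ^ 3 := by
        rw [hM]; field_simp
      rw [← e1, ← e2, e0]; ring
    rw [e3]
    have h2 : |slope0 ^ 3 * u ^ 3 * M| ≤ slope0 ^ 3 * u ^ 3 := by
      rw [abs_of_nonneg (by positivity)]
      exact mul_le_of_le_one_right (by positivity) hM1
    have h3 : |curv * u ^ 2 * (slope0 * u * M * (1 + M + M ^ 2))| ≤ 3 * slope0 * |curv| * u ^ 3 := by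
      rw [abs_mul, abs_mul, abs_of_nonneg (by positivity : 0 ≤ u ^ 2),
        abs_of_nonneg (by positivity : 0 ≤ slope0 * u * M * (1 + M + M ^ 2))]
      have : M * (1 + M + M ^ 2) ≤ 3 := by nlinarith [pow_le_one₀ hMp.le hM1 (n := 2)]
      calc |curv| * u ^ 2 * (slope0 * u * M * (1 + M + M ^ 2))
          = |curv| * u ^ 3 * slope0 * (M * (1 + M + M ^ 2)) := by ring
        _ ≤ |curv| * u ^ 3 * slope0 * 3 := by gcongr
        _ = _ := by ring
    refine (abs_add_three _ _ _).trans ?_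
    have : 0 ≤ 8 * (2 + |curv| / slope0 ^ 2) * u ^ 3 := by positivity
    linarith
  · have h1 : f u ≤ 1 := (f_le_inv hu.le).trans (by rw [div_le_one hM0]; nlinarith)
    have h2 := f_pos hu.le
    have h3 : |1 / (1 + slope0 * u)| ≤ 1 := by
      rw [abs_of_pos (by positivity), div_le_one hM0]; nlinarith
    have h4 : |curv * u ^ 2 / (1 + slope0 * u) ^ 3| ≤ |curv| / slope0 ^ 2 := by
      rw [abs_div, abs_mul, abs_of_nonneg (by positivity : 0 ≤ u ^ 2), abs_of_pos (pow_pos hM0 3),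
        div_le_div_iff₀ (by positivity) (by positivity)]
      have : u ^ 2 * slope0 ^ 2 ≤ (1 + slope0 * u) ^ 3 := by
        have : 0 < slope0 * u := by positivity
        have : 0 ≤ (slope0 * u) ^ 3 := by positivity
        nlinarith [sq_nonneg (slope0 * u)]
      calc |curv| * u ^ 2 * slope0 ^ 2 = |curv| * (u ^ 2 * slope0 ^ 2) := by ring
        _ ≤ _ := by gcongr
    have h5 : 1 ≤ 8 * u ^ 3 := by
      have := pow_le_pow_left₀ (by norm_num) h 3
      linarith
    have h6 : |f u| ≤ 1 := by rw [abs_of_pos h2]; exact h1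
    have h7 : 0 ≤ (10 + slope0 ^ 3 + 3 * slope0 * |curv|) * u ^ 3 := by positivity
    have h8 : (2 + |curv| / slope0 ^ 2) * 1 ≤ (2 + |curv| / slope0 ^ 2) * (8 * u ^ 3) := by gcongr
    calc _ ≤ |f u| + |1 / (1 + slope0 * u) + curv * u ^ 2 / (1 + slope0 * u) ^ 3| := abs_sub _ _
      _ ≤ |f u| + (|1 / (1 + slope0 * u)| + |curv * u ^ 2 / (1 + slope0 * u) ^ 3|) := by
          gcongr; exact abs_add_le _ _
      _ ≤ _ := by linarith

theorem exists_abs_f_sub_inv_le : ∃ C, 0 ≤ C ∧ ∀ u, 0 < u →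
    |f u - 1 / (1 + slope0 * u)| ≤ C * u ^ 2 := by
  obtain ⟨C, hC, h⟩ := exists_abs_f_sub_le
  have hs := slope0_pos
  refine ⟨C + |curv| + 1, by positivity, fun u hu => ?_⟩
  have hM0 : 0 < 1 + slope0 * u := by positivity
  rcases le_total u 1 with h1 | h1
  · have e : |curv * u ^ 2 / (1 + slope0 * u) ^ 3| ≤ |curv| * u ^ 2 := by
      rw [abs_div, abs_mul, abs_of_nonneg (by positivity : 0 ≤ u ^ 2), abs_of_pos (pow_pos hM0 3)]
      refine div_le_self (by positivity) (one_le_pow₀ ?_)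
      nlinarith
    have e2 := h u hu
    have e3 : u ^ 3 ≤ u ^ 2 := pow_le_pow_of_le_one hu.le h1 (by norm_num)
    have e4 : C * u ^ 3 ≤ C * u ^ 2 := by gcongr
    have e5 := abs_add_le (f u - (1 / (1 + slope0 * u) + curv * u ^ 2 / (1 + slope0 * u) ^ 3))
      (curv * u ^ 2 / (1 + slope0 * u) ^ 3)
    rw [show f u - (1 / (1 + slope0 * u) + curv * u ^ 2 / (1 + slope0 * u) ^ 3)
      + curv * u ^ 2 / (1 + slope0 * u) ^ 3 = f u - 1 / (1 + slope0 * u) by ring] at e5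
    nlinarith [sq_nonneg u]
  · have h2 := f_pos hu.le
    have h3 := f_le_inv hu.le
    have h4 : 1 / (1 + slope0 * u) ≤ 1 := by rw [div_le_one hM0]; nlinarith
    have h5 : |f u - 1 / (1 + slope0 * u)| ≤ 1 := by rw [abs_le]; constructor <;> linarith
    have : 1 ≤ u ^ 2 := one_le_pow₀ h1
    nlinarith [abs_nonneg curv]

/-- A second-order Taylor bound with x ≤ y, so the power yⁿ controls the remainder. It is applied
with x = f and y the majorant. -/
theorem abs_pow_sub_linear_le {x y : ℝ} (hx : 0 ≤ x) (hxy : x ≤ y) (n : ℕ) :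
    |x ^ (n + 2) - y ^ (n + 2) - (n + 2) * y ^ (n + 1) * (x - y)| ≤
      (n + 2) ^ 2 * y ^ n * (x - y) ^ 2 := by
  have hy := hx.trans hxy
  induction n with
  | zero =>
    have : x ^ (0 + 2) - y ^ (0 + 2) - ((0 : ℕ) + 2) * y ^ (0 + 1) * (x - y) = (x - y) ^ 2 := by
      push_cast; ring
    rw [this, abs_of_nonneg (sq_nonneg _)]
    push_cast
    nlinarith [sq_nonneg (x - y)]
  | succ n ih =>
    have e : x ^ (n + 1 + 2) - y ^ (n + 1 + 2) - ((n + 1 : ℕ) + 2) * y ^ (n + 1 + 1) * (x - y)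
        = x * (x ^ (n + 2) - y ^ (n + 2) - (n + 2) * y ^ (n + 1) * (x - y))
          + (n + 2) * y ^ (n + 1) * (x - y) ^ 2 := by
      push_cast; ring
    rw [e]
    have h1 : |x * (x ^ (n + 2) - y ^ (n + 2) - (n + 2) * y ^ (n + 1) * (x - y))| ≤
        y * ((n + 2) ^ 2 * y ^ n * (x - y) ^ 2) := by
      rw [abs_mul, abs_of_nonneg hx]
      exact mul_le_mul hxy ih (abs_nonneg _) hy
    have h2 : |((n : ℝ) + 2) * y ^ (n + 1) * (x - y) ^ 2| = (n + 2) * y ^ (n + 1) * (x - y) ^ 2 :=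
      abs_of_nonneg (by positivity)
    refine (abs_add_le _ _).trans ((add_le_add h1 h2.le).trans ?_)
    have : 0 ≤ y ^ (n + 1) * (x - y) ^ 2 := by positivity
    push_cast
    have e3 : y * ((n + 2) ^ 2 * y ^ n * (x - y) ^ 2) + (n + 2) * y ^ (n + 1) * (x - y) ^ 2
        = ((n + 2) ^ 2 + (n + 2)) * (y ^ (n + 1) * (x - y) ^ 2) := by ring
    rw [e3, mul_assoc ((_ : ℝ) ^ 2)]
    refine mul_le_mul_of_nonneg_right ?_ this
    nlinarith [(Nat.cast_nonneg n : (0 : ℝ) ≤ n)]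

/-- The first order expansion of `f ^ m` around the majorant. -/
theorem exists_abs_f_pow_sub_le : ∃ C, 0 ≤ C ∧ ∀ (m : ℕ) (u : ℝ), 2 ≤ m → 0 < u →
    |f u ^ m - (1 / (1 + slope0 * u) ^ m + m * curv * (u ^ 2 / (1 + slope0 * u) ^ (m + 2)))| ≤
      C * (m ^ 2 * (u ^ 4 / (1 + slope0 * u) ^ (m - 2)) +
        m * (u ^ 3 / (1 + slope0 * u) ^ (m - 1))) := by
  obtain ⟨C, hC, h⟩ := exists_abs_f_sub_le
  obtain ⟨C', hC', h'⟩ := exists_abs_f_sub_inv_le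
  refine ⟨C' ^ 2 + C, by positivity, fun m u hm hu => ?_⟩
  obtain ⟨n, rfl⟩ := Nat.exists_eq_add_of_le' hm
  have hs := slope0_pos
  have hD : 0 < 1 + slope0 * u := by positivity
  have h1 := abs_pow_sub_linear_le (f_pos hu.le).le (f_le_inv hu.le) n
  have h2 := h u hu
  have h3 := h' u hu
  rw [show n + 2 - 2 = n by omega, show n + 2 - 1 = n + 1 by omega]
  set D := 1 + slope0 * u
  have e : f u ^ (n + 2) - (1 / D ^ (n + 2) + ((n + 2 : ℕ) : ℝ) * curv * (u ^ 2 / D ^ (n + 2 + 2)))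
      = (f u ^ (n + 2) - (1 / D) ^ (n + 2) - (n + 2) * (1 / D) ^ (n + 1) * (f u - 1 / D))
        + (n + 2) * (1 / D) ^ (n + 1) * (f u - (1 / D + curv * u ^ 2 / D ^ 3)) := by
    simp only [div_pow, one_pow, pow_add]
    push_cast
    field_simp
    ring
  rw [e]
  have b1 : (f u - 1 / D) ^ 2 ≤ (C' * u ^ 2) ^ 2 := by
    rw [← sq_abs]; gcongr
  have b2 : |((n : ℝ) + 2) * (1 / D) ^ (n + 1) * (f u - (1 / D + curv * u ^ 2 / D ^ 3))| ≤
      (n + 2) * (1 / D) ^ (n + 1) * (C * u ^ 3) := by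
    rw [abs_mul, abs_of_nonneg (by positivity : 0 ≤ ((n : ℝ) + 2) * (1 / D) ^ (n + 1))]
    gcongr
  have b3 : ((n : ℝ) + 2) ^ 2 * (1 / D) ^ n * (f u - 1 / D) ^ 2 ≤
      (n + 2) ^ 2 * (1 / D) ^ n * (C' * u ^ 2) ^ 2 := by gcongr
  refine (abs_add_le _ _).trans ((add_le_add (h1.trans b3) b2).trans ?_)
  have c1 : 0 ≤ C * ((n + 2) ^ 2 * (u ^ 4 / D ^ n)) := by positivity
  have c2 : 0 ≤ C' ^ 2 * ((n + 2) * (u ^ 3 / D ^ (n + 1))) := by positivity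
  push_cast
  simp only [div_pow, one_pow]
  calc _ = C' ^ 2 * (((n : ℝ) + 2) ^ 2 * (u ^ 4 / D ^ n)) + C * ((n + 2) * (u ^ 3 / D ^ (n + 1))) := by
        ring
    _ ≤ _ := by linarith

theorem integral_pow_div_pow_le {a : ℝ} (ha : 0 < a) (j n : ℕ) :
    ∫ u in Set.Ioi (0 : ℝ), u ^ j / (1 + a * u) ^ (n + j + 2)
      ≤ j.factorial / a ^ (j + 1) / (n + 1) ^ (j + 1) := by
  rw [(integral_pow_div_pow ha j n).2]
  have h1 : (n.factorial : ℝ) * (n + 1) ^ (j + 1) ≤ (n + j + 1).factorial := by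
    have h := Nat.factorial_mul_ascFactorial n (j + 1)
    have h2 := Nat.pow_succ_le_ascFactorial (n + 1) (j + 1)
    have h3 : n.factorial * (n + 1) ^ (j + 1) ≤ (n + j + 1).factorial := by
      rw [add_assoc, ← h]
      exact Nat.mul_le_mul_left _ h2
    exact_mod_cast h3
  rw [div_div, div_le_div_iff₀ (by positivity) (by positivity)]
  calc (j.factorial : ℝ) * n.factorial * (a ^ (j + 1) * (n + 1) ^ (j + 1))
      = j.factorial * a ^ (j + 1) * (n.factorial * (n + 1) ^ (j + 1)) := by ring
    _ ≤ j.factorial * a ^ (j + 1) * (n + j + 1).factorial := by gcongr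
    _ = _ := by ring

/-- Each power of u is worth a factor 1/m, and lowering the exponent by a fixed i costs only a
constant. Thus the error terms m²u⁴ and mu³ both integrate to O(m⁻³). -/
theorem integral_pow_div_pow_sub_le {a : ℝ} (ha : 0 < a) (j i m : ℕ) (hm : 2 * (i + j + 2) ≤ m) :
    IntegrableOn (fun u : ℝ => u ^ j / (1 + a * u) ^ (m - i)) (Set.Ioi 0) ∧
    ∫ u in Set.Ioi (0 : ℝ), u ^ j / (1 + a * u) ^ (m - i)
      ≤ j.factorial / a ^ (j + 1) * 2 ^ (j + 1) / m ^ (j + 1) := by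
  obtain ⟨n, rfl⟩ := Nat.exists_eq_add_of_le (show i + j + 2 ≤ m by omega)
  rw [show i + j + 2 + n - i = n + j + 2 by omega]
  refine ⟨(integral_pow_div_pow ha j n).1, (integral_pow_div_pow_le ha j n).trans ?_⟩
  have h2 : ((i + j + 2 + n : ℕ) : ℝ) ≤ 2 * (n + 1) := by
    have : i + j + 2 + n ≤ 2 * (n + 1) := by omega
    exact_mod_cast this
  have h3 : 0 < ((i + j + 2 + n : ℕ) : ℝ) := by positivity
  have h4 := pow_le_pow_left₀ h3.le h2 (j + 1)
  rw [mul_pow] at h4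
  rw [div_le_div_iff₀ (by positivity) (by positivity), mul_assoc]
  gcongr

/-- The two terms of the expansion, integrated. -/
theorem exists_abs_I_sub_le : ∃ K : ℝ, 0 ≤ K ∧ ∀ m : ℕ, 30 ≤ m →
    |I₀ m - (1 / ((m - 1) * slope0) + m * curv * (2 / ((m - 1) * m * (m + 1) * slope0 ^ 3)))|
      ≤ K / m ^ 3 ∧
    |I₁ m - (1 / ((m - 2) * (m - 1) * slope0 ^ 2)
        + m * curv * (6 / ((m - 2) * (m - 1) * m * (m + 1) * slope0 ^ 4)))| ≤ K / m ^ 4 := by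
  obtain ⟨C, hC, h⟩ := exists_abs_f_pow_sub_le
  have hs := slope0_pos
  set K0 := C * ((4 : ℕ).factorial / slope0 ^ (4 + 1) * 2 ^ (4 + 1)
    + (3 : ℕ).factorial / slope0 ^ (3 + 1) * 2 ^ (3 + 1)) with hK0
  set K1 := C * ((5 : ℕ).factorial / slope0 ^ (5 + 1) * 2 ^ (5 + 1)
    + (4 : ℕ).factorial / slope0 ^ (4 + 1) * 2 ^ (4 + 1)) with hK1
  have hK0' : 0 ≤ K0 := by positivity
  have hK1' : 0 ≤ K1 := by positivity
  refine ⟨K0 + K1, by positivity, fun m hm => ?_⟩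
  have hm0 : (0 : ℝ) < m := by exact_mod_cast (show 0 < m by omega)
  obtain ⟨p, rfl⟩ := Nat.exists_eq_add_of_le' (show 3 ≤ m by omega)
  have a4 := integral_pow_div_pow_sub_le hs 4 2 (p + 3) (by omega)
  have a3 := integral_pow_div_pow_sub_le hs 3 1 (p + 3) (by omega)
  have a5 := integral_pow_div_pow_sub_le hs 5 2 (p + 3) (by omega)
  have a4' := integral_pow_div_pow_sub_le hs 4 1 (p + 3) (by omega)
  have m0 : HasIntegral (fun u => 1 / (1 + slope0 * u) ^ (p + 3)) (1 / ((p + 2) * slope0)) := by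
    have := integral_inv_pow hs (p + 1)
    refine ⟨this.1, this.2.trans ?_⟩
    push_cast; ring
  have m1 := hasIntegral_div_pow_one hs p
  have m2 := hasIntegral_div_pow_two hs (p + 1)
  have m3 := hasIntegral_div_pow_three hs p
  have n0 := m0.add (m2.const_mul ((p + 3 : ℕ) * curv))
  have n1 := m1.add (m3.const_mul ((p + 3 : ℕ) * curv))
  have f0 : HasIntegral (fun u => f u ^ (p + 3)) (I₀ (p + 3)) :=
    ⟨majorised_f.integrableOn_pow (by omega), rfl⟩
  have f1 : HasIntegral (fun u => u * f u ^ (p + 3)) (I₁ (p + 3)) :=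
    ⟨majorised_f.integrableOn_mul_pow (by omega), rfl⟩
  have d0 := f0.sub n0
  have d1 := f1.sub n1
  have B0 := (HasIntegral.const_mul ⟨a4.1, rfl⟩ (((p + 3 : ℕ) : ℝ) ^ 2)
    |>.add (HasIntegral.const_mul ⟨a3.1, rfl⟩ ((p + 3 : ℕ) : ℝ))).const_mul C
  have B1 := (HasIntegral.const_mul ⟨a5.1, rfl⟩ (((p + 3 : ℕ) : ℝ) ^ 2)
    |>.add (HasIntegral.const_mul ⟨a4'.1, rfl⟩ ((p + 3 : ℕ) : ℝ))).const_mul C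
  constructor
  · have e : I₀ (p + 3) - (1 / (((p + 3 : ℕ) - 1) * slope0) + (p + 3 : ℕ) * curv *
        (2 / (((p + 3 : ℕ) - 1) * (p + 3 : ℕ) * ((p + 3 : ℕ) + 1) * slope0 ^ 3)))
        = ∫ u in Set.Ioi (0 : ℝ), (f u ^ (p + 3) - (1 / (1 + slope0 * u) ^ (p + 3)
          + (p + 3 : ℕ) * curv * (u ^ 2 / (1 + slope0 * u) ^ (p + 1 + 4)))) := by
      rw [d0.2]; push_cast; ring
    rw [e, ← Real.norm_eq_abs]
    refine (norm_integral_le_integral_norm _).trans ?_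
    refine (setIntegral_mono_on d0.1.norm B0.1 measurableSet_Ioi fun u hu => ?_).trans ?_
    · exact h (p + 3) u (by omega) hu
    · rw [B0.2]
      have := a4.2
      have := a3.2
      calc _ ≤ C * (((p + 3 : ℕ) : ℝ) ^ 2 * ((4 : ℕ).factorial / slope0 ^ (4 + 1) * 2 ^ (4 + 1)
            / ((p + 3 : ℕ) : ℝ) ^ (4 + 1)) + ((p + 3 : ℕ) : ℝ) * ((3 : ℕ).factorial
            / slope0 ^ (3 + 1) * 2 ^ (3 + 1) / ((p + 3 : ℕ) : ℝ) ^ (3 + 1))) := by gcongr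
        _ = K0 / ((p + 3 : ℕ) : ℝ) ^ 3 := by rw [hK0]; field_simp; ring
        _ ≤ _ := by gcongr; linarith
  · have e : I₁ (p + 3) - (1 / (((p + 3 : ℕ) - 2) * ((p + 3 : ℕ) - 1) * slope0 ^ 2)
        + (p + 3 : ℕ) * curv * (6 / (((p + 3 : ℕ) - 2) * ((p + 3 : ℕ) - 1) * (p + 3 : ℕ)
          * ((p + 3 : ℕ) + 1) * slope0 ^ 4)))
        = ∫ u in Set.Ioi (0 : ℝ), (u * f u ^ (p + 3) - (u / (1 + slope0 * u) ^ (p + 3)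
          + (p + 3 : ℕ) * curv * (u ^ 3 / (1 + slope0 * u) ^ (p + 5)))) := by
      rw [d1.2]; push_cast; ring
    rw [e, ← Real.norm_eq_abs]
    refine (norm_integral_le_integral_norm _).trans ?_
    refine (setIntegral_mono_on d1.1.norm B1.1 measurableSet_Ioi fun u hu => ?_).trans ?_
    · have hu0 : (0 : ℝ) < u := hu
      have := mul_le_mul_of_nonneg_left (h (p + 3) u (by omega) hu) hu0.le
      rw [← abs_of_pos hu0, ← abs_mul, abs_of_pos hu0] at this
      refine le_trans (le_of_eq ?_) (this.trans (le_of_eq ?_))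
      · rw [Real.norm_eq_abs]; congr 1; ring
      · ring
    · rw [B1.2]
      have := a5.2
      have := a4'.2
      calc _ ≤ C * (((p + 3 : ℕ) : ℝ) ^ 2 * ((5 : ℕ).factorial / slope0 ^ (5 + 1) * 2 ^ (5 + 1)
            / ((p + 3 : ℕ) : ℝ) ^ (5 + 1)) + ((p + 3 : ℕ) : ℝ) * ((4 : ℕ).factorial
            / slope0 ^ (4 + 1) * 2 ^ (4 + 1) / ((p + 3 : ℕ) : ℝ) ^ (4 + 1))) := by gcongr
        _ = K1 / ((p + 3 : ℕ) : ℝ) ^ 4 := by rw [hK1]; field_simp; ring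
        _ ≤ _ := by gcongr; linarith

/-- The limit of `varConst`. -/
noncomputable def varLim : ℝ := 41 * Real.log 2 / 16 - 1

/-- The beta integrals contribute 1 and the curvature 2·curv/a² to the 1/m coefficient of a·m·I₀.
Both contributions triple in a²m²I₁, so the same constant governs both expansions. -/
theorem varLim_eq : varLim = 1 + 2 * curv / slope0 ^ 2 := by
  have hL : 0 < Real.log 2 := Real.log_pos (by norm_num)
  rw [varLim, curv, slope0]
  field_simp
  ring

theorem slope0_eq : slope0 = 2 / Real.log 8 := by
  rw [slope0, show (8 : ℝ) = 2 ^ 3 by norm_num, Real.log_pow]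
  push_cast; ring

theorem exists_I₀_expansion : ∃ r : ℕ → ℝ, r =O[atTop] (fun m => ((m : ℝ) ^ 2)⁻¹) ∧
    ∀ m : ℕ, 1 ≤ m → I₀ m = Real.log 8 / (2 * m) * (1 + 1 / m * varLim + r m) := by
  have hs := slope0_pos
  have hL8 : 0 < Real.log 8 := Real.log_pos (by norm_num)
  -- The remainder is defined by the identity that it has to satisfy, so only its order needs proof.
  refine ⟨fun m => slope0 * m * I₀ m - 1 - 1 / m * varLim, ?_, fun m hm => ?_⟩
  · obtain ⟨K, hK, h⟩ := exists_abs_I_sub_le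
    refine IsBigO.of_bound (2 + 4 * |curv| / slope0 ^ 2 + slope0 * K) ?_
    filter_upwards [eventually_ge_atTop 30] with m hm
    have hm' : (30 : ℝ) ≤ m := by exact_mod_cast hm
    have h0 := (h m hm).1
    set E := I₀ m - (1 / ((m - 1) * slope0) + m * curv * (2 / ((m - 1) * m * (m + 1) * slope0 ^ 3)))
    have hm0 : (0 : ℝ) < m := by linarith
    have hm1 : (0 : ℝ) < m - 1 := by linarith
    have e : slope0 * m * I₀ m - 1 - 1 / m * varLim
        = 1 / (m * (m - 1)) + 2 * curv / slope0 ^ 2 * (1 / (m * ((m - 1) * (m + 1))))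
          + slope0 * m * E := by
      rw [varLim_eq]
      simp only [E]
      field_simp
      ring
    rw [e, Real.norm_eq_abs, Real.norm_eq_abs, abs_of_pos (by positivity : 0 < ((m : ℝ) ^ 2)⁻¹)]
    have b1 : |1 / ((m : ℝ) * (m - 1))| ≤ 2 * ((m : ℝ) ^ 2)⁻¹ := by
      rw [abs_of_pos (by positivity), ← div_eq_mul_inv, div_le_div_iff₀ (by positivity)
        (by positivity)]
      nlinarith
    have b2 : |2 * curv / slope0 ^ 2 * (1 / (m * ((m - 1) * (m + 1))))| ≤
        4 * |curv| / slope0 ^ 2 * ((m : ℝ) ^ 2)⁻¹ := by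
      rw [abs_mul, abs_div, abs_mul, abs_of_pos (by positivity : 0 < slope0 ^ 2),
        abs_of_pos (by norm_num : (0 : ℝ) < 2),
        abs_of_pos (by positivity : 0 < 1 / ((m : ℝ) * ((m - 1) * (m + 1))))]
      have : 1 / ((m : ℝ) * ((m - 1) * (m + 1))) ≤ 2 * ((m : ℝ) ^ 2)⁻¹ := by
        rw [← div_eq_mul_inv, div_le_div_iff₀ (by positivity) (by positivity)]
        nlinarith [mul_pos hm0 hm1]
      calc _ ≤ 2 * |curv| / slope0 ^ 2 * (2 * ((m : ℝ) ^ 2)⁻¹) := by gcongr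
        _ = _ := by ring
    have b3 : |slope0 * m * E| ≤ slope0 * K * ((m : ℝ) ^ 2)⁻¹ := by
      rw [abs_mul, abs_of_pos (by positivity : 0 < slope0 * m)]
      calc slope0 * m * |E| ≤ slope0 * m * (K / m ^ 3) := by gcongr
        _ = _ := by field_simp
    refine (abs_add_three _ _ _).trans ?_
    linarith
  · have : (0 : ℝ) < m := by exact_mod_cast hm
    simp only [slope0_eq]
    field_simp
    ring

theorem exists_I₁_expansion : ∃ r : ℕ → ℝ, r =O[atTop] (fun m => ((m : ℝ) ^ 2)⁻¹) ∧
    ∀ m : ℕ, 1 ≤ m → I₁ m = (Real.log 8 / (2 * m)) ^ 2 * (1 + 3 / m * varLim + r m) := by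
  have hs := slope0_pos
  have hL8 : 0 < Real.log 8 := Real.log_pos (by norm_num)
  refine ⟨fun m => slope0 ^ 2 * m ^ 2 * I₁ m - 1 - 3 / m * varLim, ?_, fun m hm => ?_⟩
  · obtain ⟨K, hK, h⟩ := exists_abs_I_sub_le
    refine IsBigO.of_bound (28 + 60 * |curv| / slope0 ^ 2 + slope0 ^ 2 * K) ?_
    filter_upwards [eventually_ge_atTop 30] with m hm
    have hm' : (30 : ℝ) ≤ m := by exact_mod_cast hm
    have h0 := (h m hm).2
    obtain ⟨E, hE⟩ : ∃ E, E = I₁ m - (1 / ((m - 2) * (m - 1) * slope0 ^ 2)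
        + m * curv * (6 / ((m - 2) * (m - 1) * m * (m + 1) * slope0 ^ 4))) := ⟨_, rfl⟩
    rw [← hE] at h0
    obtain ⟨q, hq, hqm⟩ : ∃ q : ℝ, 28 ≤ q ∧ (m : ℝ) = q + 2 := ⟨m - 2, by linarith, by ring⟩
    rw [hqm] at h0 hE ⊢
    have e : slope0 ^ 2 * (q + 2) ^ 2 * I₁ m - 1 - 3 / (q + 2) * varLim
        = (7 * q + 8) / ((q + 2) * (q + 1) * q) + 6 * curv / slope0 ^ 2 *
          ((2 * q ^ 2 + 9 * q + 8) / ((q + 2) * (q + 3) * (q + 1) * q))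
          + slope0 ^ 2 * (q + 2) ^ 2 * E := by
      have hI : I₁ m = E + (1 / (q * (q + 1) * slope0 ^ 2)
        + (q + 2) * curv * (6 / (q * (q + 1) * (q + 2) * (q + 3) * slope0 ^ 4))) := by
        rw [hE]; ring
      rw [varLim_eq, hI]
      field_simp
      ring
    have hq0 : 0 < q := by linarith
    rw [e, Real.norm_eq_abs, Real.norm_eq_abs, abs_of_pos (by positivity : 0 < ((q + 2) ^ 2)⁻¹)]
    have b1 : |(7 * q + 8) / ((q + 2) * (q + 1) * q)| ≤ 28 * ((q + 2) ^ 2)⁻¹ := by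
      rw [abs_of_pos (by positivity), ← div_eq_mul_inv, div_le_div_iff₀ (by positivity)
        (by positivity)]
      obtain ⟨w, hw, rfl⟩ : ∃ w, 0 ≤ w ∧ q = 28 + w := ⟨q - 28, by linarith, by ring⟩
      rw [← sub_nonneg]
      ring_nf
      positivity
    have b2 : |6 * curv / slope0 ^ 2 *
          ((2 * q ^ 2 + 9 * q + 8) / ((q + 2) * (q + 3) * (q + 1) * q))| ≤
        60 * |curv| / slope0 ^ 2 * ((q + 2) ^ 2)⁻¹ := by
      rw [abs_mul, abs_div, abs_mul, abs_of_pos (by positivity : 0 < slope0 ^ 2),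
        abs_of_pos (by norm_num : (0 : ℝ) < 6), abs_of_pos (by positivity :
          0 < (2 * q ^ 2 + 9 * q + 8) / ((q + 2) * (q + 3) * (q + 1) * q))]
      have : (2 * q ^ 2 + 9 * q + 8) / ((q + 2) * (q + 3) * (q + 1) * q) ≤ 10 * ((q + 2) ^ 2)⁻¹ := by
        rw [← div_eq_mul_inv, div_le_div_iff₀ (by positivity) (by positivity)]
        obtain ⟨w, hw, rfl⟩ : ∃ w, 0 ≤ w ∧ q = 28 + w := ⟨q - 28, by linarith, by ring⟩
        rw [← sub_nonneg]
        ring_nf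
        positivity
      calc _ ≤ 6 * |curv| / slope0 ^ 2 * (10 * ((q + 2) ^ 2)⁻¹) := by gcongr
        _ = _ := by ring
    have b3 : |slope0 ^ 2 * (q + 2) ^ 2 * E| ≤ slope0 ^ 2 * K * ((q + 2) ^ 2)⁻¹ := by
      rw [abs_mul, abs_of_pos (by positivity : 0 < slope0 ^ 2 * (q + 2) ^ 2)]
      calc slope0 ^ 2 * (q + 2) ^ 2 * |E| ≤ slope0 ^ 2 * (q + 2) ^ 2 * (K / (q + 2) ^ 4) := by
            gcongr
        _ = _ := by field_simp
    refine (abs_add_three _ _ _).trans ?_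
    linarith
  · have : (0 : ℝ) < m := by exact_mod_cast hm
    simp only [slope0_eq]
    field_simp
    ring

theorem tendsto_zero_of_isBigO_inv_sq {r : ℕ → ℝ} (hr : r =O[atTop] fun m => ((m : ℝ) ^ 2)⁻¹) :
    Tendsto r atTop (𝓝 0) ∧ Tendsto (fun m => m * r m) atTop (𝓝 0) := by
  have h1 : Tendsto (fun m : ℕ => (m : ℝ)⁻¹) atTop (𝓝 0) := tendsto_inv_atTop_nhds_zero_nat
  constructor
  · refine hr.trans_tendsto ?_
    simpa using h1.pow 2
  · refine ((isBigO_refl (fun m : ℕ => (m : ℝ)) atTop).mul hr).trans_tendsto ?_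
    refine h1.congr' ?_
    filter_upwards [eventually_ge_atTop 1] with m hm
    have : (0 : ℝ) < m := by exact_mod_cast hm
    field_simp

theorem tendsto_biasConst : Tendsto biasConst atTop (𝓝 (2 / (3 * Real.log 2))) := by
  obtain ⟨r, hr, h⟩ := exists_I₀_expansion
  have h1 : Tendsto (fun m : ℕ => (m : ℝ)⁻¹) atTop (𝓝 0) := tendsto_inv_atTop_nhds_zero_nat
  have hL8 : 0 < Real.log 8 := Real.log_pos (by norm_num)
  have h2 : Tendsto (fun m : ℕ => Real.log 8 / 2 * (1 + (m : ℝ)⁻¹ * varLim + r m)) atTop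
      (𝓝 (Real.log 8 / 2 * (1 + 0 * varLim + 0))) :=
    (((h1.mul_const _).const_add 1).add (tendsto_zero_of_isBigO_inv_sq hr).1).const_mul _
  have h3 := h2.inv₀ (by rw [zero_mul, add_zero, add_zero, mul_one]; positivity)
  have e : (Real.log 8 / 2 * (1 + 0 * varLim + 0))⁻¹ = 2 / (3 * Real.log 2) := by
    rw [show (8 : ℝ) = 2 ^ 3 by norm_num, Real.log_pow]; simp
  rw [e] at h3
  refine h3.congr' ?_
  filter_upwards [eventually_ge_atTop 1] with m hm
  have : (0 : ℝ) < m := by exact_mod_cast hm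
  rw [biasConst, h m hm, one_div]
  congr 1
  field_simp

/-- The leading factors of I₁ and I₀² coincide and cancel. What remains is m times (1 + 3v/m + r') -
(1 + v/m + r)² over a denominator tending to 1, with v the limit, and 3 - 2 = 1 copy of v survives.
-/
theorem tendsto_varConst : Tendsto varConst atTop (𝓝 varLim) := by
  obtain ⟨r, hr, h⟩ := exists_I₀_expansion
  obtain ⟨r', hr', h'⟩ := exists_I₁_expansion
  have hL8 : 0 < Real.log 8 := Real.log_pos (by norm_num)
  have h1 : Tendsto (fun m : ℕ => (m : ℝ)⁻¹) atTop (𝓝 0) := tendsto_inv_atTop_nhds_zero_nat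
  obtain ⟨r0, mr0⟩ := tendsto_zero_of_isBigO_inv_sq hr
  obtain ⟨-, mr1⟩ := tendsto_zero_of_isBigO_inv_sq hr'
  have hd : Tendsto (fun m : ℕ => 1 + (m : ℝ)⁻¹ * varLim + r m) atTop (𝓝 1) := by
    simpa using ((h1.mul_const varLim).const_add 1).add r0
  have hn : Tendsto (fun m : ℕ => varLim + m * r' m - 2 * (m * r m) - (m : ℝ)⁻¹ * varLim ^ 2
      - 2 * varLim * r m - (m * r m) * r m) atTop (𝓝 varLim) := by
    simpa using (((((mr1.const_add varLim).sub (mr0.const_mul 2)).sub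
      (h1.mul_const (varLim ^ 2))).sub (r0.const_mul (2 * varLim))).sub (mr0.mul r0))
  have := hn.div (hd.pow 2) (by norm_num)
  rw [one_pow, div_one] at this
  refine this.congr' ?_
  filter_upwards [eventually_ge_atTop 1, hd.eventually_ne one_ne_zero] with m hm hne
  have hm0 : (0 : ℝ) < m := by exact_mod_cast hm
  simp only [Pi.div_apply]
  rw [varConst, h m hm, h' m hm]
  simp only [one_div]
  rw [mul_pow, mul_div_mul_left _ _ (by positivity), div_eq_iff (pow_ne_zero 2 hne)]
  set d := 1 + (m : ℝ)⁻¹ * varLim + r m with hdef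
  have e : ∀ X : ℝ, m * (X / d ^ 2 - 1) * d ^ 2 = m * (X - d ^ 2) := by
    intro X; field_simp
  rw [e, hdef]
  field_simp
  ring

theorem abs_slope_const_lt : |2 / (3 * Real.log 2) - 0.962| < 5e-4 := by
  have := slope0_bounds
  rw [slope0] at this
  rw [abs_lt]
  constructor <;> norm_num at this ⊢ <;> linarith

theorem abs_varLim_sub_lt : |41 * Real.log 2 / 16 - 1 - 0.776| < 5e-4 := by
  have := log_two_bounds
  rw [abs_lt]
  constructor <;> norm_num at this ⊢ <;> linarith

/-! ### Deterministic behaviour of the sketch -/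

/-- The contribution of a row to `1 / Y`. -/
noncomputable def Cell.weight (c : Cell) : ℝ :=
  (2 : ℝ) ^ (-(c.c1 : ℤ)) + (1 - if c.c2 then 1 else 0) * (2 : ℝ) ^ (-(c.c1 : ℤ) + 1)

theorem Cell.weight_mk_true (k : ℕ) : Cell.weight ⟨k, true⟩ = (1 / 2) ^ k := by
  simp [Cell.weight]

theorem Cell.weight_mk_false (k : ℕ) : Cell.weight ⟨k, false⟩ = 3 * (1 / 2) ^ k := by
  simp [Cell.weight, zpow_add₀]; ring

theorem Cell.weight_pos (c : Cell) : 0 < c.weight := by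
  obtain ⟨k, b⟩ := c
  cases b
  · rw [weight_mk_false]; positivity
  · rw [weight_mk_true]; positivity

/-- A jump to r ≥ c₁ + 2 gives at most 3·2^(-r) ≤ (3/4)·2^(-c₁), so even losing the bit never
increases the weight. This monotonicity carries the passage from a Poisson to a fixed number of
elements. -/
theorem Cell.weight_update_le (c : Cell) (r : ℕ) : (c.update r).weight ≤ c.weight := by
  have hle : (1 / 2 : ℝ) ^ c.c1 ≤ c.weight := by
    obtain ⟨k, b⟩ := c
    cases b
    · rw [weight_mk_false]; linarith [pow_pos (half_pos one_pos) k (M₀ := ℝ)]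
    · rw [weight_mk_true]
  unfold Cell.update
  split_ifs with h1 h2 h3
  · rw [weight_mk_true, h1, pow_succ]
    linarith [pow_pos (half_pos one_pos) c.c1 (M₀ := ℝ)]
  · rw [weight_mk_false]
    have : (1 / 2 : ℝ) ^ r ≤ (1 / 2) ^ (c.c1 + 2) :=
      pow_le_pow_of_le_one (by norm_num) (by norm_num) (by omega)
    rw [pow_add] at this
    linarith [pow_pos (half_pos one_pos) c.c1 (M₀ := ℝ)]
  · rw [weight_mk_true]; exact hle
  · exact le_rfl

/-- The quantity `1 / Y`. -/
noncomputable def invY {m : ℕ} (l : List (Fin m × ℕ)) : ℝ := ∑ j, (sketchOf l j).weight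

theorem sketchOf_concat {m : ℕ} (l : List (Fin m × ℕ)) (h : Fin m × ℕ) :
    sketchOf (l ++ [h]) = (sketchOf l).insert h := by
  simp [sketchOf]

theorem invY_pos {m : ℕ} (hm : 0 < m) (l : List (Fin m × ℕ)) : 0 < invY l := by
  have : Nonempty (Fin m) := ⟨⟨0, hm⟩⟩
  exact Finset.sum_pos (fun j _ => Cell.weight_pos _) Finset.univ_nonempty

theorem invY_concat_le {m : ℕ} (l : List (Fin m × ℕ)) (h : Fin m × ℕ) :
    invY (l ++ [h]) ≤ invY l := by
  refine Finset.sum_le_sum fun j _ => ?_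
  rw [sketchOf_concat, Sketch.insert, Function.update_apply]
  split_ifs with hj
  · subst hj; exact Cell.weight_update_le _ _
  · exact le_rfl

/-- No value in row `j` belongs to `D`. -/
def Avoids {m : ℕ} (j : Fin m) (D : Set ℕ) (l : List (Fin m × ℕ)) : Prop :=
  ∀ h ∈ l, h.1 = j → h.2 ∉ D

theorem avoids_concat {m : ℕ} (j : Fin m) (D : Set ℕ) (l : List (Fin m × ℕ)) (h : Fin m × ℕ) :
    Avoids j D (l ++ [h]) ↔ Avoids j D l ∧ (h.1 = j → h.2 ∉ D) := by
  simp only [Avoids, List.mem_append, List.mem_singleton]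
  constructor
  · exact fun H => ⟨fun a ha => H a (Or.inl ha), H h (Or.inr rfl)⟩
  · rintro ⟨H1, H2⟩ a (ha | rfl)
    · exact H1 a ha
    · exact H2

/-- The state of a row in terms of the values that it has seen. -/
theorem cell_spec {m : ℕ} (l : List (Fin m × ℕ)) (j : Fin m) :
    (∀ k, (sketchOf l j).c1 ≤ k ↔ Avoids j (Set.Ioi k) l) ∧
    ((sketchOf l j).c2 = false ↔
      2 ≤ (sketchOf l j).c1 ∧ Avoids j {(sketchOf l j).c1 - 1} l) := by
  induction l using List.reverseRecOn with
  | nil =>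
    simp [sketchOf, Sketch.init, Avoids]
  | append_singleton l h ih =>
    obtain ⟨i1, i2⟩ := ih
    rw [sketchOf_concat, Sketch.insert, Function.update_apply]
    simp only [avoids_concat]
    split_ifs with hj
    · subst hj
      simp only [forall_const]
      set c := sketchOf l h.1 with hc
      -- A value above the counter has not been seen.
      have hA : ∀ k, c.c1 < k → Avoids h.1 {k} l := by
        intro k hk a ha haj hak
        have := (i1 c.c1).1 le_rfl a ha haj
        simp only [Set.mem_Ioi, Set.mem_singleton_iff] at this hak
        omega
      -- A positive counter is itself a value that has been seen. Thus a step up by one sets the bit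
      -- to 1, while a step from 0 to 1 sets it by convention; this is why the bit 0 requires a
      -- counter of at least 2.
      have hB : 1 ≤ c.c1 → ¬ Avoids h.1 {c.c1} l := by
        intro hk hav
        have : c.c1 ≤ c.c1 - 1 := (i1 _).2 fun a ha haj hak => by
          have h1 := hav a ha haj
          have h2 := (i1 c.c1).1 le_rfl a ha haj
          simp only [Set.mem_Ioi, Set.mem_singleton_iff] at h1 h2 hak
          omega
        omega
      obtain ⟨j, r⟩ := h
      simp only at *
      unfold Cell.update
      split_ifs with h1 h2 h3
      · refine ⟨fun k => ?_, ?_⟩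
        · rw [← i1]; simp only [Set.mem_Ioi]; omega
        · simp only [false_iff, not_and, Set.mem_singleton_iff]
          intro hr hav
          rw [h1, Nat.add_sub_cancel] at hav
          exact absurd hav (hB (by omega))
      · refine ⟨fun k => ?_, ?_⟩
        · rw [← i1]; simp only [Set.mem_Ioi]; omega
        · simp only [true_iff, Set.mem_singleton_iff]
          exact ⟨by omega, hA _ (by omega), by omega⟩
      · refine ⟨fun k => ?_, ?_⟩
        · rw [← i1]; simp only [Set.mem_Ioi]; omega
        · simp only [false_iff, not_and, Set.mem_singleton_iff]
          intro hr hav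
          omega
      · refine ⟨fun k => ?_, ?_⟩
        · rw [← i1]; simp only [Set.mem_Ioi]; omega
        · rw [i2]
          simp only [Set.mem_singleton_iff]
          constructor
          · rintro ⟨ha, hb⟩
            refine ⟨ha, hb, fun hr => h3 ⟨by omega, i2.2 ⟨ha, hb⟩⟩⟩
          · exact fun H => ⟨H.1, H.2.1⟩
    · have hj' : ¬ h.1 = j := fun e => hj e.symm
      simp only [hj', false_imp_iff, and_true]
      exact ⟨i1, i2⟩

/-! ### Laws of hash sequences and avoidance probabilities -/

/-- Lists over a countable alphabet are countable, so the discrete structure loses nothing and makes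
every function measurable. -/
instance instMeasurableSpaceList (m : ℕ) : MeasurableSpace (List (Fin m × ℕ)) := ⊤

instance instDiscreteMeasurableSpaceList (m : ℕ) :
    DiscreteMeasurableSpace (List (Fin m × ℕ)) := ⟨fun _ => trivial⟩

/-- The law of the sequence of hash values of `n` elements. -/
noncomputable def listLaw (m n : ℕ) : Measure (List (Fin m × ℕ)) :=
  (Measure.pi fun _ : Fin n => hashLaw m).map List.ofFn

/-- The law of the sequence of hash values of a Poisson number of elements. -/
noncomputable def poissonListLaw (m : ℕ) (lam : ℝ≥0) : Measure (List (Fin m × ℕ)) :=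
  (poissonMeasure lam).bind (listLaw m)

instance : IsProbabilityMeasure geoLaw :=
  Measure.isProbabilityMeasure_map (by fun_prop)

instance (m : ℕ) [NeZero m] : IsProbabilityMeasure (hashLaw m) := by
  have : IsProbabilityMeasure (uniformOn (Set.univ : Set (Fin m))) :=
    isProbabilityMeasure_uniformOn Set.finite_univ Set.univ_nonempty
  unfold hashLaw
  infer_instance

instance (m n : ℕ) [NeZero m] : IsProbabilityMeasure (listLaw m n) :=
  Measure.isProbabilityMeasure_map Measurable.of_discrete.aemeasurable

theorem lawY_eq_map (m n : ℕ) : lawY m n = (listLaw m n).map fun l => (invY l)⁻¹ := by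
  rw [listLaw, Measure.map_map Measurable.of_discrete Measurable.of_discrete]
  rfl

theorem poissonLawY_eq_map (m : ℕ) (lam : ℝ≥0) :
    poissonLawY m lam = (poissonListLaw m lam).map fun l => (invY l)⁻¹ := by
  ext s hs
  rw [Measure.map_apply Measurable.of_discrete hs, poissonLawY, poissonListLaw,
    Measure.bind_apply hs Measurable.of_discrete.aemeasurable,
    Measure.bind_apply (MeasurableSet.of_discrete) Measurable.of_discrete.aemeasurable]
  congr 1
  funext n
  rw [lawY_eq_map, Measure.map_apply Measurable.of_discrete hs]

instance (m : ℕ) [NeZero m] (lam : ℝ≥0) : IsProbabilityMeasure (poissonListLaw m lam) := by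
  constructor
  rw [poissonListLaw, Measure.bind_apply MeasurableSet.univ Measurable.of_discrete.aemeasurable]
  simp

theorem geoLaw_real_singleton (k : ℕ) : geoLaw.real {k + 1} = (1 / 2) ^ (k + 1) := by
  rw [geoLaw, map_measureReal_apply (by fun_prop) (measurableSet_singleton _)]
  have : (fun x => x + 1) ⁻¹' {k + 1} = ({k} : Set ℕ) := by ext; simp
  rw [this, geometricMeasure_real_singleton (by
    intro h; exact absurd (congrArg Subtype.val h) (by norm_num))]
  norm_num
  ring

theorem geoLaw_real_Ioi (k : ℕ) : geoLaw.real (Set.Ioi k) = (1 / 2) ^ k := by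
  induction k with
  | zero =>
    rw [geoLaw, map_measureReal_apply (by fun_prop) measurableSet_Ioi]
    have : (fun x => x + 1) ⁻¹' Set.Ioi 0 = (Set.univ : Set ℕ) := by ext; simp
    rw [this]; simp
  | succ k ih =>
    have h : Set.Ioi k = {k + 1} ∪ Set.Ioi (k + 1) := by
      ext a; simp only [Set.mem_Ioi, Set.mem_union, Set.mem_singleton_iff]; omega
    rw [h, measureReal_union (by simp) measurableSet_Ioi, geoLaw_real_singleton] at ih
    rw [pow_succ] at ih ⊢
    linarith

/-- Avoiding this set means having counter at most k + 2 without having seen k + 1, the event behind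
the bit 0 at counter k + 2. -/
theorem geoLaw_real_insert (k : ℕ) :
    geoLaw.real ({k + 1} ∪ Set.Ioi (k + 2)) = 3 * (1 / 2) ^ (k + 2) := by
  rw [measureReal_union (by simp) measurableSet_Ioi, geoLaw_real_singleton, geoLaw_real_Ioi,
    pow_succ (1 / 2 : ℝ) (k + 1)]
  ring

theorem hashLaw_real_fibre (m : ℕ) [NeZero m] (D : Fin m → Set ℕ) :
    (hashLaw m).real {h | h.2 ∈ D h.1} = (∑ j, geoLaw.real (D j)) / m := by
  have hp : IsProbabilityMeasure (uniformOn (Set.univ : Set (Fin m))) :=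
    isProbabilityMeasure_uniformOn Set.finite_univ Set.univ_nonempty
  have h1 : hashLaw m {h | h.2 ∈ D h.1} = ∑ j, geoLaw (D j) * (m : ENNReal)⁻¹ := by
    rw [hashLaw, Measure.prod_apply MeasurableSet.of_discrete, lintegral_fintype]
    refine Finset.sum_congr rfl fun j _ => ?_
    rw [uniformOn_univ]
    simp only [Set.preimage_ofPred_eq, Set.ofPred_mem_eq, Measure.count_singleton, Fintype.card_fin,
      one_div]
  rw [Measure.real, h1, ENNReal.toReal_sum (fun j _ => ENNReal.mul_ne_top (measure_ne_top _ _)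
    (by simp [NeZero.ne m])), Finset.sum_div]
  refine Finset.sum_congr rfl fun j _ => ?_
  rw [ENNReal.toReal_mul, ENNReal.toReal_inv, ENNReal.toReal_natCast, div_eq_mul_inv]
  rfl

theorem listLaw_real_avoids (m : ℕ) [NeZero m] (n : ℕ) (D : Fin m → Set ℕ) :
    (listLaw m n).real {l | ∀ j, Avoids j (D j) l} = (1 - (∑ j, geoLaw.real (D j)) / m) ^ n := by
  rw [listLaw, map_measureReal_apply Measurable.of_discrete MeasurableSet.of_discrete]
  have h1 : List.ofFn ⁻¹' {l | ∀ j, Avoids j (D j) l} =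
      Set.pi Set.univ fun _ : Fin n => {h : Fin m × ℕ | h.2 ∈ D h.1}ᶜ := by
    ext h
    simp only [Set.mem_preimage, Set.mem_ofPred_eq, Avoids, List.mem_ofFn, Set.mem_pi, Set.mem_univ,
      forall_const, Set.mem_compl_iff]
    constructor
    · intro H i; exact H _ _ ⟨i, rfl⟩ rfl
    · rintro H j a ⟨i, rfl⟩ rfl; exact H i
  rw [h1, Measure.real, Measure.pi_pi, Finset.prod_const, ENNReal.toReal_pow, Finset.card_univ,
    Fintype.card_fin, ← Measure.real, probReal_compl_eq_one_sub MeasurableSet.of_discrete,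
    hashLaw_real_fibre]

theorem integral_pow_poissonMeasure (r : ℝ≥0) {q : ℝ} (h0 : 0 ≤ q) :
    Integrable (fun n => q ^ n) (poissonMeasure r) ∧
      ∫ n, q ^ n ∂poissonMeasure r = Real.exp (r * (q - 1)) := by
  have h3 : HasSum (fun n : ℕ => Real.exp (-r) * r ^ n / n.factorial * q ^ n)
      (Real.exp (r * (q - 1))) := by
    have h : HasSum (fun n : ℕ => Real.exp (-r) * ((r * q) ^ n / n.factorial))
        (Real.exp (-r) * Real.exp (r * q)) := by
      refine HasSum.mul_left _ ?_
      rw [Real.exp_eq_exp_ℝ]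
      exact NormedSpace.expSeries_div_hasSum_exp _
    rw [show (r : ℝ) * (q - 1) = -r + r * q by ring, Real.exp_add]
    convert! h using 1
    funext n
    rw [mul_pow]
    ring
  have hi : Integrable (fun n => q ^ n) (poissonMeasure r) := by
    rw [integrable_poissonMeasure_iff]
    simpa [abs_of_nonneg h0] using h3.summable
  exact ⟨hi, (hasSum_integral_poissonMeasure hi).unique h3⟩

theorem poissonListLaw_real (m : ℕ) [NeZero m] (lam : ℝ≥0) (A : Set (List (Fin m × ℕ))) :
    (poissonListLaw m lam).real A = ∫ n, (listLaw m n).real A ∂poissonMeasure lam := by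
  rw [Measure.real, poissonListLaw, Measure.bind_apply MeasurableSet.of_discrete
    Measurable.of_discrete.aemeasurable, integral_eq_lintegral_of_nonneg_ae
    (ae_of_all _ fun _ => measureReal_nonneg) Measurable.of_discrete.aestronglyMeasurable]
  simp

/-- The fixed-n probability is q^n; its Poisson average is the exponential of a sum over rows. This
product form is the only independence statement that is needed. -/
theorem poissonListLaw_real_avoids (m : ℕ) [NeZero m] (x : ℝ≥0) (D : Fin m → Set ℕ) :
    (poissonListLaw m (m * x)).real {l | ∀ j, Avoids j (D j) l} =
      ∏ j, Real.exp (-(x * geoLaw.real (D j))) := by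
  have hm : (m : ℝ) ≠ 0 := by simp [NeZero.ne m]
  have hm0 : (0 : ℝ) < m := by exact_mod_cast Nat.pos_of_ne_zero (NeZero.ne m)
  have hle : (∑ j, geoLaw.real (D j)) / m ≤ 1 := by
    rw [← hashLaw_real_fibre]; exact measureReal_le_one
  have hge : 0 ≤ (∑ j, geoLaw.real (D j)) / m := by
    rw [← hashLaw_real_fibre]; exact measureReal_nonneg
  rw [poissonListLaw_real]
  simp_rw [listLaw_real_avoids]
  rw [(integral_pow_poissonMeasure _ (by linarith)).2, ← Real.exp_sum]
  congr 1
  rw [Finset.sum_neg_distrib, ← Finset.mul_sum]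
  push_cast
  field_simp
  ring

/-! ### The Laplace transform of a row in the Poisson model -/

/-- The indicator of the event that row `j` avoids `D`. -/
noncomputable def avoidInd {m : ℕ} (D : Set ℕ) (l : List (Fin m × ℕ)) (j : Fin m) : ℝ :=
  Set.indicator {l | Avoids j D l} 1 l

/-- `F` is a linear combination of avoidance indicators, and `v` is the same combination of their
Poisson probabilities. -/
def Rep {m : ℕ} (x : ℝ) (F : List (Fin m × ℕ) → Fin m → ℝ) (v : ℝ) : Prop :=
  (F, v) ∈ Submodule.span ℝ (Set.range fun D : Set ℕ =>
    ((avoidInd D : List (Fin m × ℕ) → Fin m → ℝ), Real.exp (-(x * geoLaw.real D))))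

theorem prod_avoidInd {m : ℕ} (D : Fin m → Set ℕ) (l : List (Fin m × ℕ)) :
    ∏ j, avoidInd (D j) l j = Set.indicator {l | ∀ j, Avoids j (D j) l} (fun _ => (1 : ℝ)) l := by
  classical
  simp only [avoidInd, Set.indicator_apply, Set.mem_ofPred_eq, Pi.one_apply]
  split_ifs with h
  · exact Finset.prod_eq_one fun j _ => if_pos (h j)
  · push Not at h
    obtain ⟨j, hj⟩ := h
    exact Finset.prod_eq_zero (Finset.mem_univ j) (if_neg hj)

/-- By multilinearity the product over rows expands into products of avoidance indicators, whose
expectations factorise. Carrying pairs in one span keeps the coefficients of the function and of its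
value identical. -/
theorem integral_prod_of_rep {m : ℕ} [NeZero m] {x : ℝ≥0} {F : List (Fin m × ℕ) → Fin m → ℝ}
    {v : ℝ} (h : Rep x F v) : ∫ l, ∏ j, F l j ∂poissonListLaw m (m * x) = v ^ m := by
  classical
  obtain ⟨c, hc⟩ := Finsupp.mem_span_range_iff_exists_finsupp.1 h
  have hF : ∀ l j, F l j = ∑ D ∈ c.support, c D * avoidInd D l j := by
    intro l j
    have := congrFun (congrFun (congrArg Prod.fst hc) l) j
    refine this.symm.trans ?_
    simp [Finsupp.sum, Prod.fst_sum, Finset.sum_apply]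
  have hv : v = ∑ D ∈ c.support, c D * Real.exp (-(x * geoLaw.real D)) := by
    have := congrArg Prod.snd hc
    refine this.symm.trans ?_
    simp [Finsupp.sum, Prod.snd_sum]
  have hi : ∀ D : Fin m → Set ℕ, Integrable (fun l => ∏ j, avoidInd (D j) l j)
      (poissonListLaw m (m * x)) := by
    intro D
    simp_rw [prod_avoidInd]
    exact (integrable_const (1 : ℝ)).indicator MeasurableSet.of_discrete
  have hv' : v ^ m = ∏ _j : Fin m, v := by simp
  rw [hv', hv, Finset.prod_univ_sum]
  simp_rw [hF, Finset.prod_univ_sum, Finset.prod_mul_distrib]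
  rw [integral_finsetSum _ fun D _ => (hi D).const_mul _]
  refine Finset.sum_congr rfl fun D _ => ?_
  rw [integral_const_mul, ← poissonListLaw_real_avoids]
  simp_rw [prod_avoidInd]
  rw [integral_indicator_const _ MeasurableSet.of_discrete]
  simp

namespace Rep

variable {m : ℕ} {x : ℝ} {F F' : List (Fin m × ℕ) → Fin m → ℝ} {v v' : ℝ}

theorem gen (x : ℝ) (D : Set ℕ) :
    Rep x (avoidInd D : List (Fin m × ℕ) → Fin m → ℝ) (Real.exp (-(x * geoLaw.real D))) :=
  Submodule.subset_span ⟨D, rfl⟩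

theorem add (h : Rep x F v) (h' : Rep x F' v') : Rep x (F + F') (v + v') :=
  Submodule.add_mem _ h h'

theorem sub (h : Rep x F v) (h' : Rep x F' v') : Rep x (F - F') (v - v') :=
  Submodule.sub_mem _ h h'

theorem smul (h : Rep x F v) (c : ℝ) : Rep x (c • F) (c * v) :=
  Submodule.smul_mem _ c h

theorem sum {ι : Type*} (s : Finset ι) {F : ι → List (Fin m × ℕ) → Fin m → ℝ} {v : ι → ℝ}
    (h : ∀ i ∈ s, Rep x (F i) (v i)) : Rep x (∑ i ∈ s, F i) (∑ i ∈ s, v i) := by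
  have := Submodule.sum_mem _ h
  rwa [show ∑ i ∈ s, (F i, v i) = (∑ i ∈ s, F i, ∑ i ∈ s, v i) from
    Prod.ext Prod.fst_sum Prod.snd_sum] at this

end Rep

theorem Avoids.mono {m : ℕ} {j : Fin m} {D D' : Set ℕ} {l : List (Fin m × ℕ)} (hD : D ⊆ D')
    (h : Avoids j D' l) : Avoids j D l := fun a ha hj h' => h a ha hj (hD h')

theorem avoids_union {m : ℕ} {j : Fin m} {D D' : Set ℕ} {l : List (Fin m × ℕ)} :
    Avoids j (D ∪ D') l ↔ Avoids j D l ∧ Avoids j D' l := by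
  constructor
  · exact fun h => ⟨h.mono Set.subset_union_left, h.mono Set.subset_union_right⟩
  · rintro ⟨h1, h2⟩ a ha hj (h | h)
    · exact h1 a ha hj h
    · exact h2 a ha hj h

/-- The Laplace weight of a row on the event that its counter is `k`. -/
noncomputable def rowTerm {m : ℕ} (t : ℝ) (k : ℕ) (l : List (Fin m × ℕ)) (j : Fin m) : ℝ :=
  if (sketchOf l j).c1 = k then Real.exp (-(t * (sketchOf l j).weight)) else 0

/-- The expectation of `rowTerm` in the Poisson model. -/
noncomputable def rowProb (x t : ℝ) : ℕ → ℝ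
  | 0 => Real.exp (-t) * Real.exp (-x)
  | 1 => Real.exp (-(t / 2)) * (Real.exp (-(x / 2)) - Real.exp (-x))
  | k + 2 => rowWeight (x * (1 / 2) ^ (k + 2)) (t * (1 / 2) ^ (k + 2))

/-- Inclusion–exclusion on avoidance events. At counter k + 2 the bit is 0 when {k + 1} ∪ (k + 2, ∞)
is avoided but (k, ∞) is not; bit 1 is the rest of the event that the counter equals k + 2. Counters
0 and 1 always carry bit 1 and need their own formulas. -/
theorem rep_rowTerm {m : ℕ} (x t : ℝ) (k : ℕ) :
    Rep x (rowTerm t k : List (Fin m × ℕ) → Fin m → ℝ) (rowProb x t k) := by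
  classical
  match k with
  | 0 =>
    have h := (Rep.gen (m := m) x (Set.Ioi 0)).smul (Real.exp (-t))
    rw [geoLaw_real_Ioi, pow_zero, mul_one] at h
    convert! h using 1
    funext l j
    obtain ⟨h1, h2⟩ := cell_spec l j
    simp only [rowTerm, Pi.smul_apply, smul_eq_mul, avoidInd, Set.indicator_apply,
      Set.mem_ofPred_eq, ← h1, Pi.one_apply]
    generalize sketchOf l j = c at *
    obtain ⟨k, b⟩ := c
    simp only at *
    by_cases hk : k = 0
    · have hb : b = true := by
        rw [← Bool.not_eq_false, h2]; omega
      rw [if_pos hk, if_pos hk.le, hb, Cell.weight_mk_true, hk]; simp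
    · rw [if_neg hk, if_neg (by omega)]; simp
  | 1 =>
    have h := ((Rep.gen (m := m) x (Set.Ioi 1)).sub (Rep.gen x (Set.Ioi 0))).smul
      (Real.exp (-(t / 2)))
    rw [geoLaw_real_Ioi, geoLaw_real_Ioi, pow_zero, mul_one, pow_one, mul_one_div] at h
    convert! h using 1
    funext l j
    obtain ⟨h1, h2⟩ := cell_spec l j
    simp only [rowTerm, Pi.smul_apply, Pi.sub_apply, smul_eq_mul, avoidInd, Set.indicator_apply,
      Set.mem_ofPred_eq, ← h1, Pi.one_apply]
    generalize sketchOf l j = c at *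
    obtain ⟨k, b⟩ := c
    simp only at *
    by_cases hk : k = 1
    · have hb : b = true := by
        rw [← Bool.not_eq_false, h2]; omega
      rw [if_pos hk, if_pos hk.le, if_neg (by omega), hb, Cell.weight_mk_true, hk]
      rw [pow_one, mul_one_div]; ring
    · rw [if_neg hk]
      by_cases hk' : k = 0
      · rw [if_pos (by omega), if_pos (by omega)]; ring
      · rw [if_neg (by omega), if_neg (by omega)]; ring
  | k + 2 =>
    have g2 := Rep.gen (m := m) x (Set.Ioi (k + 2))
    have g1 := Rep.gen (m := m) x (Set.Ioi (k + 1))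
    have g0 := Rep.gen (m := m) x (Set.Ioi k)
    have gi := Rep.gen (m := m) x ({k + 1} ∪ Set.Ioi (k + 2))
    have h := ((((g2.sub g1).sub gi).add g0).smul (Real.exp (-(t * (1 / 2) ^ (k + 2))))).add
      ((gi.sub g0).smul (Real.exp (-(3 * (t * (1 / 2) ^ (k + 2))))))
    convert! h using 1
    · funext l j
      obtain ⟨h1, h2⟩ := cell_spec l j
      have a1 : (sketchOf l j).c1 ≤ k → Avoids j {k + 1} l := fun hk =>
        ((h1 k).1 hk).mono (by simp)
      have a2 : (sketchOf l j).c1 = k + 1 → ¬ Avoids j {k + 1} l := by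
        intro hk hav
        have h3 : Avoids j (Set.Ioi k) l :=
          (avoids_union.2 ⟨hav, (h1 (k + 1)).1 hk.le⟩).mono fun a ha => by
            simp only [Set.mem_Ioi, Set.mem_union, Set.mem_singleton_iff] at *; omega
        have := (h1 k).2 h3
        omega
      simp only [rowTerm, Pi.smul_apply, Pi.sub_apply, Pi.add_apply, smul_eq_mul, avoidInd,
        Set.indicator_apply, Set.mem_ofPred_eq, avoids_union, ← h1, Pi.one_apply]
      generalize sketchOf l j = c at *
      obtain ⟨i, b⟩ := c
      simp only at *
      rcases (show i ≤ k ∨ i = k + 1 ∨ i = k + 2 ∨ k + 2 < i by omega) with hi | hi | hi | hi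
      · rw [if_neg (by omega), if_pos (by omega), if_pos (by omega), if_pos ⟨a1 hi, by omega⟩,
          if_pos hi]
        ring
      · rw [if_neg (by omega), if_pos (by omega), if_pos (by omega), if_neg fun H => a2 hi H.1,
          if_neg (by omega)]
        ring
      · subst hi
        rw [if_pos rfl, if_pos le_rfl, if_neg (by omega), if_neg (by omega : ¬ k + 2 ≤ k)]
        simp only [le_refl, and_true, show 2 ≤ k + 2 by omega, true_and,
          show k + 2 - 1 = k + 1 by omega] at h2 ⊢
        cases b
        · rw [if_pos (h2.1 rfl), Cell.weight_mk_false]; ring_nf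
        · rw [if_neg fun H => absurd (h2.2 H) (by simp), Cell.weight_mk_true]; ring
      · rw [if_neg (by omega), if_neg (by omega), if_neg (by omega), if_neg fun H => by omega,
          if_neg (by omega)]
        ring
    · rw [geoLaw_real_Ioi, geoLaw_real_Ioi, geoLaw_real_Ioi, geoLaw_real_insert]
      set y := x * (1 / 2) ^ (k + 2) with hy
      have e1 : x * (1 / 2) ^ (k + 1) = 2 * y := by rw [hy, pow_succ]; ring
      have e0 : x * (1 / 2) ^ k = 4 * y := by rw [hy, pow_add]; ring
      have e3 : x * (3 * (1 / 2) ^ (k + 2)) = 3 * y := by rw [hy]; ring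
      have r1 : Real.exp (-(2 * y)) = Real.exp (-y) ^ 2 := by rw [← Real.exp_nat_mul]; ring_nf
      have r3 : Real.exp (-(3 * y)) = Real.exp (-y) ^ 3 := by rw [← Real.exp_nat_mul]; ring_nf
      have r4 : Real.exp (-(4 * y)) = Real.exp (-y) ^ 4 := by rw [← Real.exp_nat_mul]; ring_nf
      rw [e1, e0, e3, r3, r4, r1, rowProb, ← hy, rowWeight, r1]
      ring

/-- The right side is the weight at t = 0. Along dyadic y it telescopes. -/
theorem rowWeight_le {y t : ℝ} (hy : 0 ≤ y) (ht : 0 ≤ t) :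
    rowWeight y t ≤ Real.exp (-y) - Real.exp (-(2 * y)) := by
  have h1 : Real.exp (-y) ≤ 1 := Real.exp_le_one_iff.2 (by linarith)
  have h2 : Real.exp (-(2 * y)) ≤ 1 := Real.exp_le_one_iff.2 (by linarith)
  have h3 : Real.exp (-t) ≤ 1 := Real.exp_le_one_iff.2 (by linarith)
  have h4 : Real.exp (-(3 * t)) ≤ 1 := Real.exp_le_one_iff.2 (by linarith)
  have r1 : Real.exp (-(2 * y)) = Real.exp (-y) * Real.exp (-y) := by
    rw [← Real.exp_add]; ring_nf
  have h5 : (1 - Real.exp (-(2 * y))) * Real.exp (-t) + Real.exp (-(2 * y)) * Real.exp (-(3 * t))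
      ≤ 1 := by
    have := Real.exp_pos (-(2 * y))
    nlinarith
  calc rowWeight y t ≤ Real.exp (-y) * (1 - Real.exp (-y)) * 1 := by
        unfold rowWeight
        refine mul_le_mul_of_nonneg_left h5 ?_
        exact mul_nonneg (Real.exp_pos _).le (by linarith)
    _ = _ := by rw [r1]; ring

theorem rowProb_nonneg {x t : ℝ} (hx : 0 ≤ x) (k : ℕ) : 0 ≤ rowProb x t k := by
  match k with
  | 0 => simp only [rowProb]; positivity
  | 1 =>
    simp only [rowProb]
    have : Real.exp (-x) ≤ Real.exp (-(x / 2)) := Real.exp_le_exp.2 (by linarith)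
    exact mul_nonneg (Real.exp_pos _).le (by linarith)
  | k + 2 => exact rowWeight_nonneg (by positivity) _

theorem summable_rowProb {x t : ℝ} (hx : 0 ≤ x) (ht : 0 ≤ t) : Summable (rowProb x t) := by
  rw [← summable_nat_add_iff 2]
  refine ((summable_nat_add_iff 2).2 (summable_geometric_two.mul_left x)).of_nonneg_of_le
    (fun k => rowProb_nonneg hx _) fun k => ?_
  refine (rowWeight_le (by positivity) (by positivity)).trans ?_
  set y := x * (1 / 2) ^ (k + 2)
  have hy : 0 ≤ y := by positivity
  have h1 : Real.exp (-y) ≤ 1 := Real.exp_le_one_iff.2 (by linarith)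
  have r1 : Real.exp (-(2 * y)) = Real.exp (-y) * Real.exp (-y) := by
    rw [← Real.exp_add]; ring_nf
  have h2 := Real.add_one_le_exp (-y)
  have h3 := Real.exp_pos (-y)
  nlinarith

/-- The Laplace transform of the weight of a row in the Poisson model with mean `x` per row. -/
noncomputable def rowLaplace (x t : ℝ) : ℝ := ∑' k, rowProb x t k

theorem rowLaplace_nonneg {x t : ℝ} (hx : 0 ≤ x) : 0 ≤ rowLaplace x t :=
  tsum_nonneg fun k => rowProb_nonneg hx k

/-- For counters below K the row factor is a finite combination and `integral_prod_of_rep` applies.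
Then K → ∞ by dominated convergence, as each list has finitely many finite counters. -/
theorem integral_exp_invY_poisson {m : ℕ} [NeZero m] (x : ℝ≥0) {t : ℝ} (ht : 0 ≤ t) :
    ∫ l, Real.exp (-(t * invY l)) ∂poissonListLaw m (m * x) = rowLaplace x t ^ m := by
  have h1 : ∀ K : ℕ, ∫ l, ∏ j, (∑ k ∈ Finset.range K, rowTerm t k) l j ∂poissonListLaw m (m * x)
      = (∑ k ∈ Finset.range K, rowProb x t k) ^ m := fun K =>
    integral_prod_of_rep (Rep.sum _ fun k _ => rep_rowTerm x t k)
  have h2 : Tendsto (fun K : ℕ => (∑ k ∈ Finset.range K, rowProb x t k) ^ m) atTop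
      (𝓝 (rowLaplace x t ^ m)) :=
    ((summable_rowProb x.2 ht).hasSum.tendsto_sum_nat).pow m
  have hval : ∀ (K : ℕ) (l : List (Fin m × ℕ)) j, (∑ k ∈ Finset.range K, rowTerm t k) l j
      = if (sketchOf l j).c1 < K then Real.exp (-(t * (sketchOf l j).weight)) else 0 := by
    intro K l j
    simp only [Finset.sum_apply, rowTerm]
    rw [Finset.sum_ite_eq]
    simp only [Finset.mem_range]
  refine tendsto_nhds_unique ?_ h2
  simp_rw [← h1]
  refine tendsto_integral_of_dominated_convergence (fun _ => 1)
    (fun K => Measurable.of_discrete.aestronglyMeasurable) (integrable_const 1) ?_ ?_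
  · intro K
    refine ae_of_all _ fun l => ?_
    rw [norm_prod]
    refine Finset.prod_le_one (fun _ _ => norm_nonneg _) fun j _ => ?_
    rw [hval]
    split_ifs
    · rw [Real.norm_of_nonneg (Real.exp_pos _).le, Real.exp_le_one_iff]
      have := (sketchOf l j).weight_pos
      nlinarith
    · simp
  · refine ae_of_all _ fun l => ?_
    refine tendsto_const_nhds.congr' ?_
    have : ∀ᶠ K in atTop, ∀ j, (sketchOf l j).c1 < K := by
      rw [eventually_all]
      exact fun j => eventually_gt_atTop _
    filter_upwards [this] with K hK
    simp only [hval, hK, if_true]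
    rw [← Real.exp_sum, invY, Finset.mul_sum, Finset.sum_neg_distrib]

/-! ### Comparison of the row transform with the profile -/

theorem tsum_rowWeight_nat_le {x u : ℝ} (hx : 0 < x) (hu : 0 ≤ u) :
    ∑' n : ℕ, rowWeight (x * 2 ^ (n : ℤ)) (u * (x * 2 ^ (n : ℤ))) ≤ Real.exp (-x) := by
  refine Real.tsum_le_of_sum_range_le (fun n => rowWeight_nonneg (by positivity) _) fun N => ?_
  have h : ∀ n : ℕ, rowWeight (x * 2 ^ (n : ℤ)) (u * (x * 2 ^ (n : ℤ))) ≤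
      Real.exp (-(x * 2 ^ n)) - Real.exp (-(x * 2 ^ (n + 1))) := by
    intro n
    refine (rowWeight_le (by positivity) (by positivity)).trans (le_of_eq ?_)
    rw [zpow_natCast, pow_succ]; ring_nf
  refine (Finset.sum_le_sum fun n _ => h n).trans ?_
  rw [Finset.sum_range_sub' (fun n => Real.exp (-(x * 2 ^ n)))]
  simp only [pow_zero, mul_one]
  linarith [Real.exp_pos (-(x * 2 ^ N))]

/-- Counter k corresponds to the dyadic point x·2^(-k). The two sums agree for k ≥ 2, so only the
exceptional counters 0 and 1 and the fictitious terms with k ≤ 1 are left. -/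
theorem rowLaplace_sub_profile {x u : ℝ} (hx : 0 < x) (hu : 0 ≤ u) :
    rowLaplace x (x * u) - profile x u = rowProb x (x * u) 0 + rowProb x (x * u) 1
      - (∑' n : ℕ, rowWeight (x * 2 ^ (n : ℤ)) (u * (x * 2 ^ (n : ℤ)))
        + rowWeight (x / 2) (u * (x / 2))) := by
  have hs := (hasSum_rowWeight hx hu).summable
  have hz : ∀ k : ℕ, rowProb x (x * u) (k + 2) =
      rowWeight (x * 2 ^ (-((k + 1 : ℕ) + 1 : ℤ))) (u * (x * 2 ^ (-((k + 1 : ℕ) + 1 : ℤ)))) := by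
    intro k
    have : (2 : ℝ) ^ (-((k + 1 : ℕ) + 1 : ℤ)) = (1 / 2) ^ (k + 2) := by
      rw [show (-((k + 1 : ℕ) + 1 : ℤ)) = -((k + 2 : ℕ) : ℤ) by push_cast; ring, zpow_neg,
        zpow_natCast, one_div, inv_pow]
    rw [this, rowProb]
    congr 1; ring
  have h1 : Summable fun n : ℕ => rowWeight (x * 2 ^ (-((n : ℤ) + 1)))
      (u * (x * 2 ^ (-((n : ℤ) + 1)))) := by
    refine hs.comp_injective (i := fun n : ℕ => -((n : ℤ) + 1)) fun a b hab => ?_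
    simp only at hab
    omega
  have h2 : Summable fun n : ℕ => rowWeight (x * 2 ^ (n : ℤ)) (u * (x * 2 ^ (n : ℤ))) :=
    hs.comp_injective (i := fun n : ℕ => (n : ℤ)) Nat.cast_injective
  have e1 : profile x u = ∑' n : ℕ, rowWeight (x * 2 ^ (n : ℤ)) (u * (x * 2 ^ (n : ℤ)))
      + ∑' n : ℕ, rowWeight (x * 2 ^ (-((n : ℤ) + 1))) (u * (x * 2 ^ (-((n : ℤ) + 1)))) :=
    tsum_of_nat_of_neg_add_one h2 h1
  rw [e1, h1.tsum_eq_zero_add, rowLaplace,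
    ← (summable_rowProb hx.le (by positivity : 0 ≤ x * u)).sum_add_tsum_nat_add 2,
    Finset.sum_range_succ, Finset.sum_range_one]
  simp_rw [hz]
  have e3 : x * (2 : ℝ) ^ (-(((0 : ℕ) : ℤ) + 1)) = x / 2 := by
    rw [show (-(((0 : ℕ) : ℤ) + 1)) = -1 by norm_num, zpow_neg_one]; ring
  rw [e3]
  ring

theorem abs_rowLaplace_sub_profile_le {x u : ℝ} (hx : 0 < x) (hu : 0 ≤ u) :
    |rowLaplace x (x * u) - profile x u| ≤ Real.exp (-(x / 2)) := by
  rw [rowLaplace_sub_profile hx hu]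
  have h1 := tsum_rowWeight_nat_le hx hu
  have h2 := rowWeight_le (y := x / 2) (t := u * (x / 2)) (by positivity) (by positivity)
  rw [mul_div_cancel₀ x two_ne_zero] at h2
  have h3 : 0 ≤ ∑' n : ℕ, rowWeight (x * 2 ^ (n : ℤ)) (u * (x * 2 ^ (n : ℤ))) :=
    tsum_nonneg fun n => rowWeight_nonneg (by positivity) _
  have h4 := rowWeight_nonneg (y := x / 2) (by positivity) (u * (x / 2))
  have h5 := rowProb_nonneg (t := x * u) hx.le 0
  have h6 := rowProb_nonneg (t := x * u) hx.le 1
  have hxu : 0 ≤ x * u := by positivity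
  have h7 : rowProb x (x * u) 0 ≤ Real.exp (-x) :=
    mul_le_of_le_one_left (Real.exp_pos _).le (Real.exp_le_one_iff.2 (by linarith))
  have h8 : rowProb x (x * u) 1 ≤ Real.exp (-(x / 2)) - Real.exp (-x) := by
    have : Real.exp (-x) ≤ Real.exp (-(x / 2)) := Real.exp_le_exp.2 (by linarith)
    exact mul_le_of_le_one_left (by linarith) (Real.exp_le_one_iff.2 (by linarith))
  rw [abs_le]
  constructor <;> linarith

/-- A crude majorant of order 1/(1 + u), uniform for x bounded away from 0; its third power gives
the integrable domination. -/
theorem rowLaplace_le {x u : ℝ} (hx : 0 < x) (hu : 0 < u) :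
    rowLaplace x (x * u) ≤ (2 + 4 / x) / (1 + u) := by
  have h := rowLaplace_sub_profile hx hu.le
  have h3 : 0 ≤ ∑' n : ℕ, rowWeight (x * 2 ^ (n : ℤ)) (u * (x * 2 ^ (n : ℤ))) :=
    tsum_nonneg fun n => rowWeight_nonneg (by positivity) _
  have h4 := rowWeight_nonneg (y := x / 2) (by positivity) (u * (x / 2))
  have h1 := (majorised_profile hx).le u hu
  have h2 : (1 : ℝ) / (1 + 0.95 * u) ≤ 2 / (1 + u) := by
    rw [div_le_div_iff₀ (by positivity) (by positivity)]; linarith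
  have hs : 0 < x / 2 * (1 + u) := by positivity
  have e : Real.exp (-(x / 2 * (1 + u))) ≤ 2 / x / (1 + u) := by
    rw [Real.exp_neg, inv_le_comm₀ (Real.exp_pos _) (by positivity)]
    have := Real.add_one_le_exp (x / 2 * (1 + u))
    have e2 : (2 / x / (1 + u))⁻¹ = x / 2 * (1 + u) := by field_simp
    linarith
  have h5 : rowProb x (x * u) 0 ≤ Real.exp (-(x / 2 * (1 + u))) := by
    rw [rowProb, ← Real.exp_add, Real.exp_le_exp]
    nlinarith
  have h6 : rowProb x (x * u) 1 ≤ Real.exp (-(x / 2 * (1 + u))) := by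
    rw [rowProb]
    calc _ ≤ Real.exp (-(x * u / 2)) * Real.exp (-(x / 2)) := by
          refine mul_le_mul_of_nonneg_left ?_ (Real.exp_pos _).le
          linarith [Real.exp_pos (-x)]
      _ = _ := by rw [← Real.exp_add]; ring_nf
  have e3 : (2 + 4 / x) / (1 + u) = 2 / (1 + u) + 2 * (2 / x / (1 + u)) := by field_simp; ring
  linarith

/-- `∑ₖ (e^{-a y} - e^{-b y})` over the dyadic points `y = x 2ᵏ` is at most `2 log (b / a)`. -/
theorem tsum_exp_sub_exp_bounds {x a b : ℝ} (hx : 0 < x) (ha : 0 < a) (hab : a ≤ b) :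
    0 ≤ ∑' k : ℤ, (Real.exp (-(a * (x * 2 ^ k))) - Real.exp (-(b * (x * 2 ^ k)))) ∧
    ∑' k : ℤ, (Real.exp (-(a * (x * 2 ^ k))) - Real.exp (-(b * (x * 2 ^ k)))) ≤
      2 * Real.log (b / a) := by
  constructor
  · refine tsum_nonneg fun k => ?_
    have : 0 < x * 2 ^ k := by positivity
    have := Real.exp_le_exp.2 (show -(b * (x * 2 ^ k)) ≤ -(a * (x * 2 ^ k)) by nlinarith)
    linarith
  · rw [(hasSum_exp_sub_exp hx ha hab).tsum_eq, Real.logb]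
    have h1 := (abs_le.1 (abs_integral_fluct_le_log hx ha hab)).2
    have h2 : 0 ≤ Real.log (b / a) := Real.log_nonneg (by rwa [one_le_div ha])
    have h3 : Real.log (b / a) / Real.log 2 ≤ 1.5 * Real.log (b / a) := by
      have := log_two_bounds
      rw [div_le_iff₀ (by linarith)]
      nlinarith
    linarith

/-- The product xu is held fixed while the Poisson mean changes. Each of the six exponentials moves
by a sum lying in [0, 2 log k], by `tsum_exp_sub_exp_bounds`. -/
theorem abs_profile_dilate_sub_le {x u k : ℝ} (hx : 0 < x) (hu : 0 ≤ u) (hk : 1 ≤ k) :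
    |profile (k * x) (u / k) - profile x u| ≤ 12 * Real.log k := by
  have hk0 : 0 < k := by linarith
  have key : ∀ p q : ℝ, 0 < p → 0 ≤ q →
      HasSum (fun i : ℤ => Real.exp (-((p + q * u) * (x * 2 ^ i)))
        - Real.exp (-((p * k + q * u) * (x * 2 ^ i))))
        (∑' i : ℤ, (Real.exp (-((p + q * u) * (x * 2 ^ i)))
        - Real.exp (-((p * k + q * u) * (x * 2 ^ i))))) ∧
      0 ≤ ∑' i : ℤ, (Real.exp (-((p + q * u) * (x * 2 ^ i)))
        - Real.exp (-((p * k + q * u) * (x * 2 ^ i)))) ∧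
      ∑' i : ℤ, (Real.exp (-((p + q * u) * (x * 2 ^ i)))
        - Real.exp (-((p * k + q * u) * (x * 2 ^ i)))) ≤ 2 * Real.log k := by
    intro p q hp hq
    have hqu : 0 ≤ q * u := by positivity
    have ha : 0 < p + q * u := by positivity
    have hab : p + q * u ≤ p * k + q * u := by nlinarith
    obtain ⟨h1, h2⟩ := tsum_exp_sub_exp_bounds hx ha hab
    refine ⟨(hasSum_exp_sub_exp hx ha hab).summable.hasSum, h1, h2.trans ?_⟩
    have : (p * k + q * u) / (p + q * u) ≤ k := by
      rw [div_le_iff₀ ha]; nlinarith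
    have h3 : 0 < (p * k + q * u) / (p + q * u) := by positivity
    linarith [Real.log_le_log h3 this]
  obtain ⟨s1, a1, b1⟩ := key 1 1 one_pos zero_le_one
  obtain ⟨s2, a2, b2⟩ := key 2 1 two_pos zero_le_one
  obtain ⟨s3, a3, b3⟩ := key 3 1 three_pos zero_le_one
  obtain ⟨s4, a4, b4⟩ := key 4 1 four_pos zero_le_one
  obtain ⟨s5, a5, b5⟩ := key 3 3 three_pos three_pos.le
  obtain ⟨s6, a6, b6⟩ := key 4 3 four_pos three_pos.le
  have hP := (hasSum_rowWeight hx hu).summable.hasSum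
  have hP' := (hasSum_rowWeight (x := k * x) (u := u / k) (by positivity) (by positivity)).summable.hasSum
  have hs := ((((s2.sub s1).add (s3.sub s4)).add (s6.sub s5)).add hP).unique (hP'.congr_fun ?_)
  · rw [profile, profile, ← hs, abs_le]
    constructor <;> linarith
  · intro i
    rw [rowWeight_eq, rowWeight_eq]
    have e : ∀ p q : ℝ, (p + q * (u / k)) * (k * x * 2 ^ i) = (p * k + q * u) * (x * 2 ^ i) := by
      intro p q; field_simp
    have e' : ∀ p : ℝ, (p + u / k) * (k * x * 2 ^ i) = (p * k + 1 * u) * (x * 2 ^ i) := by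
      intro p; field_simp
    simp only [e, e', one_mul]
    ring

/-! ### Inverse moments from Laplace transforms -/

theorem lintegral_pow_mul_exp {s : ℝ} (hs : 0 < s) (j : ℕ) :
    ∫⁻ t in Set.Ioi (0 : ℝ), ENNReal.ofReal (t ^ j * Real.exp (-(t * s)))
      = ENNReal.ofReal (j.factorial / s ^ (j + 1)) := by
  have h := Real.integral_rpow_mul_exp_neg_mul_Ioi (a := j + 1) (r := s) (by positivity) hs
  have h1 : ∫ t in Set.Ioi (0 : ℝ), t ^ j * Real.exp (-(t * s)) = j.factorial / s ^ (j + 1) := by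
    rw [Real.Gamma_nat_eq_factorial] at h
    have e : ∀ t ∈ Set.Ioi (0 : ℝ), t ^ j * Real.exp (-(t * s))
        = t ^ ((j : ℝ) + 1 - 1) * Real.exp (-(s * t)) := by
      intro t _
      rw [add_sub_cancel_right, Real.rpow_natCast, mul_comm t s]
    rw [setIntegral_congr_fun measurableSet_Ioi e, h,
      show (j : ℝ) + 1 = ((j + 1 : ℕ) : ℝ) by push_cast; ring, Real.rpow_natCast, div_pow, one_pow]
    ring
  rw [← h1, ofReal_integral_eq_lintegral_ofReal]
  · refine not_imp_comm.1 integral_undef ?_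
    rw [h1]; positivity
  · filter_upwards [ae_restrict_mem measurableSet_Ioi] with t ht
    have : (0 : ℝ) < t := ht
    simp only [Pi.zero_apply]
    positivity

section Moments

variable {Ω : Type*} [MeasurableSpace Ω] {P : Measure Ω} [IsProbabilityMeasure P] {S : Ω → ℝ}

theorem measurable_laplace (hS : Measurable S) :
    Measurable fun t : ℝ => ∫ ω, Real.exp (-(t * S ω)) ∂P := by
  have h : StronglyMeasurable (Function.uncurry fun (t : ℝ) ω => Real.exp (-(t * S ω))) := by
    apply Measurable.stronglyMeasurable
    fun_prop
  exact h.integral_prod_right.measurable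

theorem integrable_exp_neg (hS : Measurable S) (hS0 : ∀ ω, 0 < S ω) {t : ℝ} (ht : 0 ≤ t) :
    Integrable (fun ω => Real.exp (-(t * S ω))) P := by
  refine Integrable.of_bound (by fun_prop) 1 (ae_of_all _ fun ω => ?_)
  rw [Real.norm_of_nonneg (Real.exp_pos _).le, Real.exp_le_one_iff]
  have := mul_nonneg ht (hS0 ω).le
  linarith

/-- Moments of `S⁻¹` through the Laplace transform of `S`. -/
theorem integral_inv_pow_of_laplace (hS : Measurable S) (hS0 : ∀ ω, 0 < S ω) (j : ℕ)
    (hL : IntegrableOn (fun t : ℝ => t ^ j * ∫ ω, Real.exp (-(t * S ω)) ∂P) (Set.Ioi 0)) :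
    Integrable (fun ω => j.factorial / S ω ^ (j + 1)) P ∧
      ∫ ω, j.factorial / S ω ^ (j + 1) ∂P
        = ∫ t in Set.Ioi (0 : ℝ), t ^ j * ∫ ω, Real.exp (-(t * S ω)) ∂P := by
  have hnn : ∀ t ∈ Set.Ioi (0 : ℝ), 0 ≤ t ^ j * ∫ ω, Real.exp (-(t * S ω)) ∂P := by
    intro t ht
    have : (0 : ℝ) < t := ht
    exact mul_nonneg (by positivity) (integral_nonneg fun _ => (Real.exp_pos _).le)
  have hnn' : 0 ≤ᵐ[volume.restrict (Set.Ioi 0)] fun t : ℝ =>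
      t ^ j * ∫ ω, Real.exp (-(t * S ω)) ∂P := by
    filter_upwards [ae_restrict_mem measurableSet_Ioi] with t ht using hnn t ht
  have hpos : ∀ ω, 0 ≤ (j.factorial : ℝ) / S ω ^ (j + 1) := fun ω => by
    have := hS0 ω; positivity
  have key : ∫⁻ ω, ENNReal.ofReal (j.factorial / S ω ^ (j + 1)) ∂P
      = ENNReal.ofReal (∫ t in Set.Ioi (0 : ℝ), t ^ j * ∫ ω, Real.exp (-(t * S ω)) ∂P) := by
    rw [ofReal_integral_eq_lintegral_ofReal hL hnn']
    calc ∫⁻ ω, ENNReal.ofReal (j.factorial / S ω ^ (j + 1)) ∂P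
        = ∫⁻ ω, (∫⁻ t in Set.Ioi (0 : ℝ), ENNReal.ofReal (t ^ j * Real.exp (-(t * S ω)))) ∂P := by
          refine lintegral_congr fun ω => (lintegral_pow_mul_exp (hS0 ω) j).symm
      _ = ∫⁻ t in Set.Ioi (0 : ℝ), ∫⁻ ω, ENNReal.ofReal (t ^ j * Real.exp (-(t * S ω))) ∂P := by
          apply lintegral_lintegral_swap
          apply Measurable.aemeasurable
          fun_prop
      _ = _ := by
          refine setLIntegral_congr_fun measurableSet_Ioi fun t ht => ?_
          have ht0 : (0 : ℝ) < t := ht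
          rw [← integral_const_mul, ofReal_integral_eq_lintegral_ofReal
            ((integrable_exp_neg hS hS0 ht0.le).const_mul _) (ae_of_all _ fun ω => by positivity)]
  have hm : AEStronglyMeasurable (fun ω => (j.factorial : ℝ) / S ω ^ (j + 1)) P := by
    apply Measurable.aestronglyMeasurable
    fun_prop
  have hI : Integrable (fun ω => (j.factorial : ℝ) / S ω ^ (j + 1)) P := by
    refine ⟨hm, ?_⟩
    rw [hasFiniteIntegral_iff_ofReal (ae_of_all _ hpos), key]
    exact ENNReal.ofReal_lt_top
  refine ⟨hI, ?_⟩
  rw [integral_eq_lintegral_of_nonneg_ae (ae_of_all _ hpos) hm, key, ENNReal.toReal_ofReal]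
  exact setIntegral_nonneg measurableSet_Ioi hnn

/-- The variance functional of a Laplace transform. -/
noncomputable def varLap (H : ℝ → ℝ) : ℝ :=
  (∫ u in Set.Ioi (0 : ℝ), u * H u) - (∫ u in Set.Ioi (0 : ℝ), H u) ^ 2

/-- `H` is measurable on the half-line and lies between `0` and `C (1 + u)⁻³`. -/
structure CubicDecay (H : ℝ → ℝ) (C : ℝ) : Prop where
  meas : AEStronglyMeasurable H (volume.restrict (Set.Ioi 0))
  nonneg : ∀ u, 0 < u → 0 ≤ H u
  le : ∀ u, 0 < u → H u ≤ C / (1 + u) ^ 3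

theorem integrableOn_cubic :
    IntegrableOn (fun u : ℝ => 1 / (1 + u) ^ 3) (Set.Ioi 0) ∧
      IntegrableOn (fun u : ℝ => u / (1 + u) ^ 3) (Set.Ioi 0) := by
  have h0 := (integral_inv_pow one_pos 1).1
  have h1 := (hasIntegral_div_pow_one one_pos 0).1
  simp only [one_mul] at h0 h1
  exact ⟨h0, h1⟩

theorem CubicDecay.integrableOn {H : ℝ → ℝ} {C : ℝ} (h : CubicDecay H C) :
    IntegrableOn H (Set.Ioi 0) ∧ IntegrableOn (fun u => u * H u) (Set.Ioi 0) := by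
  constructor
  · refine (integrableOn_cubic.1.const_mul C).mono' h.meas ?_
    filter_upwards [ae_restrict_mem measurableSet_Ioi] with u hu
    rw [Real.norm_of_nonneg (h.nonneg u hu), mul_one_div]
    exact h.le u hu
  · refine (integrableOn_cubic.2.const_mul C).mono'
      (measurable_id.aestronglyMeasurable.mul h.meas) ?_
    filter_upwards [ae_restrict_mem measurableSet_Ioi] with u hu
    have hu0 : (0 : ℝ) < u := hu
    rw [Real.norm_of_nonneg (mul_nonneg hu0.le (h.nonneg u hu))]
    calc u * H u ≤ u * (C / (1 + u) ^ 3) := mul_le_mul_of_nonneg_left (h.le u hu) hu0.le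
      _ = _ := by ring

/-- The two moment formulas j = 0, 1 after the substitution t = xu. Cubic decay is what makes the
integral of t·L(t) converge. -/
theorem variance_inv_of_laplace (hS : Measurable S) (hS0 : ∀ ω, 0 < S ω) {x C : ℝ} (hx : 0 < x)
    (h : CubicDecay (fun u => ∫ ω, Real.exp (-(x * u * S ω)) ∂P) C) :
    MemLp (fun ω => (S ω)⁻¹) 2 P ∧ variance (fun ω => (S ω)⁻¹) P
      = x ^ 2 * varLap (fun u => ∫ ω, Real.exp (-(x * u * S ω)) ∂P) := by
  set L : ℝ → ℝ := fun t => ∫ ω, Real.exp (-(t * S ω)) ∂P with hL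
  obtain ⟨i0, i1⟩ := h.integrableOn
  have i0' : IntegrableOn (fun u => L (x * u)) (Set.Ioi 0) := i0
  have i1' : IntegrableOn (fun u => (fun t => t * L t) (x * u)) (Set.Ioi 0) := by
    refine (i1.const_mul x).congr (ae_of_all _ fun u => ?_)
    simp only [hL]; ring
  replace i0' := (integrableOn_Ioi_comp_mul_left_iff L 0 hx).1 i0'
  replace i1' := (integrableOn_Ioi_comp_mul_left_iff (fun t => t * L t) 0 hx).1 i1'
  rw [mul_zero] at i0' i1'
  have e0 : ∫ u in Set.Ioi (0 : ℝ), L (x * u) = x⁻¹ * ∫ t in Set.Ioi (0 : ℝ), L t := by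
    have := integral_comp_mul_left_Ioi L 0 hx
    simpa using this
  have e1 : ∫ u in Set.Ioi (0 : ℝ), u * L (x * u) = (x ^ 2)⁻¹ * ∫ t in Set.Ioi (0 : ℝ), t * L t := by
    have := integral_comp_mul_left_Ioi (fun t => t * L t) 0 hx
    simp only [mul_zero, smul_eq_mul, mul_assoc, integral_const_mul] at this
    set A := ∫ u in Set.Ioi (0 : ℝ), u * L (x * u)
    set B := ∫ t in Set.Ioi (0 : ℝ), t * L t
    field_simp at this ⊢
    exact this
  have m0 := integral_inv_pow_of_laplace (P := P) hS hS0 0 (by simpa using i0')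
  have m1 := integral_inv_pow_of_laplace (P := P) hS hS0 1 (by simpa using i1')
  simp only [Nat.factorial, Nat.cast_one, zero_add, pow_one, pow_zero, one_mul, one_div, mul_one,
    Nat.reduceAdd] at m0 m1
  have hmem : MemLp (fun ω => (S ω)⁻¹) 2 P := by
    rw [memLp_two_iff_integrable_sq (by apply Measurable.aestronglyMeasurable; fun_prop)]
    simpa [inv_pow] using m1.1
  refine ⟨hmem, ?_⟩
  rw [variance_eq_sub hmem]
  have e2 : ∫ ω, ((fun ω => (S ω)⁻¹) ^ 2) ω ∂P = ∫ ω, (S ω ^ 2)⁻¹ ∂P := by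
    simp [inv_pow]
  rw [e2, m0.2, m1.2, varLap]
  change _ = x ^ 2 * ((∫ u in Set.Ioi (0 : ℝ), u * L (x * u))
    - (∫ u in Set.Ioi (0 : ℝ), L (x * u)) ^ 2)
  rw [e0, e1]
  field_simp
  rfl

end Moments

/-- The variance functional is continuous under dominated convergence of differences. -/
theorem tendsto_varLap_sub {ι : Type*} {l : Filter ι} [l.IsCountablyGenerated] {H K : ι → ℝ → ℝ}
    {C : ℝ} (hH : ∀ᶠ i in l, CubicDecay (H i) C) (hK : ∀ᶠ i in l, CubicDecay (K i) C)
    (h : ∀ u, 0 < u → Tendsto (fun i => H i u - K i u) l (𝓝 0)) :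
    Tendsto (fun i => varLap (H i) - varLap (K i)) l (𝓝 0) := by
  have hd : ∀ᶠ i in l, ∀ u, 0 < u → |H i u - K i u| ≤ C / (1 + u) ^ 3 := by
    filter_upwards [hH, hK] with i h1 h2 u hu
    have := h1.nonneg u hu
    have := h1.le u hu
    have := h2.nonneg u hu
    have := h2.le u hu
    rw [abs_le]; constructor <;> linarith
  have t0 : Tendsto (fun i => ∫ u in Set.Ioi (0 : ℝ), (H i u - K i u)) l (𝓝 0) := by
    have := tendsto_integral_filter_of_dominated_convergence (l := l)
      (μ := volume.restrict (Set.Ioi 0)) (F := fun i u => H i u - K i u) (f := fun _ => (0 : ℝ))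
      (fun u => C * (1 / (1 + u) ^ 3))
      (by filter_upwards [hH, hK] with i h1 h2 using h1.meas.sub h2.meas) ?_
      (integrableOn_cubic.1.const_mul C) ?_
    · simpa using this
    · filter_upwards [hd] with i hi
      filter_upwards [ae_restrict_mem measurableSet_Ioi] with u hu
      rw [mul_one_div]; exact hi u hu
    · filter_upwards [ae_restrict_mem measurableSet_Ioi] with u hu using h u hu
  have t1 : Tendsto (fun i => ∫ u in Set.Ioi (0 : ℝ), u * (H i u - K i u)) l (𝓝 0) := by
    have := tendsto_integral_filter_of_dominated_convergence (l := l)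
      (μ := volume.restrict (Set.Ioi 0)) (F := fun i u => u * (H i u - K i u))
      (f := fun _ => (0 : ℝ)) (fun u => C * (u / (1 + u) ^ 3))
      (by filter_upwards [hH, hK] with i h1 h2 using
        measurable_id.aestronglyMeasurable.mul (h1.meas.sub h2.meas)) ?_
      (integrableOn_cubic.2.const_mul C) ?_
    · simpa using this
    · filter_upwards [hd] with i hi
      filter_upwards [ae_restrict_mem measurableSet_Ioi] with u hu
      have hu0 : (0 : ℝ) < u := hu
      rw [norm_mul, Real.norm_of_nonneg hu0.le, Real.norm_eq_abs]
      calc u * |H i u - K i u| ≤ u * (C / (1 + u) ^ 3) :=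
            mul_le_mul_of_nonneg_left (hi u hu) hu0.le
        _ = _ := by ring
    · filter_upwards [ae_restrict_mem measurableSet_Ioi] with u hu
      simpa using (h u hu).const_mul u
  set B := ∫ u in Set.Ioi (0 : ℝ), C * (1 / (1 + u) ^ 3) with hB
  have hbd : ∀ G : ℝ → ℝ, CubicDecay G C → 0 ≤ ∫ u in Set.Ioi (0 : ℝ), G u ∧
      ∫ u in Set.Ioi (0 : ℝ), G u ≤ B := by
    intro G hG
    refine ⟨setIntegral_nonneg measurableSet_Ioi hG.nonneg, ?_⟩
    refine setIntegral_mono_on hG.integrableOn.1 (integrableOn_cubic.1.const_mul C)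
      measurableSet_Ioi fun u hu => ?_
    rw [mul_one_div]; exact hG.le u hu
  -- The difference of the squared first moments factors; one factor tends to 0 and the other is
  -- bounded by 2B.
  have t2 : Tendsto (fun i => (∫ u in Set.Ioi (0 : ℝ), (H i u - K i u)) *
      ((∫ u in Set.Ioi (0 : ℝ), H i u) + ∫ u in Set.Ioi (0 : ℝ), K i u)) l (𝓝 0) := by
    refine squeeze_zero_norm' (a := fun i => ‖∫ u in Set.Ioi (0 : ℝ), (H i u - K i u)‖ * (2 * B)) ?_ ?_
    · filter_upwards [hH, hK] with i h1 h2
      obtain ⟨a1, a2⟩ := hbd _ h1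
      obtain ⟨b1, b2⟩ := hbd _ h2
      rw [norm_mul, Real.norm_of_nonneg (add_nonneg a1 b1)]
      refine mul_le_mul_of_nonneg_left (by linarith) (norm_nonneg _)
    · simpa using t0.norm.mul_const (2 * B)
  have := t1.sub t2
  rw [sub_zero] at this
  refine this.congr' ?_
  filter_upwards [hH, hK] with i h1 h2
  have e0 : ∫ u in Set.Ioi (0 : ℝ), (H i u - K i u) = (∫ u in Set.Ioi (0 : ℝ), H i u)
      - ∫ u in Set.Ioi (0 : ℝ), K i u := integral_sub h1.integrableOn.1 h2.integrableOn.1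
  have e1 : ∫ u in Set.Ioi (0 : ℝ), u * (H i u - K i u) = (∫ u in Set.Ioi (0 : ℝ), u * H i u)
      - ∫ u in Set.Ioi (0 : ℝ), u * K i u := by
    simp_rw [mul_sub]
    exact integral_sub h1.integrableOn.2 h2.integrableOn.2
  rw [e0, e1, varLap, varLap]
  ring

/-! ### From a Poisson to a fixed number of elements -/

/-- Chernoff's bound with the generating function at 1 - s; the upper tail below uses 1 + s. -/
theorem poissonMeasure_real_Iio_le (lam : ℝ≥0) (n : ℕ) {s : ℝ} (h0 : 0 ≤ s) (h1 : s ≤ 1 / 2) :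
    (poissonMeasure lam).real (Set.Iio n) ≤ Real.exp (n * (s + 2 * s ^ 2) - lam * s) := by
  have hq : 0 < 1 - s := by linarith
  obtain ⟨hi, he⟩ := integral_pow_poissonMeasure lam hq.le
  have h2 : (poissonMeasure lam).real (Set.Iio n) ≤
      ∫ k, (1 / (1 - s)) ^ n * (1 - s) ^ k ∂poissonMeasure lam := by
    have : ∫ k, Set.indicator (Set.Iio n) (fun _ => (1 : ℝ)) k ∂poissonMeasure lam
        = (poissonMeasure lam).real (Set.Iio n) := by
      rw [integral_indicator_const _ MeasurableSet.of_discrete]; simp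
    rw [← this]
    refine integral_mono ((integrable_const _).indicator MeasurableSet.of_discrete)
      (hi.const_mul _) fun k => ?_
    by_cases hk : k < n
    · simp only
      rw [Set.indicator_of_mem (Set.mem_Iio.2 hk), one_div, inv_pow, ← div_eq_inv_mul,
        one_le_div (by positivity)]
      exact pow_le_pow_of_le_one hq.le (by linarith) hk.le
    · simp only
      rw [Set.indicator_of_notMem (by simpa using hk)]
      positivity
  refine h2.trans ?_
  rw [integral_const_mul, he, sub_sub_cancel_left]
  have h3 : 1 / (1 - s) ≤ Real.exp (s + 2 * s ^ 2) := by
    have h4 := Real.add_one_le_exp (s + 2 * s ^ 2)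
    refine le_trans ?_ h4
    rw [div_le_iff₀ hq]
    nlinarith [mul_nonneg (sq_nonneg s) (by linarith : 0 ≤ 1 / 2 - s)]
  calc (1 / (1 - s)) ^ n * Real.exp (lam * -s) ≤ Real.exp (s + 2 * s ^ 2) ^ n * Real.exp (lam * -s) := by
        gcongr
    _ = _ := by rw [← Real.exp_nat_mul, ← Real.exp_add]; ring_nf

theorem poissonMeasure_real_Ioi_le (lam : ℝ≥0) (n : ℕ) {s : ℝ} (h0 : 0 ≤ s) :
    (poissonMeasure lam).real (Set.Ioi n) ≤ Real.exp (lam * s - n * (s - s ^ 2)) := by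
  have hq : 0 < 1 + s := by linarith
  obtain ⟨hi, he⟩ := integral_pow_poissonMeasure lam hq.le
  have h2 : (poissonMeasure lam).real (Set.Ioi n) ≤
      ∫ k, (1 / (1 + s)) ^ n * (1 + s) ^ k ∂poissonMeasure lam := by
    have : ∫ k, Set.indicator (Set.Ioi n) (fun _ => (1 : ℝ)) k ∂poissonMeasure lam
        = (poissonMeasure lam).real (Set.Ioi n) := by
      rw [integral_indicator_const _ MeasurableSet.of_discrete]; simp
    rw [← this]
    refine integral_mono ((integrable_const _).indicator MeasurableSet.of_discrete)
      (hi.const_mul _) fun k => ?_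
    by_cases hk : n < k
    · simp only
      rw [Set.indicator_of_mem (Set.mem_Ioi.2 hk), one_div, inv_pow, ← div_eq_inv_mul,
        one_le_div (by positivity)]
      exact pow_le_pow_right₀ (by linarith) hk.le
    · simp only
      rw [Set.indicator_of_notMem (by simpa using hk)]
      positivity
  refine h2.trans ?_
  rw [integral_const_mul, he, add_sub_cancel_left]
  have h3 : 1 / (1 + s) ≤ Real.exp (-(s - s ^ 2)) := by
    have h4 := Real.add_one_le_exp (-(s - s ^ 2))
    refine le_trans ?_ h4
    rw [div_le_iff₀ hq]
    nlinarith [pow_nonneg h0 3]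
  calc (1 / (1 + s)) ^ n * Real.exp (lam * s) ≤ Real.exp (-(s - s ^ 2)) ^ n * Real.exp (lam * s) := by
        gcongr
    _ = _ := by rw [← Real.exp_nat_mul, ← Real.exp_add]; ring_nf

/-- The Laplace transform of `1 / Y` after `n` elements. -/
noncomputable def laplaceN (m n : ℕ) (t : ℝ) : ℝ :=
  ∫ l, Real.exp (-(t * invY l)) ∂listLaw m n

theorem laplaceN_nonneg {m : ℕ} (n : ℕ) (t : ℝ) : 0 ≤ laplaceN m n t :=
  integral_nonneg fun _ => (Real.exp_pos _).le

section FixedCount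

variable {m : ℕ} [NeZero m]

theorem invY_pos' (l : List (Fin m × ℕ)) : 0 < invY l :=
  invY_pos (Nat.pos_of_ne_zero (NeZero.ne m)) l

theorem integrable_exp_invY {P : Measure (List (Fin m × ℕ))} [IsProbabilityMeasure P] {t : ℝ}
    (ht : 0 ≤ t) : Integrable (fun l => Real.exp (-(t * invY l))) P :=
  integrable_exp_neg Measurable.of_discrete invY_pos' ht

theorem laplaceN_le_one (n : ℕ) {t : ℝ} (ht : 0 ≤ t) : laplaceN m n t ≤ 1 := by
  calc laplaceN m n t ≤ ∫ _l, (1 : ℝ) ∂listLaw m n := by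
        refine integral_mono (integrable_exp_invY ht) (integrable_const 1) fun l => ?_
        rw [Real.exp_le_one_iff]
        have := mul_nonneg ht (invY_pos' l).le
        linarith
    _ = 1 := by simp

/-- Dropping the last hash value preserves the product measure, and adding it does not increase 1/Y
pointwise. -/
theorem laplaceN_le_succ (n : ℕ) {t : ℝ} (ht : 0 ≤ t) :
    laplaceN m n t ≤ laplaceN m (n + 1) t := by
  have hmp : MeasurePreserving (fun (h : Fin (n + 1) → Fin m × ℕ) (i : Fin n) => h i.castSucc)
      (Measure.pi fun _ => hashLaw m) (Measure.pi fun _ => hashLaw m) := by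
    have h1 := measurePreserving_piFinSuccAbove (fun _ : Fin (n + 1) => hashLaw m) (Fin.last n)
    have h2 := (measurePreserving_snd (μ := hashLaw m)
      (ν := Measure.pi fun _ : Fin n => hashLaw m)).comp h1
    convert! h2 using 1
    funext h i
    simp [MeasurableEquiv.piFinSuccAbove, Fin.insertNthEquiv, Fin.init]
  have e : ∀ n, laplaceN m n t = ∫ h, Real.exp (-(t * invY (List.ofFn h)))
      ∂(Measure.pi fun _ : Fin n => hashLaw m) := by
    intro n
    rw [laplaceN, listLaw, integral_map Measurable.of_discrete.aemeasurable
      Measurable.of_discrete.aestronglyMeasurable]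
  have hi : ∀ n, Integrable (fun h => Real.exp (-(t * invY (List.ofFn h))))
      (Measure.pi fun _ : Fin n => hashLaw m) := fun n =>
    integrable_exp_neg Measurable.of_discrete (fun h => invY_pos' _) ht
  rw [e, e, ← hmp.map_eq, integral_map Measurable.of_discrete.aemeasurable
    Measurable.of_discrete.aestronglyMeasurable]
  refine integral_mono ?_ (hi (n + 1)) fun h => ?_
  · exact integrable_exp_neg (S := fun h : Fin (n + 1) → Fin m × ℕ =>
      invY (List.ofFn fun i : Fin n => h i.castSucc)) Measurable.of_discrete (fun h => invY_pos' _) ht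
  · simp only
    rw [Real.exp_le_exp, List.ofFn_succ_last]
    have := mul_le_mul_of_nonneg_left (invY_concat_le (List.ofFn fun i : Fin n => h i.castSucc)
      (h (Fin.last n))) ht
    linarith

theorem monotone_laplaceN {t : ℝ} (ht : 0 ≤ t) : Monotone fun n => laplaceN m n t :=
  monotone_nat_of_le_succ fun n => laplaceN_le_succ n ht

theorem integrable_laplaceN {t : ℝ} (ht : 0 ≤ t) (lam : ℝ≥0) :
    Integrable (fun n => laplaceN m n t) (poissonMeasure lam) := by
  refine Integrable.of_bound Measurable.of_discrete.aestronglyMeasurable 1 (ae_of_all _ fun n => ?_)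
  rw [Real.norm_of_nonneg (laplaceN_nonneg n t)]
  exact laplaceN_le_one n ht

theorem integral_laplaceN_poisson {t : ℝ} (ht : 0 ≤ t) (x : ℝ≥0) :
    ∫ n, laplaceN m n t ∂poissonMeasure (m * x) = rowLaplace x t ^ m := by
  rw [← integral_exp_invY_poisson x ht,
    integral_eq_lintegral_of_nonneg_ae (ae_of_all _ fun n => laplaceN_nonneg n t)
      Measurable.of_discrete.aestronglyMeasurable,
    integral_eq_lintegral_of_nonneg_ae (ae_of_all _ fun l => (Real.exp_pos _).le)
      Measurable.of_discrete.aestronglyMeasurable, poissonListLaw,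
    Measure.lintegral_bind Measurable.of_discrete.aemeasurable Measurable.of_discrete.aemeasurable]
  congr 1
  refine lintegral_congr fun n => ?_
  rw [laplaceN, ofReal_integral_eq_lintegral_ofReal (integrable_exp_invY ht)
    (ae_of_all _ fun l => (Real.exp_pos _).le)]

/-- In the Poisson average the terms with at least n elements are each no smaller than the n-th, by
monotonicity. The companion bound uses the terms with at most n elements and estimates the others by
1. -/
theorem laplaceN_mul_le {t : ℝ} (ht : 0 ≤ t) (x : ℝ≥0) (n : ℕ) :
    laplaceN m n t * (poissonMeasure (m * x)).real (Set.Ici n) ≤ rowLaplace x t ^ m := by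
  rw [← integral_laplaceN_poisson ht x]
  have h1 : ∫ k, Set.indicator (Set.Ici n) (fun _ => laplaceN m n t) k ∂poissonMeasure (m * x)
      = laplaceN m n t * (poissonMeasure (m * x)).real (Set.Ici n) := by
    rw [integral_indicator_const _ MeasurableSet.of_discrete, smul_eq_mul, mul_comm]
  rw [← h1]
  refine integral_mono ((integrable_const _).indicator MeasurableSet.of_discrete)
    (integrable_laplaceN ht _) fun k => ?_
  by_cases hk : n ≤ k
  · rw [Set.indicator_of_mem (Set.mem_Ici.2 hk)]
    exact monotone_laplaceN ht hk
  · rw [Set.indicator_of_notMem (by simpa using hk)]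
    exact laplaceN_nonneg k t

theorem rowLaplace_pow_le {t : ℝ} (ht : 0 ≤ t) (x : ℝ≥0) (n : ℕ) :
    rowLaplace x t ^ m ≤ laplaceN m n t + (poissonMeasure (m * x)).real (Set.Ioi n) := by
  rw [← integral_laplaceN_poisson ht x]
  have h1 : ∫ k, (laplaceN m n t + Set.indicator (Set.Ioi n) (fun _ => (1 : ℝ)) k)
      ∂poissonMeasure (m * x) = laplaceN m n t + (poissonMeasure (m * x)).real (Set.Ioi n) := by
    rw [integral_add (integrable_const _) ((integrable_const _).indicator MeasurableSet.of_discrete),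
      integral_indicator_const _ MeasurableSet.of_discrete]
    simp
  rw [← h1]
  refine integral_mono (integrable_laplaceN ht _)
    ((integrable_const _).add ((integrable_const _).indicator MeasurableSet.of_discrete)) fun k => ?_
  by_cases hk : n < k
  · simp only
    rw [Set.indicator_of_mem (Set.mem_Ioi.2 hk)]
    linarith [laplaceN_le_one (m := m) k ht, laplaceN_nonneg (m := m) n t]
  · simp only
    rw [Set.indicator_of_notMem (by simpa using hk), add_zero]
    exact monotone_laplaceN ht (not_lt.1 hk)

end FixedCount

theorem pow_le_cubic {g C u : ℝ} (hg : 0 ≤ g) (hC : 0 ≤ C) (hu : 0 ≤ u) (h : g ≤ C / (1 + u)) {m : ℕ}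
    (hm : 3 ≤ m) : g ^ m ≤ C ^ m / (1 + u) ^ 3 := by
  calc g ^ m ≤ (C / (1 + u)) ^ m := pow_le_pow_left₀ hg h m
    _ = C ^ m / (1 + u) ^ m := div_pow _ _ _
    _ ≤ C ^ m / (1 + u) ^ 3 := by
        gcongr
        linarith

theorem CubicDecay.mono {H : ℝ → ℝ} {C C' : ℝ} (h : CubicDecay H C) (hC : C ≤ C') :
    CubicDecay H C' where
  meas := h.meas
  nonneg := h.nonneg
  le u hu := (h.le u hu).trans (by gcongr)

theorem cubicDecay_profile {x : ℝ} (hx : 0 < x) {m : ℕ} (hm : 3 ≤ m) :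
    CubicDecay (fun u => profile x u ^ m) (2 ^ m) where
  meas := (measurable_profile hx).pow m
  nonneg u _ := pow_nonneg (profile_nonneg hx u) m
  le u hu := by
    refine pow_le_cubic (profile_nonneg hx u) zero_le_two hu.le ?_ hm
    refine ((majorised_profile hx).le u hu).trans ?_
    rw [div_le_div_iff₀ (by positivity) (by positivity)]; linarith

section Laws

variable {m : ℕ} [NeZero m]

theorem cubicDecay_poisson {x : ℝ≥0} (hx : 0 < x) (hm : 3 ≤ m) :
    CubicDecay (fun u => ∫ l, Real.exp (-(x * u * invY l)) ∂poissonListLaw m (m * x))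
      ((2 + 4 / x) ^ m) where
  meas := ((measurable_laplace Measurable.of_discrete).comp
    (measurable_const_mul (x : ℝ))).aestronglyMeasurable
  nonneg u _ := integral_nonneg fun _ => (Real.exp_pos _).le
  le u hu := by
    have hC : (0 : ℝ) ≤ 2 + 4 / x := by positivity
    refine (integral_exp_invY_poisson (m := m) x (t := x * u)
      (mul_nonneg x.coe_nonneg hu.le)).le.trans ?_
    exact pow_le_cubic (rowLaplace_nonneg x.coe_nonneg) hC hu.le
      (rowLaplace_le (NNReal.coe_pos.2 hx) hu) hm

/-- Any positive Poisson mean gives {n, n + 1, …} positive mass, so Poisson decay passes to every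
fixed n, with a constant that depends on n. -/
theorem cubicDecay_laplaceN {x : ℝ≥0} (hx : 0 < x) (hm : 3 ≤ m) (n : ℕ) :
    CubicDecay (fun u => laplaceN m n (x * u))
      ((2 + 4 / x) ^ m / (poissonMeasure (m * x)).real (Set.Ici n)) where
  meas := ((measurable_laplace Measurable.of_discrete).comp
    (measurable_const_mul (x : ℝ))).aestronglyMeasurable
  nonneg u _ := laplaceN_nonneg n _
  le u hu := by
    have hm0 : (0 : ℝ≥0) < m := by exact_mod_cast (show 0 < m by omega)
    have hP : 0 < (poissonMeasure (m * x)).real (Set.Ici n) :=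
      (poissonMeasure_real_singleton_pos n (mul_pos hm0 hx)).trans_le
        (measureReal_mono (by simp))
    have h := laplaceN_mul_le (m := m) (t := x * u) (mul_nonneg x.2 hu.le) x n
    rw [div_right_comm, le_div_iff₀ hP]
    have hC : (0 : ℝ) ≤ 2 + 4 / x := by positivity
    exact h.trans (pow_le_cubic (rowLaplace_nonneg x.coe_nonneg) hC hu.le
      (rowLaplace_le (NNReal.coe_pos.2 hx) hu) hm)

theorem variance_lawY {x : ℝ≥0} (hx : 0 < x) (hm : 3 ≤ m) (n : ℕ) :
    MemLp id 2 (lawY m n) ∧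
      variance id (lawY m n) = x ^ 2 * varLap fun u => laplaceN m n (x * u) := by
  have h := variance_inv_of_laplace (P := listLaw m n) Measurable.of_discrete invY_pos'
    (NNReal.coe_pos.2 hx) (cubicDecay_laplaceN hx hm n)
  rw [lawY_eq_map, variance_id_map Measurable.of_discrete.aemeasurable,
    memLp_map_measure_iff aestronglyMeasurable_id Measurable.of_discrete.aemeasurable]
  exact h

theorem variance_poissonLawY {x : ℝ≥0} (hx : 0 < x) (hm : 3 ≤ m) :
    MemLp id 2 (poissonLawY m (m * x)) ∧ variance id (poissonLawY m (m * x)) = x ^ 2 *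
      varLap fun u => ∫ l, Real.exp (-(x * u * invY l)) ∂poissonListLaw m (m * x) := by
  have h := variance_inv_of_laplace (P := poissonListLaw m (m * x)) Measurable.of_discrete invY_pos'
    (NNReal.coe_pos.2 hx) (cubicDecay_poisson hx hm)
  rw [poissonLawY_eq_map, variance_id_map Measurable.of_discrete.aemeasurable,
    memLp_map_measure_iff aestronglyMeasurable_id Measurable.of_discrete.aemeasurable]
  exact h

theorem rowLaplace_zero (t : ℝ) : rowLaplace 0 t = Real.exp (-t) := by
  rw [rowLaplace, tsum_eq_single 0]
  · simp [rowProb]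
  · intro k hk
    match k with
    | 0 => exact absurd rfl hk
    | 1 => simp [rowProb]
    | k + 2 => simp [rowProb, rowWeight]

/-- Mean 0 is excluded by the scaling t = xu and is treated with scale 1: the sketch is then the
initial one and the row transform is e^(-t). -/
theorem memLp_poissonLawY (hm : 3 ≤ m) (x : ℝ≥0) : MemLp id 2 (poissonLawY m (m * x)) := by
  rcases eq_or_ne x 0 with rfl | hx
  · have hc : CubicDecay (fun u => ∫ l, Real.exp (-(1 * u * invY l)) ∂poissonListLaw m (m * 0))
        (1 ^ m) := by
      refine ⟨((measurable_laplace Measurable.of_discrete).comp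
        (measurable_const_mul (1 : ℝ))).aestronglyMeasurable,
        fun u _ => integral_nonneg fun _ => (Real.exp_pos _).le, fun u hu => ?_⟩
      rw [integral_exp_invY_poisson 0 (by positivity), NNReal.coe_zero, rowLaplace_zero, one_mul]
      refine pow_le_cubic (Real.exp_pos _).le zero_le_one hu.le ?_ hm
      rw [Real.exp_neg, one_div]
      gcongr
      linarith [Real.add_one_le_exp u]
    have h := variance_inv_of_laplace (P := poissonListLaw m (m * 0)) Measurable.of_discrete
      invY_pos' one_pos hc
    rw [poissonLawY_eq_map, memLp_map_measure_iff aestronglyMeasurable_id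
      Measurable.of_discrete.aemeasurable]
    exact h.1
  · exact (variance_poissonLawY (pos_iff_ne_zero.2 hx) hm).1

theorem tendsto_pow_sub_pow {ι : Type*} {l : Filter ι} {a b : ι → ℝ} {C : ℝ} (n : ℕ)
    (ha : ∀ᶠ i in l, 0 ≤ a i ∧ a i ≤ C) (hb : ∀ᶠ i in l, 0 ≤ b i ∧ b i ≤ C)
    (h : Tendsto (fun i => a i - b i) l (𝓝 0)) :
    Tendsto (fun i => a i ^ n - b i ^ n) l (𝓝 0) := by
  rcases n with _ | n
  · simpa using tendsto_const_nhds
  refine squeeze_zero_norm' (a := fun i => (n + 1) * C ^ n * |a i - b i|) ?_ ?_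
  · filter_upwards [ha, hb] with i h1 h2
    exact abs_pow_sub_pow_le_of_le h1.1 h2.1 h1.2 h2.2 n
  · simpa using h.abs.const_mul ((n + 1) * C ^ n)

theorem profile_le_two {x u : ℝ} (hx : 0 < x) (hu : 0 < u) : profile x u ≤ 2 := by
  refine ((majorised_profile hx).le u hu).trans ?_
  rw [div_le_iff₀ (by positivity)]; linarith

theorem tendsto_varLap_poisson (hm : 3 ≤ m) :
    Tendsto (fun x : ℝ≥0 => varLap (fun u => ∫ l, Real.exp (-(x * u * invY l))
      ∂poissonListLaw m (m * x)) - varFun (profile x) m) atTop (𝓝 0) := by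
  have h26 : (2 : ℝ) ^ m ≤ 6 ^ m := by gcongr; norm_num
  have hev : ∀ᶠ x : ℝ≥0 in atTop, (1 : ℝ≥0) ≤ x := eventually_ge_atTop 1
  have hT : Tendsto (fun x : ℝ≥0 => (x : ℝ)) atTop atTop := NNReal.tendsto_coe_atTop.2 tendsto_id
  have hexp : Tendsto (fun x : ℝ≥0 => Real.exp (-((x : ℝ) / 2))) atTop (𝓝 0) :=
    Real.tendsto_exp_neg_atTop_nhds_zero.comp (hT.atTop_div_const two_pos)
  refine tendsto_varLap_sub (C := 6 ^ m) (K := fun (x : ℝ≥0) u => profile x u ^ m) ?_ ?_ ?_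
  · filter_upwards [hev] with x hx
    have hx0 : 0 < x := lt_of_lt_of_le one_pos hx
    refine (cubicDecay_poisson hx0 hm).mono ?_
    have : (1 : ℝ) ≤ x := by exact_mod_cast hx
    gcongr
    have : 4 / (x : ℝ) ≤ 4 := div_le_self (by norm_num) this
    linarith
  · filter_upwards [hev] with x hx
    have hx0 : 0 < x := lt_of_lt_of_le one_pos hx
    exact (cubicDecay_profile (NNReal.coe_pos.2 hx0) hm).mono h26
  · intro u hu
    have h1 : ∀ x : ℝ≥0, ∫ l, Real.exp (-(x * u * invY l)) ∂poissonListLaw m (m * x)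
        = rowLaplace x (x * u) ^ m := fun x => integral_exp_invY_poisson x (by positivity)
    simp_rw [h1]
    refine tendsto_pow_sub_pow (C := 6) m ?_ ?_ ?_
    · filter_upwards [hev] with x hx
      have hx0 : (0 : ℝ) < x := NNReal.coe_pos.2 (lt_of_lt_of_le one_pos hx)
      have hx1 : (1 : ℝ) ≤ x := by exact_mod_cast hx
      refine ⟨rowLaplace_nonneg hx0.le, (rowLaplace_le hx0 hu).trans ?_⟩
      have : 4 / (x : ℝ) ≤ 4 := div_le_self (by norm_num) hx1
      rw [div_le_iff₀ (by positivity)]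
      linarith
    · filter_upwards [hev] with x hx
      have hx0 : (0 : ℝ) < x := NNReal.coe_pos.2 (lt_of_lt_of_le one_pos hx)
      exact ⟨profile_nonneg hx0 u, (profile_le_two hx0 hu).trans (by norm_num)⟩
    · refine squeeze_zero_norm' ?_ hexp
      filter_upwards [hev] with x hx
      have hx0 : (0 : ℝ) < x := NNReal.coe_pos.2 (lt_of_lt_of_le one_pos hx)
      exact abs_rowLaplace_sub_profile_le hx0 hu.le

end Laws

/-- A window width for the comparison of a fixed and a Poisson number of elements. -/
noncomputable def window (n : ℕ) : ℝ≥0 := (NNReal.sqrt (NNReal.sqrt n))⁻¹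

/-- The window is n^(-1/4): a vanishing relative change of the mean that still exceeds the Poisson
fluctuations n^(-1/2). -/
theorem tendsto_window : Tendsto (fun n => (window n : ℝ)) atTop (𝓝 0) ∧
    Tendsto (fun n : ℕ => n * (window n : ℝ) ^ 2) atTop atTop := by
  have h1 : Tendsto (fun n : ℕ => √(n : ℝ)) atTop atTop :=
    Real.tendsto_sqrt_atTop.comp tendsto_natCast_atTop_atTop
  have e : ∀ n : ℕ, (window n : ℝ) = (√(√(n : ℝ)))⁻¹ := fun n => by simp [window]
  constructor
  · simp_rw [e]
    exact tendsto_inv_atTop_zero.comp (Real.tendsto_sqrt_atTop.comp h1)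
  · refine h1.congr fun n => ?_
    rw [e, inv_pow, Real.sq_sqrt (Real.sqrt_nonneg _), ← div_eq_mul_inv, Real.div_sqrt]

theorem tendsto_poissonMeasure_Ici :
    Tendsto (fun n : ℕ => (poissonMeasure (n * (1 + window n))).real (Set.Ici n)) atTop (𝓝 1) := by
  obtain ⟨h0, h1⟩ := tendsto_window
  have h2 : Tendsto (fun n : ℕ => (poissonMeasure (n * (1 + window n))).real (Set.Iio n)) atTop
      (𝓝 0) := by
    refine squeeze_zero' (Eventually.of_forall fun n => measureReal_nonneg)
      (g := fun n : ℕ => Real.exp (-(n * (window n : ℝ) ^ 2 / 8))) ?_ ?_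
    · filter_upwards [h0.eventually_le_const zero_lt_one] with n hn
      have hw : (0 : ℝ) ≤ window n := (window n).2
      refine (poissonMeasure_real_Iio_le _ n (s := window n / 4) (by positivity)
        (by linarith)).trans (Real.exp_le_exp.2 (le_of_eq ?_))
      push_cast
      ring
    · exact Real.tendsto_exp_neg_atTop_nhds_zero.comp (h1.atTop_div_const (by norm_num))
  have h3 := h2.const_sub 1
  rw [sub_zero] at h3
  refine h3.congr fun n => ?_
  rw [← Set.compl_Iio, probReal_compl_eq_one_sub measurableSet_Iio]

theorem tendsto_poissonMeasure_Ioi :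
    Tendsto (fun n : ℕ => (poissonMeasure (n / (1 + window n))).real (Set.Ioi n)) atTop (𝓝 0) := by
  obtain ⟨h0, h1⟩ := tendsto_window
  refine squeeze_zero' (Eventually.of_forall fun n => measureReal_nonneg)
    (g := fun n : ℕ => Real.exp (-(n * (window n : ℝ) ^ 2 / 16))) ?_ ?_
  · filter_upwards [h0.eventually_le_const zero_lt_one] with n hn
    have hw : (0 : ℝ) ≤ window n := (window n).2
    refine (poissonMeasure_real_Ioi_le _ n (s := window n / 4) (by positivity)).trans
      (Real.exp_le_exp.2 ?_)
    push_cast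
    set w : ℝ := (window n : ℝ)
    have h2 : 1 / (1 + w) ≤ 1 - w / 2 := by
      rw [div_le_iff₀ (by positivity)]; nlinarith
    have h3 : (n : ℝ) * (w / 4) * (1 / (1 + w)) ≤ n * (w / 4) * (1 - w / 2) := by gcongr
    have e : (n : ℝ) / (1 + w) * (w / 4) = n * (w / 4) * (1 / (1 + w)) := by ring
    rw [e]
    nlinarith
  · exact Real.tendsto_exp_neg_atTop_nhds_zero.comp (h1.atTop_div_const (by norm_num))

theorem rowLaplace_le_six {x u : ℝ} (hx : 1 ≤ x) (hu : 0 < u) : rowLaplace x (x * u) ≤ 6 := by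
  refine (rowLaplace_le (zero_lt_one.trans_le hx) hu).trans ?_
  have : 4 / x ≤ 4 := div_le_self (by norm_num) hx
  rw [div_le_iff₀ (by positivity)]
  linarith

section Laws

variable {m : ℕ} [NeZero m]

/-- A domination uniform in n: the comparison mean is dilated by k so that its upper tail has mass
at least 1/2. The constant 16 is 2 for this mass times 8 for replacing 1 + u/k by (1 + u)/2. -/
theorem cubicDecay_laplaceN_of_dilate {x k : ℝ≥0} (hm : 3 ≤ m) (n : ℕ) (hk : 1 ≤ k) (hk2 : k ≤ 2)
    (hx : 1 ≤ k * x) (hp : 1 / 2 ≤ (poissonMeasure (m * (k * x))).real (Set.Ici n)) :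
    CubicDecay (fun u => laplaceN m n (x * u)) (16 * 6 ^ m) where
  meas := ((measurable_laplace Measurable.of_discrete).comp
    (measurable_const_mul (x : ℝ))).aestronglyMeasurable
  nonneg u _ := laplaceN_nonneg n _
  le u hu := by
    have hk0 : (0 : ℝ) < k := NNReal.coe_pos.2 (one_pos.trans_le hk)
    have hk1 : (1 : ℝ) ≤ k := by exact_mod_cast hk
    have hk2' : (k : ℝ) ≤ 2 := by exact_mod_cast hk2
    have hx1 : (1 : ℝ) ≤ k * x := by exact_mod_cast hx
    have h := (cubicDecay_laplaceN (one_pos.trans_le hx) hm n).le (u / k) (by positivity)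
    have e : ((k * x : ℝ≥0) : ℝ) * (u / k) = x * u := by
      push_cast
      field_simp
    rw [e] at h
    refine h.trans ?_
    have h4 : 4 / ((k * x : ℝ≥0) : ℝ) ≤ 4 := div_le_self (by norm_num) (by push_cast; exact hx1)
    have h5 : (2 + 4 / ((k * x : ℝ≥0) : ℝ)) ^ m / (poissonMeasure (m * (k * x))).real (Set.Ici n)
        ≤ 2 * 6 ^ m := by
      rw [div_le_iff₀ (by linarith)]
      have : (2 + 4 / ((k * x : ℝ≥0) : ℝ)) ^ m ≤ 6 ^ m := by gcongr; linarith
      nlinarith [pow_pos (show (0 : ℝ) < 6 by norm_num) m]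
    have h6 : (1 + u) / 2 ≤ 1 + u / k := by
      have : u / 2 ≤ u / k := by gcongr
      linarith
    calc _ ≤ 2 * 6 ^ m / ((1 + u) / 2) ^ 3 := by gcongr
      _ = 16 * 6 ^ m / (1 + u) ^ 3 := by field_simp; norm_num

/-- Pointwise in u, the transform after n elements is squeezed between Poisson transforms with means
n/(1 + w) and n(1 + w), where w is the window. Both approach the profile at scale n/m, by
exponential closeness and log-Lipschitz dependence on the mean. -/
theorem tendsto_varLap_fixed (hm : 3 ≤ m) :
    Tendsto (fun n : ℕ => varLap (fun u => laplaceN m n (((n / m : ℝ≥0) : ℝ) * u))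
      - varFun (profile (n / m)) m) atTop (𝓝 0) := by
  have hm0 : (0 : ℝ≥0) < m := by exact_mod_cast (show 0 < m by omega)
  have hmr : (0 : ℝ) < m := by exact_mod_cast hm0
  obtain ⟨hw, -⟩ := tendsto_window
  have hp := tendsto_poissonMeasure_Ici
  have hq := tendsto_poissonMeasure_Ioi
  have ep : ∀ n : ℕ, (n : ℝ≥0) * (1 + window n) = m * ((1 + window n) * (n / m)) := fun n => by
    field_simp
  have eq : ∀ n : ℕ, (n : ℝ≥0) / (1 + window n) = m * (n / m / (1 + window n)) := fun n => by
    field_simp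
  simp_rw [ep] at hp
  simp_rw [eq] at hq
  have hx : Tendsto (fun n : ℕ => (n : ℝ) / m) atTop atTop :=
    tendsto_natCast_atTop_atTop.atTop_div_const hmr
  have hk1 : ∀ n, (1 : ℝ) ≤ 1 + window n := fun n => le_add_of_nonneg_right (window n).coe_nonneg
  have hk2 : ∀ᶠ n in atTop, (1 : ℝ) + window n ≤ 2 := by
    filter_upwards [hw.eventually_le_const one_pos] with n hn
    linarith
  have hx2 : ∀ᶠ n : ℕ in atTop, (2 : ℝ) ≤ n / m := hx.eventually_ge_atTop 2
  have hlog : Tendsto (fun n => 12 * Real.log (1 + window n)) atTop (𝓝 0) := by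
    have h1 : Tendsto (fun n => (1 : ℝ) + window n) atTop (𝓝 1) := by
      simpa using hw.const_add 1
    simpa using (((Real.continuousAt_log one_ne_zero).tendsto.comp h1).const_mul 12)
  have hexp : Tendsto (fun n : ℕ => Real.exp (-((n : ℝ) / m / 4))) atTop (𝓝 0) :=
    Real.tendsto_exp_neg_atTop_nhds_zero.comp (hx.atTop_div_const (by norm_num))
  have herr := hexp.add hlog
  rw [add_zero] at herr
  refine tendsto_varLap_sub (C := 16 * 6 ^ m) (K := fun (n : ℕ) u => profile (n / m) u ^ m)
    ?_ ?_ ?_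
  · filter_upwards [hk2, hx2, hp.eventually_const_le (show (1 / 2 : ℝ) < 1 by norm_num)]
      with n h1 h2 h3
    refine cubicDecay_laplaceN_of_dilate hm n (k := 1 + window n) (by simp) ?_ ?_ h3
    · exact_mod_cast h1
    · rw [← NNReal.coe_le_coe]
      push_cast
      nlinarith [hk1 n]
  · filter_upwards [hx2] with n h2
    refine (cubicDecay_profile (by linarith) hm).mono ?_
    have : (2 : ℝ) ^ m ≤ 6 ^ m := by gcongr; norm_num
    linarith [pow_pos (show (0 : ℝ) < 6 by norm_num) m]
  · intro u hu
    have hprof : ∀ᶠ n : ℕ in atTop,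
        0 ≤ profile ((n : ℝ) / m) u ∧ profile ((n : ℝ) / m) u ≤ 6 := by
      filter_upwards [hx2] with n h2
      have : (0 : ℝ) < n / m := by linarith
      exact ⟨profile_nonneg this u, (profile_le_two this hu).trans (by norm_num)⟩
    have hA : ∀ᶠ n : ℕ in atTop,
        0 ≤ rowLaplace ((1 + window n) * (n / m)) (n / m * u) ∧
        rowLaplace ((1 + window n) * (n / m)) (n / m * u) ≤ 6 ∧
        |rowLaplace ((1 + window n) * (n / m)) (n / m * u) - profile (n / m) u|
          ≤ Real.exp (-((n : ℝ) / m / 4)) + 12 * Real.log (1 + window n) := by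
      filter_upwards [hx2] with n h2
      have hk := hk1 n
      generalize (1 : ℝ) + window n = k at hk ⊢
      generalize (n : ℝ) / m = x at h2 ⊢
      have hxx : x ≤ k * x := by nlinarith
      have e : x * u = k * x * (u / k) := by field_simp
      have hu' : 0 < u / k := by positivity
      rw [e]
      refine ⟨rowLaplace_nonneg (by linarith), rowLaplace_le_six (by linarith) hu', ?_⟩
      have h3 := abs_rowLaplace_sub_profile_le (x := k * x) (by linarith) hu'.le
      have h4 := abs_profile_dilate_sub_le (x := x) (by linarith) hu.le hk
      have h5 : Real.exp (-(k * x / 2)) ≤ Real.exp (-(x / 4)) :=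
        Real.exp_le_exp.2 (by linarith)
      exact (abs_sub_le _ (profile (k * x) (u / k)) _).trans (by linarith)
    have hB : ∀ᶠ n : ℕ in atTop,
        0 ≤ rowLaplace (n / m / (1 + window n)) (n / m * u) ∧
        rowLaplace (n / m / (1 + window n)) (n / m * u) ≤ 6 ∧
        |rowLaplace (n / m / (1 + window n)) (n / m * u) - profile (n / m) u|
          ≤ Real.exp (-((n : ℝ) / m / 4)) + 12 * Real.log (1 + window n) := by
      filter_upwards [hx2, hk2] with n h2 hk'
      have hk := hk1 n
      generalize (1 : ℝ) + window n = k at hk hk' ⊢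
      generalize (n : ℝ) / m = x at h2 ⊢
      have hxx : x / 2 ≤ x / k := by gcongr
      have e : x * u = x / k * (k * u) := by field_simp
      have hu' : 0 < k * u := by positivity
      rw [e]
      refine ⟨rowLaplace_nonneg (by linarith), rowLaplace_le_six (by linarith) hu', ?_⟩
      have h3 := abs_rowLaplace_sub_profile_le (x := x / k) (by linarith) hu'.le
      have h4 := abs_profile_dilate_sub_le (x := x / k) (by linarith) hu'.le hk
      rw [mul_div_cancel₀ x (by linarith), mul_div_cancel_left₀ u (by linarith), abs_sub_comm] at h4
      have h5 : Real.exp (-(x / k / 2)) ≤ Real.exp (-(x / 4)) :=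
        Real.exp_le_exp.2 (by linarith)
      exact (abs_sub_le _ (profile (x / k) (k * u)) _).trans (by linarith)
    have tA := tendsto_pow_sub_pow m (hA.mono fun _ h => ⟨h.1, h.2.1⟩) hprof
      (squeeze_zero_norm' (hA.mono fun _ h => h.2.2) herr)
    have tB := tendsto_pow_sub_pow m (hB.mono fun _ h => ⟨h.1, h.2.1⟩) hprof
      (squeeze_zero_norm' (hB.mono fun _ h => h.2.2) herr)
    have hL : ∀ n : ℕ, 0 ≤ ((n / m : ℝ≥0) : ℝ) * u := fun n => by positivity
    have tq := tB.sub hq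
    have tp := tA.add (hp.const_sub 1)
    rw [sub_zero] at tq
    rw [sub_self, add_zero] at tp
    refine tendsto_of_tendsto_of_tendsto_of_le_of_le tq tp (fun n => ?_) (fun n => ?_)
    · have := rowLaplace_pow_le (m := m) (hL n) (n / m / (1 + window n)) n
      push_cast at this ⊢
      linarith
    · have h1 := laplaceN_mul_le (m := m) (hL n) ((1 + window n) * (n / m)) n
      -- With L the transform and p the upper-tail mass, (1 - L)(1 - p) ≥ 0 turns the bound on Lp
      -- into the same bound on L plus 1 - p, avoiding a division.
      have h2 : (1 - laplaceN m n (((n / m : ℝ≥0) : ℝ) * u)) *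
          (1 - (poissonMeasure (m * ((1 + window n) * (n / m)))).real (Set.Ici n)) ≥ 0 :=
        mul_nonneg (sub_nonneg.2 (laplaceN_le_one n (hL n)))
          (sub_nonneg.2 measureReal_le_one)
      push_cast at h1 h2 ⊢
      linarith

end Laws

/-! ### Assembling the variance statements -/

theorem I₀_pos {m : ℕ} (hm : 3 ≤ m) : 0 < I₀ m := by
  obtain ⟨p, rfl⟩ := Nat.exists_eq_add_of_le' hm
  exact lt_of_lt_of_le (by positivity) (le_I₀ p)

theorem exists_variance_poissonLawY {m : ℕ} (hm : 3 ≤ m) : ∃ ε o : ℝ≥0 → ℝ,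
    (∀ x, |ε x| ≤ 8.4e-5) ∧ Tendsto o atTop (𝓝 0) ∧
    ∀ x : ℝ≥0, 0 < x → variance id (poissonLawY m (m * x)) =
      (x : ℝ) ^ 2 * ((∫ u in Set.Ioi (0 : ℝ), u * f u ^ m)
        - (∫ u in Set.Ioi (0 : ℝ), f u ^ m) ^ 2 + ε x / m + o x) := by
  have : NeZero m := ⟨by omega⟩
  have hmr : (0 : ℝ) < m := by exact_mod_cast (show 0 < m by omega)
  refine ⟨fun x => if 0 < x then m * (varFun (profile x) m - varFun f m) else 0, _, fun x => ?_,
    tendsto_varLap_poisson hm, fun x hx => ?_⟩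
  · dsimp only
    split_ifs with hx
    · have h := (abs_varFun_profile_sub_le (NNReal.coe_pos.2 hx) hm).1
      rwa [abs_mul, abs_of_pos hmr, mul_comm, ← le_div_iff₀ hmr]
    · norm_num
  · dsimp only
    rw [(variance_poissonLawY hx hm).2, if_pos hx, mul_div_cancel_left₀ _ hmr.ne']
    change _ = _ * (varFun f m + _ + _)
    ring

/-- With scale x = n/m the prefactor γ_m² m⁴ x²/n² equals 1/I₀². Dividing the variance functional by
I₀² produces β_m/m, and the bound proportional to I₀² becomes the bound on ε'. -/
theorem exists_variance_lawY {m : ℕ} (hm : 3 ≤ m) : ∃ ε o : ℕ → ℝ,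
    (∀ n, |ε n| ≤ 1e-3) ∧ Tendsto o atTop (𝓝 0) ∧
    ∀ n : ℕ, 0 < n →
      variance (fun y => biasConst m * (m : ℝ) ^ 2 * y) (lawY m n) / (n : ℝ) ^ 2 =
        (varConst m + ε n) / m + o n := by
  have : NeZero m := ⟨by omega⟩
  have hmr : (0 : ℝ) < m := by exact_mod_cast (show 0 < m by omega)
  have hI := I₀_pos hm
  have ht := (tendsto_varLap_fixed hm).div_const (I₀ m ^ 2)
  rw [zero_div] at ht
  refine ⟨fun n => if 0 < n then m * (varFun (profile (n / m)) m - varFun f m) / I₀ m ^ 2 else 0,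
    _, fun n => ?_, ht, fun n hn => ?_⟩
  · dsimp only
    split_ifs with hn
    · have hn' : (0 : ℝ) < n := by exact_mod_cast hn
      have h := (abs_varFun_profile_sub_le (div_pos hn' hmr) hm).2
      rw [abs_div, abs_mul, abs_of_pos hmr, abs_of_pos (pow_pos hI 2), div_le_iff₀ (pow_pos hI 2)]
      calc _ ≤ (m : ℝ) * (1e-3 / m * I₀ m ^ 2) := by gcongr
        _ = 1e-3 * I₀ m ^ 2 := by field_simp
    · norm_num
  · have hn' : (0 : ℝ) < n := by exact_mod_cast hn
    have hx : (0 : ℝ≥0) < n / m :=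
      div_pos (by exact_mod_cast hn) (by exact_mod_cast (show 0 < m by omega))
    have hv := variance_const_mul (biasConst m * (m : ℝ) ^ 2) id (lawY m n)
    simp only [id_eq] at hv
    dsimp only
    rw [hv, (variance_lawY hx hm n).2, if_pos hn]
    have hf : varFun f m = I₁ m - I₀ m ^ 2 := rfl
    rw [hf, biasConst, varConst]
    push_cast
    field_simp
    ring

end EHLL
theorem mainTheorem2 :
    -- the integrals and the second moments of `Y` exist
    (∀ m : ℕ, 2 ≤ m → IntegrableOn (fun u => EHLL.f u ^ m) (Set.Ioi 0)) ∧
    (∀ m : ℕ, 3 ≤ m → IntegrableOn (fun u => u * EHLL.f u ^ m) (Set.Ioi 0)) ∧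
    (∀ m : ℕ, 3 ≤ m → ∀ x : ℝ≥0, MemLp id 2 (EHLL.poissonLawY m (m * x))) ∧
    (∀ m : ℕ, 3 ≤ m → ∀ n : ℕ, MemLp id 2 (EHLL.lawY m n)) ∧
    -- the variance of `Y` in the Poisson model
    (∀ m : ℕ, 3 ≤ m → ∃ ε o : ℝ≥0 → ℝ,
      (∀ x, |ε x| ≤ 8.4e-5) ∧ Tendsto o atTop (𝓝 0) ∧
      ∀ x : ℝ≥0, 0 < x →
        variance id (EHLL.poissonLawY m (m * x)) =
          (x : ℝ) ^ 2 * ((∫ u in Set.Ioi (0 : ℝ), u * EHLL.f u ^ m)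
            - (∫ u in Set.Ioi (0 : ℝ), EHLL.f u ^ m) ^ 2 + ε x / m + o x)) ∧
    -- the expansions of the two Laplace integrals
    (∃ r : ℕ → ℝ, r =O[atTop] (fun m => ((m : ℝ) ^ 2)⁻¹) ∧
      ∀ m : ℕ, 2 ≤ m → EHLL.I₀ m =
        Real.log 8 / (2 * m) * (1 + 1 / m * (41 * Real.log 2 / 16 - 1) + r m)) ∧
    (∃ r : ℕ → ℝ, r =O[atTop] (fun m => ((m : ℝ) ^ 2)⁻¹) ∧
      ∀ m : ℕ, 3 ≤ m → EHLL.I₁ m =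
        (Real.log 8 / (2 * m)) ^ 2 * (1 + 3 / m * (41 * Real.log 2 / 16 - 1) + r m)) ∧
    -- the relative variance of the estimator `γ_m m² Y` for `n` distinct elements
    (∀ m : ℕ, 3 ≤ m → ∃ ε o : ℕ → ℝ,
      (∀ n, |ε n| ≤ 1e-3) ∧ Tendsto o atTop (𝓝 0) ∧
      ∀ n : ℕ, 0 < n →
        variance (fun y => EHLL.biasConst m * (m : ℝ) ^ 2 * y) (EHLL.lawY m n) / (n : ℝ) ^ 2 =
          (EHLL.varConst m + ε n) / m + o n) ∧
    -- the limits of the two constants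
    Tendsto EHLL.biasConst atTop (𝓝 (2 / (3 * Real.log 2))) ∧
    Tendsto EHLL.varConst atTop (𝓝 (41 * Real.log 2 / 16 - 1)) ∧
    |2 / (3 * Real.log 2) - 0.962| < 5e-4 ∧
    |41 * Real.log 2 / 16 - 1 - 0.776| < 5e-4 := by
  refine ⟨fun m hm => EHLL.majorised_f.integrableOn_pow hm,
    fun m hm => EHLL.majorised_f.integrableOn_mul_pow hm, fun m hm x => ?_, fun m hm n => ?_,
    fun m hm => EHLL.exists_variance_poissonLawY hm, ?_, ?_,
    fun m hm => EHLL.exists_variance_lawY hm, EHLL.tendsto_biasConst, EHLL.tendsto_varConst,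
    EHLL.abs_slope_const_lt, EHLL.abs_varLim_sub_lt⟩
  · have : NeZero m := ⟨by omega⟩
    exact EHLL.memLp_poissonLawY hm x
  · have : NeZero m := ⟨by omega⟩
    -- Finiteness of the moment does not depend on the auxiliary scale, so scale 1 also covers n =
    -- 0.
    exact (EHLL.variance_lawY one_pos hm n).1
  · obtain ⟨r, hr, h⟩ := EHLL.exists_I₀_expansion
    exact ⟨r, hr, fun m hm => h m (by omega)⟩
  · obtain ⟨r, hr, h⟩ := EHLL.exists_I₁_expansion
    exact ⟨r, hr, fun m hm => h m (by omega)⟩
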